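/- \textbf{Setting.} For $p\in\mathbb R^2$ write $p=(x(p),y(p))$. For a set $A$ of points with positive coordinates and $\varepsilon>0$, an \emph{$\varepsilon$-convex Pareto set} of $A$ is a subset $S\subseteq A$ such that for every $q\in A$ some convex combination $p$ of points of $S$ satisfies $p\le(1+\varepsilon)q$ coordinatewise; $\mathrm{OPT}_\varepsilon(A)$ is the minimum number of points of such a set. The ratio distance from $p$ to $q$ is $\mathcal{RD}(p,q)=\max\{x(q)/x(p)-1,\;y(q)/y(p)-1,\;0\}$, and $\mathcal{RD}(p,S)=\inf_{q\in S}\mathcal{RD}(p,q)$. An exact oracle $\mathrm{Comb}$ for a finite set $A$ returns, for each $\lambda\in[0,\infty)$, a point of $A$ minimizing $y+\lambda x$ over $A$, and, for $\lambda=+\infty$, a point of $A$ minimizing $x$; ties are broken arbitrarily. The \emph{Chord algorithm} computes $a=\mathrm{Comb}(+\infty)$, $b=\mathrm{Comb}(0)$, $c=(x(a),y(b))$ and calls $\mathrm{Chord}(a,b,c)$, where $\mathrm{Chord}(l,r,s)$ is the following recursive routine. If $\mathcal{RD}(s,lr)\le\varepsilon$ (here $lr$ is the segment), stop. Otherwise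 let $q=\mathrm{Comb}(\lambda_{lr})$ with $\lambda_{lr}$ the absolute slope of $lr$; if $\mathcal{RD}(q,lr)\le\varepsilon$, stop. Otherwise let $\ell(q)$ be the line through $q$ parallel to $lr$, let $s_l,s_r$ be its intersections with the lines $ls$ and $rs$, and call $\mathrm{Chord}(l,q,s_l)$ and $\mathrm{Chord}(q,r,s_r)$. Let $\mathrm{CHORD}_\varepsilon(A)$ be the total number of calls to $\mathrm{Comb}$ (including the first two). The \emph{performance ratio} on $A$ is $\mathrm{CHORD}_\varepsilon(A)/\mathrm{OPT}_\varepsilon(A)$. For $\gamma\in[0,1)$, a probability distribution $\mathcal D$ over a bounded measurable set $T\subseteq\mathbb R^2$ of positive area is \emph{$\gamma$-balanced} if $(1-\gamma)\,\mathcal U(B)\le\mathcal D(B)\le\mathcal U(B)/(1-\gamma)$ for all measurable $B\subseteq T$, where $\mathcal U$ is the uniform distribution over $T$. \textbf{Theorem.} Let $\gamma\in[0,1)$. There is a constant $C=C(\gamma)>0$ such that the following holds. Let $a,b$ be points with $0<x(a)<x(b)$ and $0<y(b)<y(a)$, let $c=(x(a),y(b))$, and let $T_1=\triangle(abc)$ be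 the (root) triangle. Let $\mathcal D$ be a $\gamma$-balanced distribution over $T_1$, let $\varepsilon>0$ and $n\ge0$, let $p_1,\dots,p_n$ be drawn independently from $\mathcal D$, and run the Chord algorithm with error $\varepsilon$ and any exact oracle on the instance $I=\{a,b,p_1,\dots,p_n\}$. Then the performance ratio is a random variable (measurable up to null sets), and 1. if $n\ge3$, then $$\mathbb E\left[\frac{\mathrm{CHORD}_\varepsilon(I)}{\mathrm{OPT}_\varepsilon(I)}\right]\le C\,\log\log n;$$ 2. if $m\ge1$ is an integer with $T_1\subseteq[2^{-m},2^m]^2$ and $\varepsilon\le1/3$, then, for every $n\ge 0$, $$\mathbb E\left[\frac{\mathrm{CHORD}_\varepsilon(I)}{\mathrm{OPT}_\varepsilon(I)}\right]\le C\,\bigl(\log m+\log\log(1/\varepsilon)\bigr).$$ -/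

import Mathlib

open MeasureTheory
open scoped ENNReal

noncomputable section

namespace Chord

/-- Points of the plane whose coordinates are the two objectives `x` and `y`. -/
abbrev Point : Type := ℝ × ℝ

/-! ### Ratio distance, convex Pareto sets and the optimum -/

/-- The ratio distance from `p` to `q` (for points with positive coordinates). -/
def ratioDist (p q : Point) : ℝ :=
  max (max (q.1 / p.1 - 1) (q.2 / p.2 - 1)) 0

/-- The ratio distance from a point `p` to a (nonempty) set `S`. -/
def ratioDistTo (p : Point) (S : Set Point) : ℝ :=
  ⨅ q : S, ratioDist p q

/-- `p` covers `q` up to a factor `1 + ε` in both coordinates. -/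
def Covers (ε : ℝ) (p q : Point) : Prop :=
  p.1 ≤ (1 + ε) * q.1 ∧ p.2 ≤ (1 + ε) * q.2

/-- `S` is an `ε`-convex Pareto set of `A`: a subset of `A` whose convex combinations
`ε`-cover every point of `A`. -/
def IsConvexPareto (ε : ℝ) (A S : Set Point) : Prop :=
  S ⊆ A ∧ ∀ q ∈ A, ∃ p ∈ convexHull ℝ S, Covers ε p q

/-- The minimum number of points of an `ε`-convex Pareto set of `A`. -/
def opt (ε : ℝ) (A : Set Point) : ℕ∞ :=
  ⨅ (S : Set Point) (_ : IsConvexPareto ε A S), S.encard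

/-! ### The `Comb` oracle -/

/-- The combined objective `y + lam * x`; for `lam = ∞` it is the `x` objective. -/
def combObjective (lam : ℝ≥0∞) (p : Point) : ℝ :=
  if lam = ⊤ then p.1 else p.2 + lam.toReal * p.1

/-- `comb` is an exact `Comb` oracle for the objective space `A`: for every
`lam ∈ [0, ∞]` it returns a point of `A` that minimizes the combined objective
(ties are broken arbitrarily). -/
def IsComb (A : Set Point) (comb : ℝ≥0∞ → Point) : Prop :=
  ∀ lam, comb lam ∈ A ∧ ∀ p ∈ A, combObjective lam (comb lam) ≤ combObjective lam p

/-! ### The Chord algorithm -/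

/-- The absolute slope of the line through `l` (left, above) and `r` (right, below). -/
def slope (l r : Point) : ℝ≥0∞ :=
  ENNReal.ofReal ((l.2 - r.2) / (r.1 - l.1))

/-- The two-dimensional cross product. -/
def cross (v w : Point) : ℝ := v.1 * w.2 - v.2 * w.1

/-- The intersection of the line through `u` and `v` with the line through `q` of
direction `w` (for lines that are not parallel). -/
def meet (u v q w : Point) : Point :=
  u + (cross w (q - u) / cross w (v - u)) • (v - u)

open Classical in
/-- The number of `Comb` calls that the recursive routine, started on the triangle with
left point `l`, right point `r` and third point `s`, makes in the first `d` levels of its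
recursion tree. -/
def callsUpTo (comb : ℝ≥0∞ → Point) (ε : ℝ) : ℕ → Point → Point → Point → ℕ
  | 0, _, _, _ => 0
  | d + 1, l, r, s =>
    if ratioDistTo s (segment ℝ l r) ≤ ε then 0
    else
      let q := comb (slope l r)
      if ratioDistTo q (segment ℝ l r) ≤ ε then 1
      else
        1 + callsUpTo comb ε d l q (meet l s q (r - l))
          + callsUpTo comb ε d q r (meet r s q (r - l))

/-- The total number of `Comb` calls of the Chord algorithm with oracle `comb` and error
`ε`: the two initial calls, which give `a` and `b`, and the calls of the recursive routine
on the root triangle with vertices `a`, `b` and `(x(a), y(b))`. -/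
def calls (comb : ℝ≥0∞ → Point) (ε : ℝ) : ℕ∞ :=
  let a := comb ⊤
  let b := comb 0
  2 + ⨆ d : ℕ, (callsUpTo comb ε d a b (a.1, b.2) : ℕ∞)

/-- The performance ratio of the Chord algorithm on the objective space `A`, accessed
through the oracle `comb`. -/
def perfRatio (ε : ℝ) (A : Set Point) (comb : ℝ≥0∞ → Point) : ℝ≥0∞ :=
  (calls comb ε : ℝ≥0∞) / (opt ε A : ℝ≥0∞)

/-! ### Random instances -/

/-- The root triangle with left vertex `a`, right vertex `b` and third vertex
`(x(a), y(b))`. -/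
def rootTriangle (a b : Point) : Set Point :=
  convexHull ℝ {a, b, (a.1, b.2)}

/-- The instance formed by the vertices `a`, `b` of the root triangle and the `n` points
`p i` that are inserted into it. -/
def inst (a b : Point) {n : ℕ} (p : Fin n → Point) : Set Point :=
  {a, b} ∪ Set.range p

/-- The distribution `D` over `A` is `γ`-balanced; `ProbabilityTheory.cond volume A` is the
uniform distribution over `A`. -/
structure IsBalanced (γ : ℝ) (A : Set Point) (D : Measure Point) : Prop where
  prob : IsProbabilityMeasure D
  supported : D Aᶜ = 0
  lower : ∀ B ⊆ A, MeasurableSet B →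
    ENNReal.ofReal (1 - γ) * ProbabilityTheory.cond volume A B ≤ D B
  upper : ∀ B ⊆ A, MeasurableSet B →
    D B ≤ ProbabilityTheory.cond volume A B / ENNReal.ofReal (1 - γ)

end Chord

end

/-! Let `q` be the extreme point found in a triangle `T`, and let `t` (`Tri.depthRatio`) be one
minus its normalized weight on the bottom vertex. The corner of `T` beyond `q` contains a copy of
`T` scaled by `t`, so it has at least `t ^ 2` of the volume of `T`; the two children of `T` have
together at most `2 * t` of it. Since `2 * t ≤ lam * t ^ 2 + 1 / lam`, the mass of the children is
at most `c * lam` times the mass of the corner plus `c / lam` times the mass of `T`, with `c = (1 -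
γ)⁻²` (`VolumeComparable.children_le`).

Now redraw one of the `k` points of `T` with the others fixed. If it falls in the corner beyond the
extreme point of the others, it is itself the extreme point of all, and only one point can be.
Summing over the points, the expected number of points in the children is at most `c * lam + c / lam
* k` (`lmarginal_sum_isExtreme_le`), which is of order `√k` for `lam = √k`. Given the rest, the
points in a child are again independent in it (`lmarginal_child_le`), so the bound iterates. As the
sizes of the children are random, one propagates bounds affine in `k`, with a `lam` that depends on
the level only: `L` levels in which counts drop like square roots, followed by `L` levels of
geometric decay that cancel the factor `(2 + c) ^ L` accumulated meanwhile. For `n ≤ 2 ^ (2 ^ L)`,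
the expected number of points left in triangles with more than `B = B(γ)` points is at most `4`
after `2 * L` levels (`remaining_le`).

A triangle on which the routine recurses contains a point of every `ε`-convex Pareto set
(`Valid.exists_mem_interior`), and the triangles of one level are disjoint. So each level costs
`O(OPT)`, triangles with at most `B` points cost `O(B)` per point of the solution, and the points
that remain cost `O(1)` each (`Valid.callsIn_le_remaining`). This gives `log log n`.

For the bound free of `n`, suppose that `log n` exceeds a suitable multiple of `m + log (1 / ε)`.
Then the first extreme point is in expectation so close to the bottom vertex that the areas of its
two children are of the order of the least area of a triangle on which the routine does not stop at
once, so the expected ratio is bounded (`lintegral_perfRatio_le_const`). For smaller `n` the first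
bound applies.

Almost surely no two chords are parallel; then ties are irrelevant and the ratio agrees with a
measurable function of the points. -/

noncomputable section

namespace Chord

/-! ### Triangles and barycentric weights -/

/-- A triangle of the recursion: left vertex, right vertex, bottom vertex. -/
abbrev Tri : Type := Point × Point × Point

namespace Tri

/-- Twice the signed area of a triangle. -/
def area (T : Tri) : ℝ := cross (T.2.2 - T.1) (T.2.1 - T.1)

/-- The unnormalized barycentric weight of the left vertex. -/
def wl (T : Tri) (z : Point) : ℝ := cross (T.2.1 - T.2.2) (z - T.2.2)

/-- The unnormalized barycentric weight of the right vertex. -/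
def wr (T : Tri) (z : Point) : ℝ := cross (T.2.2 - T.1) (z - T.1)

/-- The unnormalized barycentric weight of the bottom vertex. -/
def wb (T : Tri) (z : Point) : ℝ := cross (z - T.1) (T.2.1 - T.1)

/-- The open triangle. -/
def interior (T : Tri) : Set Point := {z | 0 < T.wl z ∧ 0 < T.wr z ∧ 0 < T.wb z}

/-- The triangle of the left recursive call, when `q` is the point found. -/
def left (T : Tri) (q : Point) : Tri := (T.1, q, T.1 + (T.wb q / T.area) • (T.2.2 - T.1))

/-- The triangle of the right recursive call, when `q` is the point found. -/
def right (T : Tri) (q : Point) : Tri := (q, T.2.1, T.2.1 + (T.wb q / T.area) • (T.2.2 - T.2.1))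

/-- The part of `q`'s weight that is not on the bottom vertex. -/
def depthRatio (T : Tri) (q : Point) : ℝ := 1 - T.wb q / T.area

lemma wl_add_wr_add_wb (T : Tri) (z : Point) : T.wl z + T.wr z + T.wb z = T.area := by
  simp only [wl, wr, wb, area, cross, Prod.fst_sub, Prod.snd_sub]; ring

lemma area_pos_of_mem {T : Tri} {z : Point} (hz : z ∈ T.interior) : 0 < T.area := by
  rw [← T.wl_add_wr_add_wb z]; obtain ⟨h1, h2, h3⟩ := hz; positivity

@[simp] lemma wb_left_vertex (T : Tri) : T.wb T.1 = 0 := by simp [wb, cross]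
@[simp] lemma wr_left_vertex (T : Tri) : T.wr T.1 = 0 := by simp [wr, cross]
@[simp] lemma wb_right_vertex (T : Tri) : T.wb T.2.1 = 0 := by
  simp only [wb, cross]; ring
@[simp] lemma wl_right_vertex (T : Tri) : T.wl T.2.1 = 0 := by
  simp only [wl, cross]; ring
lemma wb_bottom_vertex (T : Tri) : T.wb T.2.2 = T.area := rfl

/-! Weights with respect to the two children. -/

lemma wr_left (T : Tri) (q z : Point) :
    (T.left q).wr z = T.wb q / T.area * T.wr z := by
  simp only [left, wr, cross, Prod.fst_sub, Prod.snd_sub, Prod.fst_add, Prod.snd_add,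
    Prod.smul_fst, Prod.smul_snd, smul_eq_mul]; ring

lemma smul_sub_left_bottom (T : Tri) (q : Point) :
    T.area • (q - T.1) - T.wb q • (T.2.2 - T.1) = T.wr q • (T.2.1 - T.1) := by
  ext <;>
  simp only [area, wr, wb, cross, Prod.fst_sub, Prod.snd_sub, Prod.smul_fst, Prod.smul_snd,
    smul_eq_mul] <;> ring

lemma smul_sub_right_bottom (T : Tri) (q : Point) :
    T.area • (q - T.2.1) - T.wb q • (T.2.2 - T.2.1) = -(T.wl q • (T.2.1 - T.1)) := by
  ext <;>
  simp only [area, wl, wb, cross, Prod.fst_sub, Prod.snd_sub, Prod.smul_fst, Prod.smul_snd,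
    smul_eq_mul, Prod.fst_neg, Prod.snd_neg] <;> ring

lemma sub_bottom_left (T : Tri) (hT : T.area ≠ 0) (q : Point) :
    q - (T.left q).2.2 = (T.wr q / T.area) • (T.2.1 - T.1) := by
  have h := congrArg (fun v => (T.area)⁻¹ • v) (T.smul_sub_left_bottom q)
  simp only [smul_sub, smul_smul, inv_mul_cancel₀ hT, one_smul] at h
  simp only [left, div_eq_inv_mul, smul_sub]
  rw [← h]; abel

lemma sub_bottom_right (T : Tri) (hT : T.area ≠ 0) (q : Point) :
    (T.right q).2.2 - q = (T.wl q / T.area) • (T.2.1 - T.1) := by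
  have h := congrArg (fun v => (T.area)⁻¹ • v) (T.smul_sub_right_bottom q)
  simp only [smul_sub, smul_neg, smul_smul, inv_mul_cancel₀ hT, one_smul] at h
  simp only [right, div_eq_inv_mul, smul_sub]
  rw [eq_comm, neg_eq_iff_eq_neg] at h
  rw [h]; abel

lemma cross_chord (T : Tri) (z q : Point) :
    cross (T.2.1 - T.1) (z - q) = T.wb q - T.wb z := by
  simp only [wb, cross, Prod.fst_sub, Prod.snd_sub]; ring

lemma cross_smul_left (c : ℝ) (v w : Point) : cross (c • v) w = c * cross v w := by
  simp only [cross, Prod.smul_fst, Prod.smul_snd, smul_eq_mul]; ring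

lemma wb_line (T : Tri) (u v : Point) (t : ℝ) :
    T.wb (u + t • (v - u)) = (1 - t) * T.wb u + t * T.wb v := by
  simp only [wb, cross, Prod.fst_sub, Prod.snd_sub, Prod.fst_add, Prod.snd_add,
    Prod.smul_fst, Prod.smul_snd, smul_eq_mul]; ring

lemma wl_line (T : Tri) (u v : Point) (t : ℝ) :
    T.wl (u + t • (v - u)) = (1 - t) * T.wl u + t * T.wl v := by
  simp only [wl, cross, Prod.fst_sub, Prod.snd_sub, Prod.fst_add, Prod.snd_add,
    Prod.smul_fst, Prod.smul_snd, smul_eq_mul]; ring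

lemma wr_line (T : Tri) (u v : Point) (t : ℝ) :
    T.wr (u + t • (v - u)) = (1 - t) * T.wr u + t * T.wr v := by
  simp only [wr, cross, Prod.fst_sub, Prod.snd_sub, Prod.fst_add, Prod.snd_add,
    Prod.smul_fst, Prod.smul_snd, smul_eq_mul]; ring

lemma wb_bottom_left (T : Tri) (hT : T.area ≠ 0) (q : Point) :
    T.wb (T.left q).2.2 = T.wb q := by
  simp only [left, wb_line, wb_left_vertex, wb_bottom_vertex]; field_simp; ring

lemma wl_left (T : Tri) (hT : T.area ≠ 0) (q z : Point) :
    (T.left q).wl z = T.wr q / T.area * (T.wb q - T.wb z) := by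
  rw [wl, show (T.left q).2.1 = q from rfl, sub_bottom_left T hT, cross_smul_left, cross_chord,
    wb_bottom_left T hT]

lemma wr_right (T : Tri) (hT : T.area ≠ 0) (q z : Point) :
    (T.right q).wr z = T.wl q / T.area * (T.wb q - T.wb z) := by
  rw [wr, show (T.right q).1 = q from rfl, sub_bottom_right T hT, cross_smul_left, cross_chord]

lemma area_left (T : Tri) (q : Point) :
    (T.left q).area = T.wb q / T.area * T.wr q := wr_left T q q

lemma wl_right (T : Tri) (q z : Point) :
    (T.right q).wl z = T.wb q / T.area * T.wl z := by
  simp only [right, wl, cross, Prod.fst_sub, Prod.snd_sub, Prod.fst_add, Prod.snd_add,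
    Prod.smul_fst, Prod.smul_snd, smul_eq_mul]; ring

lemma area_eq_wl (T : Tri) : T.area = T.wl T.1 := by
  simp only [wl, area, cross, Prod.fst_sub, Prod.snd_sub]; ring

lemma area_right (T : Tri) (q : Point) :
    (T.right q).area = T.wb q / T.area * T.wl q := by
  rw [area_eq_wl, wl_right]; rfl

/-- The recursion's line intersections are the bottom vertices of the children. -/
lemma meet_left (T : Tri) (q : Point) :
    meet T.1 T.2.2 q (T.2.1 - T.1) = (T.left q).2.2 := by
  have h1 : cross (T.2.1 - T.1) (q - T.1) = -T.wb q := by simp only [wb, cross]; ring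
  have h2 : cross (T.2.1 - T.1) (T.2.2 - T.1) = -T.area := by simp only [area, cross]; ring
  rw [meet, h1, h2, neg_div_neg_eq]; rfl

lemma meet_right (T : Tri) (q : Point) :
    meet T.2.1 T.2.2 q (T.2.1 - T.1) = (T.right q).2.2 := by
  have h1 : cross (T.2.1 - T.1) (q - T.2.1) = -T.wb q := by
    simp only [wb, cross, Prod.fst_sub, Prod.snd_sub]; ring
  have h2 : cross (T.2.1 - T.1) (T.2.2 - T.2.1) = -T.area := by
    simp only [area, cross, Prod.fst_sub, Prod.snd_sub]; ring
  rw [meet, h1, h2, neg_div_neg_eq]; rfl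

/-- The weights of the child are explicit in those of `T`. Strict inequality in `wb` is what keeps
`q`, and every point as deep as `q`, out of the child; the inequality in `wr` separates it from the
right child, where `wl` is bounded by `T.wl q`. -/
lemma left_interior_subset {T : Tri} {q : Point} (hq : q ∈ T.interior) :
    (T.left q).interior ⊆ {z | z ∈ T.interior ∧ T.wb z < T.wb q ∧ T.wr z < T.wr q} := by
  have hT := area_pos_of_mem hq
  obtain ⟨hql, hqr, hqb⟩ := hq
  have hω : 0 < T.wb q / T.area := div_pos hqb hT
  rintro z ⟨h1, h2, h3⟩
  have hsum := (T.left q).wl_add_wr_add_wb z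
  rw [area_left] at hsum
  rw [wl_left T hT.ne'] at h1 hsum
  rw [wr_left] at h2 hsum
  have hb : T.wb z < T.wb q := by
    have := (pos_iff_pos_of_mul_pos h1).1 (div_pos hqr hT); linarith
  have hr : 0 < T.wr z := (pos_iff_pos_of_mul_pos h2).1 hω
  have hrq : T.wr z < T.wr q := by
    refine lt_of_mul_lt_mul_left ?_ hω.le
    linarith
  -- The chord of the child is the side from the left vertex to `q`, so `z` is below it when the
  -- ratio of `wb` to `wr` is larger at `z` than at `q`; this forces `0 < T.wb z`.
  have e1 : (T.left q).wb z * T.area = T.wr q * T.wb z - T.wr z * T.wb q := by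
    simp only [left, area, wr, wb, cross, Prod.fst_sub, Prod.snd_sub]; ring
  have e2 := T.wl_add_wr_add_wb z
  have e3 := T.wl_add_wr_add_wb q
  have hbz : 0 < T.wb z := by
    have : 0 < T.wr q * T.wb z := by
      have := mul_pos h3 hT
      have := mul_pos hr hqb
      linarith
    exact (pos_iff_pos_of_mul_pos this).1 hqr
  exact ⟨⟨by linarith, hr, hbz⟩, hb, hrq⟩

lemma right_interior_subset {T : Tri} {q : Point} (hq : q ∈ T.interior) :
    (T.right q).interior ⊆ {z | z ∈ T.interior ∧ T.wb z < T.wb q ∧ T.wl z < T.wl q} := by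
  have hT := area_pos_of_mem hq
  obtain ⟨hql, hqr, hqb⟩ := hq
  have hω : 0 < T.wb q / T.area := div_pos hqb hT
  rintro z ⟨h2, h1, h3⟩
  have hsum := (T.right q).wl_add_wr_add_wb z
  rw [area_right] at hsum
  rw [wr_right T hT.ne'] at h1 hsum
  rw [wl_right] at h2 hsum
  have hb : T.wb z < T.wb q := by
    have := (pos_iff_pos_of_mul_pos h1).1 (div_pos hql hT); linarith
  have hr : 0 < T.wl z := (pos_iff_pos_of_mul_pos h2).1 hω
  have hrq : T.wl z < T.wl q := by
    refine lt_of_mul_lt_mul_left ?_ hω.le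
    linarith
  have e1 : (T.right q).wb z * T.area = T.wl q * T.wb z - T.wl z * T.wb q := by
    simp only [right, area, wl, wb, cross, Prod.fst_sub, Prod.snd_sub]; ring
  have e2 := T.wl_add_wr_add_wb z
  have e3 := T.wl_add_wr_add_wb q
  have hbz : 0 < T.wb z := by
    have : 0 < T.wl q * T.wb z := by
      have := mul_pos h3 hT
      have := mul_pos hr hqb
      linarith
    exact (pos_iff_pos_of_mul_pos this).1 hql
  exact ⟨⟨hr, by linarith, hbz⟩, hb, hrq⟩

lemma disjoint_left_right {T : Tri} {q : Point} (hq : q ∈ T.interior) :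
    Disjoint (T.left q).interior (T.right q).interior := by
  refine Set.disjoint_left.2 fun z hz hz' => ?_
  obtain ⟨_, h1, h2⟩ := left_interior_subset hq hz
  obtain ⟨_, _, h3⟩ := right_interior_subset hq hz'
  have e2 := T.wl_add_wr_add_wb z
  have e3 := T.wl_add_wr_add_wb q
  linarith

/-- With `ω = T.wb q / T.area`, the children take the fraction `ω * (1 - ω)` of the area. For `q`
inside `T` this is at most `1 / 4`, which makes the areas sum geometrically, and at most `1 - ω`,
which is small for deep `q`. -/
lemma area_left_add_area_right (T : Tri) (q : Point) :
    (T.left q).area + (T.right q).area = T.wb q / T.area * (T.area - T.wb q) := by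
  have := T.wl_add_wr_add_wb q
  rw [area_left, area_right, ← mul_add, show T.wr q + T.wl q = T.area - T.wb q by linarith]

end Tri
end Chord
end

noncomputable section

namespace Chord

/-! ### Volumes of pieces of a triangle and balanced distributions -/

namespace Tri

@[fun_prop] lemma continuous_wl (T : Tri) : Continuous T.wl := by
  unfold wl cross; fun_prop
@[fun_prop] lemma continuous_wr (T : Tri) : Continuous T.wr := by
  unfold wr cross; fun_prop
@[fun_prop] lemma continuous_wb (T : Tri) : Continuous T.wb := by
  unfold wb cross; fun_prop

lemma isOpen_interior (T : Tri) : IsOpen T.interior :=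
  (isOpen_lt continuous_const T.continuous_wl).inter
    ((isOpen_lt continuous_const T.continuous_wr).inter
      (isOpen_lt continuous_const T.continuous_wb))

lemma measurableSet_interior (T : Tri) : MeasurableSet T.interior :=
  T.isOpen_interior.measurableSet

lemma volume_homothety (c : Point) (t : ℝ) (S : Set Point) :
    volume ((fun z => c + t • (z - c)) '' S) = ENNReal.ofReal (t ^ 2) * volume S := by
  have h := Measure.addHaar_image_homothety (volume : Measure Point) c t S
  have e : (fun z => c + t • (z - c)) = ⇑(AffineMap.homothety c t) := by
    ext z <;> simp [AffineMap.homothety_apply] <;> ring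
  rw [e, h]
  simp [abs_of_nonneg (sq_nonneg t)]

/-- The homothety at the bottom vertex with ratio `T.depthRatio q` maps the triangle into the
corner, because it sends the chord to the parallel through `q`. -/
lemma volume_corner {T : Tri} {q : Point} (hq : q ∈ T.interior) :
    ENNReal.ofReal (T.depthRatio q ^ 2) * volume T.interior
      ≤ volume {z | z ∈ T.interior ∧ T.wb q < T.wb z} := by
  have hT := area_pos_of_mem hq
  have hsum := T.wl_add_wr_add_wb q
  obtain ⟨hql, hqr, hqb⟩ := hq
  have hδ : 0 < T.depthRatio q := by
    rw [depthRatio, sub_pos, div_lt_one hT]; linarith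
  have hδ' : T.depthRatio q < 1 := by
    have := div_pos hqb hT
    rw [depthRatio]; linarith
  have hA : (1 - T.depthRatio q) * T.area = T.wb q := by
    rw [depthRatio]; field_simp; ring
  rw [← volume_homothety T.2.2]
  refine measure_mono ?_
  rintro _ ⟨z, ⟨h1, h2, h3⟩, rfl⟩
  have e1 : T.wl T.2.2 = 0 := by simp [wl, cross]
  have e2 : T.wr T.2.2 = 0 := by simp only [wr, cross]; ring
  refine ⟨⟨?_, ?_, ?_⟩, ?_⟩
  · rw [wl_line, e1]; have := mul_pos hδ h1; linarith
  · rw [wr_line, e2]; have := mul_pos hδ h2; linarith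
  · rw [wb_line, wb_bottom_vertex, hA]; have := mul_pos hδ h3; linarith
  · rw [wb_line, wb_bottom_vertex, hA]; have := mul_pos hδ h3; linarith

/-- A part of a triangle whose complement contains a copy scaled by `1 - t` has at most
`2 t` times its volume. -/
lemma volume_le_of_homothety {T : Tri} (hfin : volume T.interior ≠ ⊤) (c : Point) {t : ℝ}
    (ht : 0 ≤ t) {P : Set Point} (hPm : MeasurableSet P) (hP : P ⊆ T.interior)
    (h : ∀ z ∈ T.interior, c + (1 - t) • (z - c) ∈ T.interior \ P) :
    volume P ≤ ENNReal.ofReal (2 * t) * volume T.interior := by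
  have h1 : ENNReal.ofReal ((1 - t) ^ 2) * volume T.interior ≤ volume (T.interior \ P) := by
    rw [← volume_homothety c]
    exact measure_mono (by rintro _ ⟨z, hz, rfl⟩; exact h z hz)
  have h2 := measure_sdiff_add_inter (μ := volume) T.interior hPm
  rw [Set.inter_eq_right.2 hP] at h2
  have h3 : volume T.interior ≤ ENNReal.ofReal ((1 - t) ^ 2) * volume T.interior
      + ENNReal.ofReal (2 * t) * volume T.interior := by
    rw [← add_mul, ← ENNReal.ofReal_add (by positivity) (by positivity)]
    -- `(1 - t) ^ 2 + 2 * t = 1 + t ^ 2`.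
    refine le_mul_of_one_le_left zero_le (ENNReal.one_le_ofReal.2 (by nlinarith))
  have h4 : volume (T.interior \ P) ≠ ⊤ := ne_top_of_le_ne_top hfin (measure_mono Set.sdiff_subset)
  have h5 : volume (T.interior \ P) + volume P
      ≤ volume (T.interior \ P) + ENNReal.ofReal (2 * t) * volume T.interior := by
    calc _ = volume T.interior := h2
      _ ≤ _ := h3
      _ ≤ _ := by gcongr
  exact (ENNReal.add_le_add_iff_left h4).1 h5

/-- Contract towards the right vertex by `1 - T.wr q / T.area`: the image has `wr` above `T.wr q`,
whereas the left child has it below. The exact ratio of areas is smaller, but this is all that the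
comparison with the corner needs. -/
lemma volume_left {T : Tri} {q : Point} (hq : q ∈ T.interior) (hfin : volume T.interior ≠ ⊤) :
    volume (T.left q).interior
      ≤ ENNReal.ofReal (2 * (T.wr q / T.area)) * volume T.interior := by
  have hT := area_pos_of_mem hq
  have hsub := left_interior_subset hq
  have hsum := T.wl_add_wr_add_wb q
  obtain ⟨hql, hqr, hqb⟩ := hq
  have h0 : 0 < T.wr q / T.area := div_pos hqr hT
  have h1 : T.wr q / T.area < 1 := by rw [div_lt_one hT]; linarith
  have h2 : T.wr q / T.area * T.area = T.wr q := by field_simp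
  refine volume_le_of_homothety hfin T.2.1 h0.le (measurableSet_interior _)
    (fun z hz => (hsub hz).1) fun z ⟨z1, z2, z3⟩ => ⟨⟨?_, ?_, ?_⟩, fun hz => ?_⟩
  · rw [wl_line, wl_right_vertex]; have := mul_pos (sub_pos.2 h1) z1; linarith
  · rw [wr_line, show T.wr T.2.1 = T.area from rfl]; have := mul_pos (sub_pos.2 h1) z2
    linarith
  · rw [wb_line, wb_right_vertex]; have := mul_pos (sub_pos.2 h1) z3; linarith
  · have h3 := (hsub hz).2.2
    rw [wr_line, show T.wr T.2.1 = T.area from rfl] at h3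
    have := mul_pos (sub_pos.2 h1) z2
    linarith

lemma volume_right {T : Tri} {q : Point} (hq : q ∈ T.interior) (hfin : volume T.interior ≠ ⊤) :
    volume (T.right q).interior
      ≤ ENNReal.ofReal (2 * (T.wl q / T.area)) * volume T.interior := by
  have hT := area_pos_of_mem hq
  have hsub := right_interior_subset hq
  have hsum := T.wl_add_wr_add_wb q
  obtain ⟨hql, hqr, hqb⟩ := hq
  have h0 : 0 < T.wl q / T.area := div_pos hql hT
  have h1 : T.wl q / T.area < 1 := by rw [div_lt_one hT]; linarith
  have h2 : T.wl q / T.area * T.area = T.wl q := by field_simp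
  refine volume_le_of_homothety hfin T.1 h0.le (measurableSet_interior _)
    (fun z hz => (hsub hz).1) fun z ⟨z1, z2, z3⟩ => ⟨⟨?_, ?_, ?_⟩, fun hz => ?_⟩
  · rw [wl_line, ← area_eq_wl]; have := mul_pos (sub_pos.2 h1) z1; linarith
  · rw [wr_line, wr_left_vertex]; have := mul_pos (sub_pos.2 h1) z2; linarith
  · rw [wb_line, wb_left_vertex]; have := mul_pos (sub_pos.2 h1) z3; linarith
  · have h3 := (hsub hz).2.2
    rw [wl_line, ← area_eq_wl] at h3
    have := mul_pos (sub_pos.2 h1) z1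
    linarith

lemma depthRatio_eq (T : Tri) (hT : T.area ≠ 0) (q : Point) :
    T.depthRatio q = T.wr q / T.area + T.wl q / T.area := by
  rw [depthRatio, ← T.wl_add_wr_add_wb q] at *; field_simp; ring

lemma depthRatio_pos {T : Tri} {q : Point} (hq : q ∈ T.interior) : 0 < T.depthRatio q := by
  have hT := area_pos_of_mem hq
  rw [T.depthRatio_eq hT.ne']
  exact add_pos (div_pos hq.2.1 hT) (div_pos hq.1 hT)

end Tri

/-- A measure `D` for which the mass of subsets of the interior of any triangle inside `R` is
comparable to a multiple `κ` of the volume, up to the factor `1 - γ` in both directions. -/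
structure VolumeComparable (g : ℝ≥0∞) (R : Set Point) (D : Measure Point) (κ : ℝ≥0∞) : Prop where
  lower : ∀ B ⊆ R, MeasurableSet B → g * (κ * volume B) ≤ D B
  upper : ∀ B ⊆ R, MeasurableSet B → D B ≤ κ * volume B / g

lemma IsBalanced.volumeComparable {γ : ℝ} {R : Set Point} {D : Measure Point}
    (h : IsBalanced γ R D) (hR : MeasurableSet R) :
    VolumeComparable (ENNReal.ofReal (1 - γ)) R D (volume R)⁻¹ := by
  have e : ∀ B ⊆ R, ProbabilityTheory.cond volume R B = (volume R)⁻¹ * volume B := fun B hB => by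
    rw [ProbabilityTheory.cond_apply hR, Set.inter_eq_right.2 hB]
  exact ⟨fun B hB hm => by rw [← e B hB]; exact h.lower B hB hm,
    fun B hB hm => by rw [← e B hB]; exact h.upper B hB hm⟩

/-- `2 t ≤ lam * t ^ 2 + 1 / lam`, scaled by `κ V` and by the density bounds. -/
lemma VolumeComparable.le_of_corner {γ : ℝ} (hγ1 : γ < 1) {R : Set Point}
    {D : Measure Point} {κ : ℝ≥0∞} (h : VolumeComparable (ENNReal.ofReal (1 - γ)) R D κ)
    {T : Tri} (hTR : T.interior ⊆ R) {q : Point} (hq : q ∈ T.interior) {lam : ℝ} (hlam : 0 < lam) :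
    κ * (ENNReal.ofReal (2 * T.depthRatio q) * volume T.interior) / ENNReal.ofReal (1 - γ)
      ≤ ENNReal.ofReal (((1 - γ) ^ 2)⁻¹ * lam) * D {z | z ∈ T.interior ∧ T.wb q < T.wb z}
        + ENNReal.ofReal (((1 - γ) ^ 2)⁻¹ / lam) * D T.interior := by
  set t := T.depthRatio q
  have ht : 0 < t := Tri.depthRatio_pos hq
  have hg : 0 < 1 - γ := by linarith
  have hm : MeasurableSet {z | z ∈ T.interior ∧ T.wb q < T.wb z} :=
    T.measurableSet_interior.inter (isOpen_lt continuous_const T.continuous_wb).measurableSet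
  have h1 := h.lower _ (fun z hz => hTR hz.1) hm
  have h2 := h.lower _ hTR T.measurableSet_interior
  have h3 := Tri.volume_corner hq
  set V := volume T.interior
  calc κ * (ENNReal.ofReal (2 * t) * V) / ENNReal.ofReal (1 - γ)
      ≤ κ * (ENNReal.ofReal (lam * t ^ 2 + 1 / lam) * V) / ENNReal.ofReal (1 - γ) := by
        gcongr
        have : lam * t ^ 2 + 1 / lam - 2 * t = (lam * t - 1) ^ 2 / lam := by field_simp; ring
        have : 0 ≤ (lam * t - 1) ^ 2 / lam := by positivity
        linarith
    _ = ENNReal.ofReal ((1 - γ)⁻¹ * (lam * t ^ 2 + 1 / lam)) * (κ * V) := by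
        rw [ENNReal.ofReal_mul (by positivity), ENNReal.ofReal_inv_of_pos hg, ENNReal.div_eq_inv_mul]
        ring
    -- One factor `(1 - γ)⁻¹` comes from the upper density bound; the second pays for the factor `1
    -- - γ` with which the lower bound turns volumes back into masses.
    _ = ENNReal.ofReal (((1 - γ) ^ 2)⁻¹ * lam) * (ENNReal.ofReal (1 - γ) *
          (κ * (ENNReal.ofReal (t ^ 2) * V)))
        + ENNReal.ofReal (((1 - γ) ^ 2)⁻¹ / lam) * (ENNReal.ofReal (1 - γ) * (κ * V)) := by
        have : (1 - γ)⁻¹ * (lam * t ^ 2 + 1 / lam) =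
          ((1 - γ) ^ 2)⁻¹ * lam * (1 - γ) * t ^ 2 + ((1 - γ) ^ 2)⁻¹ / lam * (1 - γ) := by
          field_simp
        rw [this, ENNReal.ofReal_add (by positivity) (by positivity),
          ENNReal.ofReal_mul (by positivity), ENNReal.ofReal_mul (q := 1 - γ) (by positivity),
          ENNReal.ofReal_mul (p := ((1 - γ) ^ 2)⁻¹ / lam) (by positivity)]
        ring
    _ ≤ _ := by
        gcongr
        · exact le_trans (by gcongr) h1

/-- The fractions bounding the two children are `2 * (wr q / area)` and `2 * (wl q / area)`, and
they add up to `2 * T.depthRatio q`. -/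
lemma VolumeComparable.children_le {γ : ℝ} (hγ1 : γ < 1) {R : Set Point}
    {D : Measure Point} {κ : ℝ≥0∞} (h : VolumeComparable (ENNReal.ofReal (1 - γ)) R D κ)
    {T : Tri} (hTR : T.interior ⊆ R) (hfin : volume T.interior ≠ ⊤) {q : Point}
    (hq : q ∈ T.interior) {lam : ℝ} (hlam : 0 < lam) :
    D (T.left q).interior + D (T.right q).interior
      ≤ ENNReal.ofReal (((1 - γ) ^ 2)⁻¹ * lam) * D {z | z ∈ T.interior ∧ T.wb q < T.wb z}
        + ENNReal.ofReal (((1 - γ) ^ 2)⁻¹ / lam) * D T.interior := by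
  refine le_trans ?_ (h.le_of_corner hγ1 hTR hq hlam)
  have hT := Tri.area_pos_of_mem hq
  have hl := h.upper _ (fun z hz => hTR (Tri.left_interior_subset hq hz).1)
    (Tri.measurableSet_interior _)
  have hr := h.upper _ (fun z hz => hTR (Tri.right_interior_subset hq hz).1)
    (Tri.measurableSet_interior _)
  refine (add_le_add hl hr).trans ?_
  rw [← ENNReal.add_div, ← mul_add]
  gcongr
  refine (add_le_add (Tri.volume_left hq hfin) (Tri.volume_right hq hfin)).trans ?_
  have a1 := div_pos hq.2.1 hT
  have a2 := div_pos hq.1 hT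
  rw [← add_mul, ← ENNReal.ofReal_add (by positivity) (by positivity), ← mul_add,
    ← T.depthRatio_eq hT.ne']

/-- The same trade-off for the depth ratio itself; it controls how far from the bottom vertex the
first point found is. -/
lemma VolumeComparable.depthRatio_mul_le {γ : ℝ} (hγ1 : γ < 1) {R : Set Point}
    {D : Measure Point} {κ : ℝ≥0∞} (h : VolumeComparable (ENNReal.ofReal (1 - γ)) R D κ)
    {T : Tri} (hTR : T.interior ⊆ R) {q : Point}
    (hq : q ∈ T.interior) {lam : ℝ} (hlam : 0 < lam) :
    ENNReal.ofReal (T.depthRatio q) * D T.interior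
      ≤ ENNReal.ofReal (((1 - γ) ^ 2)⁻¹ * lam) * D {z | z ∈ T.interior ∧ T.wb q < T.wb z}
        + ENNReal.ofReal (((1 - γ) ^ 2)⁻¹ / lam) * D T.interior := by
  refine le_trans ?_ (h.le_of_corner hγ1 hTR hq hlam)
  have ht := Tri.depthRatio_pos hq
  calc _ ≤ ENNReal.ofReal (2 * T.depthRatio q) *
        (κ * volume T.interior / ENNReal.ofReal (1 - γ)) := by
        gcongr
        · linarith
        · exact h.upper _ hTR T.measurableSet_interior
    _ = _ := by simp only [ENNReal.div_eq_inv_mul]; ring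

end Chord
end

noncomputable section

namespace Chord

/-! ### Indicators of propositions -/

open Classical in
/-- The indicator of a proposition. -/
def ind (P : Prop) : ℝ≥0∞ := if P then 1 else 0

lemma ind_of_true {P : Prop} (h : P) : ind P = 1 := if_pos h
lemma ind_of_false {P : Prop} (h : ¬P) : ind P = 0 := if_neg h

lemma ind_le_one (P : Prop) : ind P ≤ 1 := by
  by_cases h : P <;> simp [ind, h]

lemma ind_mono {P Q : Prop} (h : P → Q) : ind P ≤ ind Q := by
  by_cases hP : P <;> simp [ind, hP, h]

lemma ind_and (P Q : Prop) : ind (P ∧ Q) = ind P * ind Q := by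
  by_cases hP : P <;> by_cases hQ : Q <;> simp [ind, hP, hQ]

lemma measurable_ind {α : Type*} [MeasurableSpace α] {P : α → Prop}
    (h : MeasurableSet {x | P x}) : Measurable fun x => ind (P x) :=
  Measurable.ite h measurable_const measurable_const

lemma lintegral_ind {α : Type*} [MeasurableSpace α] (μ : Measure α) {P : α → Prop}
    (h : MeasurableSet {x | P x}) : ∫⁻ x, ind (P x) ∂μ = μ {x | P x} := by
  rw [← lintegral_indicator_one h]
  congr 1

lemma sum_ind_le_one {ι : Type*} (K : Finset ι) (P : ι → Prop)
    (h : ∀ i ∈ K, ∀ j ∈ K, P i → P j → i = j) : ∑ i ∈ K, ind (P i) ≤ 1 := by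
  by_cases hex : ∃ i ∈ K, P i
  · obtain ⟨i, hi, hPi⟩ := hex
    rw [Finset.sum_eq_single i (fun j hj hji => ind_of_false fun hPj => hji (h j hj i hi hPj hPi))
      (fun hni => absurd hi hni)]
    exact ind_le_one _
  · push Not at hex
    rw [Finset.sum_eq_zero fun i hi => ind_of_false (hex i hi)]
    exact zero_le_one

/-! ### Measurability of triangle data -/

section measurability

variable {α : Type*} [MeasurableSpace α]

lemma measurable_cross {v w : α → Point} (hv : Measurable v) (hw : Measurable w) :
    Measurable fun x => cross (v x) (w x) := by
  unfold cross; fun_prop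

lemma Tri.measurable_wl {T : α → Tri} {z : α → Point} (hT : Measurable T) (hz : Measurable z) :
    Measurable fun x => (T x).wl (z x) := measurable_cross (by fun_prop) (by fun_prop)

lemma Tri.measurable_wr {T : α → Tri} {z : α → Point} (hT : Measurable T) (hz : Measurable z) :
    Measurable fun x => (T x).wr (z x) := measurable_cross (by fun_prop) (by fun_prop)

lemma Tri.measurable_wb {T : α → Tri} {z : α → Point} (hT : Measurable T) (hz : Measurable z) :
    Measurable fun x => (T x).wb (z x) := measurable_cross (by fun_prop) (by fun_prop)

lemma Tri.measurable_area {T : α → Tri} (hT : Measurable T) :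
    Measurable fun x => (T x).area := measurable_cross (by fun_prop) (by fun_prop)

lemma Tri.measurable_depthRatio {T : α → Tri} {z : α → Point} (hT : Measurable T)
    (hz : Measurable z) : Measurable fun x => (T x).depthRatio (z x) :=
  measurable_const.sub ((Tri.measurable_wb hT hz).div (Tri.measurable_area hT))

lemma Tri.measurable_left {T : α → Tri} {q : α → Point} (hT : Measurable T) (hq : Measurable q) :
    Measurable fun x => (T x).left (q x) := by
  have := (Tri.measurable_wb hT hq).div (Tri.measurable_area hT)
  unfold Tri.left
  exact Measurable.prodMk (by fun_prop) (Measurable.prodMk hq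
    (Measurable.add (by fun_prop) (this.smul (by fun_prop))))

lemma Tri.measurable_right {T : α → Tri} {q : α → Point} (hT : Measurable T) (hq : Measurable q) :
    Measurable fun x => (T x).right (q x) := by
  have := (Tri.measurable_wb hT hq).div (Tri.measurable_area hT)
  unfold Tri.right
  exact Measurable.prodMk hq (Measurable.prodMk (by fun_prop)
    (Measurable.add (by fun_prop) (this.smul (by fun_prop))))

lemma Tri.measurableSet_mem_interior {T : α → Tri} {z : α → Point} (hT : Measurable T)
    (hz : Measurable z) : MeasurableSet {x | z x ∈ (T x).interior} :=
  (measurableSet_lt measurable_const (Tri.measurable_wl hT hz)).inter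
    ((measurableSet_lt measurable_const (Tri.measurable_wr hT hz)).inter
      (measurableSet_lt measurable_const (Tri.measurable_wb hT hz)))

end measurability

/-! ### Exploring the random points level by level -/

variable {ι : Type*}

/-- Among the points with index in `J`, the one with index `i` is the unique extreme point in
the direction of the chord of `T`. -/
def IsExtreme (T : Tri) (J : Finset ι) (p : ι → Point) (i : ι) : Prop :=
  i ∈ J ∧ ∀ j ∈ J, j ≠ i → T.wb (p j) < T.wb (p i)

lemma IsExtreme.unique {T : Tri} {J : Finset ι} {p : ι → Point} {i j : ι}
    (hi : IsExtreme T J p i) (hj : IsExtreme T J p j) : i = j := by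
  by_contra h
  exact lt_asymm (hi.2 j hj.1 (Ne.symm h)) (hj.2 i hi.1 h)

lemma sum_isExtreme_le_one (T : Tri) (J K : Finset ι) (p : ι → Point) :
    ∑ i ∈ K, ind (IsExtreme T J p i) ≤ 1 :=
  sum_ind_le_one _ _ fun _ _ _ _ hi hj => hi.unique hj

lemma measurableSet_isExtreme {α : Type*} [MeasurableSpace α] {T : α → Tri} (hT : Measurable T)
    (J : Finset ι) {p : α → ι → Point} (hp : ∀ i, Measurable fun x => p x i) (i : ι) :
    MeasurableSet {x | IsExtreme (T x) J (p x) i} := by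
  refine MeasurableSet.inter (s₂ := {x | ∀ j ∈ J, j ≠ i → (T x).wb (p x j) < (T x).wb (p x i)})
    (MeasurableSet.const _) ?_
  simp only [Set.ofPred_forall]
  refine Finset.measurableSet_biInter _ fun j _ => MeasurableSet.iInter fun _ => ?_
  exact measurableSet_lt (Tri.measurable_wb hT (hp j)) (Tri.measurable_wb hT (hp i))

/-- All points with index in `J` are in the open triangle `T`. -/
def AllIn (T : Tri) (J : Finset ι) (p : ι → Point) : Prop := ∀ j ∈ J, p j ∈ T.interior

lemma measurableSet_allIn {α : Type*} [MeasurableSpace α] {T : α → Tri} (hT : Measurable T)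
    (J : Finset ι) {p : α → ι → Point} (hp : ∀ i, Measurable fun x => p x i) :
    MeasurableSet {x | AllIn (T x) J (p x)} := by
  simp only [AllIn, Set.ofPred_forall]
  exact Finset.measurableSet_biInter _ fun j _ => Tri.measurableSet_mem_interior hT (hp j)

open Classical in
/-- The indices in `J` of points in the open triangle `T`. -/
def inside (T : Tri) (J : Finset ι) (p : ι → Point) : Finset ι :=
  J.filter fun j => p j ∈ T.interior

lemma mem_inside {T : Tri} {J : Finset ι} {p : ι → Point} {j : ι} :
    j ∈ inside T J p ↔ j ∈ J ∧ p j ∈ T.interior := by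
  classical
  exact Finset.mem_filter

lemma inside_subset (T : Tri) (J : Finset ι) (p : ι → Point) : inside T J p ⊆ J :=
  fun _ h => (mem_inside.1 h).1

lemma card_inside (T : Tri) (J : Finset ι) (p : ι → Point) :
    ((inside T J p).card : ℝ≥0∞) = ∑ j ∈ J, ind (p j ∈ T.interior) := by
  classical
  simp only [inside, Finset.card_filter, Nat.cast_sum, ind]
  refine Finset.sum_congr rfl fun j _ => ?_
  split_ifs <;> simp

lemma measurableSet_inside_eq {α : Type*} [MeasurableSpace α] {T : α → Tri} (hT : Measurable T)
    (J S : Finset ι) {p : α → ι → Point} (hp : ∀ i, Measurable fun x => p x i) :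
    MeasurableSet {x | inside (T x) J (p x) = S} := by
  by_cases hS : S ⊆ J
  · have : {x | inside (T x) J (p x) = S}
        = ⋂ j ∈ J, {x | j ∈ S ↔ p x j ∈ (T x).interior} := by
      ext x
      simp only [Set.mem_ofPred_eq, Set.mem_iInter, Finset.ext_iff, mem_inside]
      constructor
      · intro h j hj
        rw [← h j]; simp [hj]
      · intro h j
        constructor
        · rintro ⟨hj, hm⟩
          exact (h j hj).2 hm
        · intro hj
          exact ⟨hS hj, (h j (hS hj)).1 hj⟩
    rw [this]
    refine Finset.measurableSet_biInter _ fun j _ => ?_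
    have hm := Tri.measurableSet_mem_interior hT (hp j)
    by_cases hj : j ∈ S
    · simpa only [hj, true_iff] using hm
    · simp only [hj, false_iff]
      exact hm.compl
  · convert MeasurableSet.empty
    ext x
    simp only [Set.mem_ofPred_eq, Set.mem_empty_iff_false, iff_false]
    rintro rfl
    exact hS (inside_subset _ _ _)

/-- The number of points that are left in the triangles after `m` levels of the recursion, when
triangles with at most `B` points are discarded. -/
def remaining (B : ℕ) : ℕ → Tri → Finset ι → (ι → Point) → ℝ≥0∞
  | 0, _, J, _ => J.card
  | m + 1, T, J, p =>
    if J.card ≤ B then 0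
    else ∑ i ∈ J, ind (IsExtreme T J p i) *
      (remaining B m (T.left (p i)) (inside (T.left (p i)) J p) p
        + remaining B m (T.right (p i)) (inside (T.right (p i)) J p) p)

/-- Conditioning on a random index set: it is replaced by a finite sum over its deterministic
values, so that measurability and integration can be treated for a fixed set. -/
lemma eq_sum_inside (T : Tri) (J : Finset ι) (p : ι → Point) (f : Finset ι → ℝ≥0∞) :
    f (inside T J p) = ∑ S ∈ J.powerset, ind (inside T J p = S) * f S := by
  rw [Finset.sum_eq_single (inside T J p)]
  · rw [ind_of_true rfl, one_mul]
  · intro S _ hS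
    rw [ind_of_false (Ne.symm hS), zero_mul]
  · intro h
    exact absurd (Finset.mem_powerset.2 (inside_subset _ _ _)) h

lemma measurable_remaining {α : Type*} [MeasurableSpace α] (B m : ℕ) :
    ∀ {T : α → Tri} (_ : Measurable T) (J : Finset ι) {p : α → ι → Point}
      (_ : ∀ i, Measurable fun x => p x i), Measurable fun x => remaining B m (T x) J (p x) := by
  induction m with
  | zero => intro T _ J p _; exact measurable_const
  | succ m ih =>
    intro T hT J p hp
    simp only [remaining]
    split_ifs
    · exact measurable_const
    · refine Finset.measurable_fun_sum _ fun i _ =>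
        (measurable_ind (measurableSet_isExtreme hT J hp i)).mul (Measurable.add ?_ ?_)
      · have hc := Tri.measurable_left hT (hp i)
        simp_rw [fun x => eq_sum_inside ((T x).left (p x i)) J (p x)
          (fun S => remaining B m ((T x).left (p x i)) S (p x))]
        exact Finset.measurable_fun_sum _ fun S _ =>
          (measurable_ind (measurableSet_inside_eq hc J S hp)).mul (ih hc S hp)
      · have hc := Tri.measurable_right hT (hp i)
        simp_rw [fun x => eq_sum_inside ((T x).right (p x i)) J (p x)
          (fun S => remaining B m ((T x).right (p x i)) S (p x))]
        exact Finset.measurable_fun_sum _ fun S _ =>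
          (measurable_ind (measurableSet_inside_eq hc J S hp)).mul (ih hc S hp)

end Chord
end

noncomputable section

namespace Chord

/-! ### Redrawing one point: the expected number of points in the children -/

section marginal

variable {ι : Type*}

lemma measurable_allIn (T : Tri) (J : Finset ι) :
    Measurable fun p : ι → Point => ind (AllIn T J p) :=
  measurable_ind (measurableSet_allIn measurable_const J fun i => measurable_pi_apply i)

variable [DecidableEq ι] (D : Measure Point)

lemma lmarginal_finset_sum {κ : Type*} (J : Finset ι) (K : Finset κ)
    (f : κ → (ι → Point) → ℝ≥0∞) (hf : ∀ k ∈ K, Measurable (f k)) (x : ι → Point) :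
    lmarginal (fun _ => D) J (fun p => ∑ k ∈ K, f k p) x
      = ∑ k ∈ K, lmarginal (fun _ => D) J (f k) x := by
  unfold lmarginal
  exact lintegral_finsetSum' K fun k hk => ((hf k hk).comp measurable_updateFinset).aemeasurable

lemma lmarginal_const_mul (J : Finset ι) (c : ℝ≥0∞) (f : (ι → Point) → ℝ≥0∞) (hf : Measurable f)
    (x : ι → Point) :
    lmarginal (fun _ => D) J (fun p => c * f p) x = c * lmarginal (fun _ => D) J f x := by
  unfold lmarginal
  exact lintegral_const_mul _ (hf.comp measurable_updateFinset)

variable [SigmaFinite D]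

/-- If `j` is drawn afresh, it is either not in the part selected by `h`, or it becomes the extreme
point often enough: summed over `j` this bounds the expected number of selected points. -/
lemma lmarginal_sum_isExtreme_le (T : Tri) (h : Point → Point → ℝ≥0∞)
    (hm : Measurable fun z : Point × Point => h z.1 z.2) (c₁ c₂ : ℝ≥0∞)
    (hc : ∀ q ∈ T.interior, ∫⁻ z, ind (z ∈ T.interior) * h q z ∂D
      ≤ c₁ * D {z | z ∈ T.interior ∧ T.wb q < T.wb z} + c₂ * D T.interior)
    (J : Finset ι) (x : ι → Point) :
    lmarginal (fun _ => D) J (fun p => ind (AllIn T J p) *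
        ∑ i ∈ J, ∑ j ∈ J.erase i, ind (IsExtreme T J p i) * h (p i) (p j)) x
      ≤ (c₁ + c₂ * J.card) * lmarginal (fun _ => D) J (fun p => ind (AllIn T J p)) x := by
  have hAm := measurable_allIn T J
  have hEm : ∀ K : Finset ι, ∀ i, Measurable fun p : ι → Point => ind (IsExtreme T K p i) :=
    fun K i => measurable_ind
      (measurableSet_isExtreme measurable_const K (fun i => measurable_pi_apply i) i)
  have hwm : ∀ i j : ι, Measurable fun p : ι → Point => ind (T.wb (p i) < T.wb (p j)) :=
    fun i j => measurable_ind (measurableSet_lt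
      (Tri.measurable_wb measurable_const (measurable_pi_apply i))
      (Tri.measurable_wb measurable_const (measurable_pi_apply j)))
  have hhm : ∀ i j : ι, Measurable fun p : ι → Point => h (p i) (p j) := fun i j => by
    have : Measurable fun p : ι → Point => (p i, p j) := by fun_prop
    exact hm.comp this
  -- Extremality of `i` is only required among the points other than `j`, so that this factor does
  -- not depend on the point that is redrawn.
  set f : ι → ι → (ι → Point) → ℝ≥0∞ := fun j i p =>
    ind (AllIn T J p) * (ind (IsExtreme T (J.erase j) p i) * h (p i) (p j)) with hf
  set g : ι → ι → (ι → Point) → ℝ≥0∞ := fun j i p =>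
    ind (AllIn T J p) * (ind (IsExtreme T (J.erase j) p i) *
      (c₁ * ind (T.wb (p i) < T.wb (p j)) + c₂)) with hg
  have hfm : ∀ j i, Measurable (f j i) := fun j i => hAm.mul ((hEm _ i).mul (hhm i j))
  have hgm : ∀ j i, Measurable (g j i) := fun j i =>
    hAm.mul ((hEm _ i).mul (((hwm i j).const_mul _).add_const _))
  have hfg : ∀ j ∈ J, ∀ i ∈ J.erase j,
      lmarginal (fun _ => D) J (f j i) x ≤ lmarginal (fun _ => D) J (g j i) x := by
    intro j hj i hi
    have hij : i ≠ j := (Finset.mem_erase.1 hi).1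
    -- It suffices to compare the integrals over the single coordinate `j`; there `q = x i` is fixed
    -- and `hc` applies.
    refine lmarginal_le_of_subset (s := {j}) (by simpa using hj) (hfm j i) (hgm j i) ?_ x
    intro x
    rw [lmarginal_singleton, lmarginal_singleton]
    have hA : ∀ z, AllIn T J (Function.update x j z) ↔ AllIn T (J.erase j) x ∧ z ∈ T.interior := by
      intro z
      constructor
      · intro h
        refine ⟨fun k hk => ?_, by simpa using h j hj⟩
        simpa [Function.update_of_ne (Finset.mem_erase.1 hk).1] using
          h k (Finset.mem_erase.1 hk).2
      · rintro ⟨h1, h2⟩ k hk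
        by_cases hkj : k = j
        · subst hkj; simpa using h2
        · rw [Function.update_of_ne hkj]; exact h1 k (Finset.mem_erase.2 ⟨hkj, hk⟩)
    have hE : ∀ z, IsExtreme T (J.erase j) (Function.update x j z) i
        ↔ IsExtreme T (J.erase j) x i := by
      intro z
      unfold IsExtreme
      rw [Function.update_of_ne hij]
      refine and_congr_right fun _ => forall_congr' fun k => forall_congr' fun hk => ?_
      rw [Function.update_of_ne (Finset.mem_erase.1 hk).1]
    simp only [hf, hg, hA, hE, ind_and, Function.update_self, Function.update_of_ne hij]
    by_cases hq : x i ∈ T.interior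
    swap
    · have : ¬ AllIn T (J.erase j) x := fun h => hq (h i hi)
      simp [ind_of_false this]
    have hin : Measurable fun z : Point => ind (z ∈ T.interior) :=
      measurable_ind T.measurableSet_interior
    have hcm : MeasurableSet {z | z ∈ T.interior ∧ T.wb (x i) < T.wb z} :=
      T.measurableSet_interior.inter (isOpen_lt continuous_const T.continuous_wb).measurableSet
    calc ∫⁻ z, ind (AllIn T (J.erase j) x) * ind (z ∈ T.interior) *
          (ind (IsExtreme T (J.erase j) x i) * h (x i) z) ∂D
        = ∫⁻ z, (ind (AllIn T (J.erase j) x) * ind (IsExtreme T (J.erase j) x i)) *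
            (ind (z ∈ T.interior) * h (x i) z) ∂D := by
          refine lintegral_congr fun z => ?_; ring
      _ = (ind (AllIn T (J.erase j) x) * ind (IsExtreme T (J.erase j) x i)) *
            ∫⁻ z, ind (z ∈ T.interior) * h (x i) z ∂D :=
          lintegral_const_mul _ (hin.mul (hm.comp (measurable_const.prodMk measurable_id)))
      _ ≤ (ind (AllIn T (J.erase j) x) * ind (IsExtreme T (J.erase j) x i)) *
            ∫⁻ z, (c₁ * ind (z ∈ T.interior ∧ T.wb (x i) < T.wb z)
              + c₂ * ind (z ∈ T.interior)) ∂D := by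
          refine mul_le_mul' le_rfl ?_
          rw [lintegral_add_right _ (hin.const_mul _), lintegral_const_mul _ (measurable_ind hcm),
            lintegral_const_mul _ hin, lintegral_ind _ hcm,
            lintegral_ind D (P := fun z => z ∈ T.interior) T.measurableSet_interior]
          exact hc _ hq
      _ = ∫⁻ z, (ind (AllIn T (J.erase j) x) * ind (IsExtreme T (J.erase j) x i)) *
            (c₁ * ind (z ∈ T.interior ∧ T.wb (x i) < T.wb z) + c₂ * ind (z ∈ T.interior)) ∂D :=
          (lintegral_const_mul _ (((measurable_ind hcm).const_mul _).add (hin.const_mul _))).symm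
      _ = _ := by
          refine lintegral_congr fun z => ?_
          rw [ind_and]; ring
  have hup : ∀ p : ι → Point, ∑ j ∈ J, ∑ i ∈ J.erase j, g j i p
      ≤ (c₁ + c₂ * J.card) * ind (AllIn T J p) := by
    intro p
    -- If `j` is deeper than the extreme point of the others, then `j` is the extreme point of `J`.
    -- Hence the `c₁` terms, summed over `j`, contribute at most `c₁` and not `c₁ * J.card`.
    have h1 : ∀ j ∈ J, ∑ i ∈ J.erase j, ind (IsExtreme T (J.erase j) p i) *
        ind (T.wb (p i) < T.wb (p j)) ≤ ind (IsExtreme T J p j) := by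
      intro j hj
      by_cases hjE : IsExtreme T J p j
      · rw [ind_of_true hjE]
        refine le_trans (Finset.sum_le_sum fun i _ => ?_) (sum_isExtreme_le_one T (J.erase j) _ p)
        exact mul_le_of_le_one_right zero_le (ind_le_one _)
      · rw [Finset.sum_eq_zero]
        · exact zero_le
        intro i hi
        rw [← ind_and]
        refine ind_of_false fun ⟨⟨_, h1⟩, h2⟩ => hjE ⟨hj, fun k hk hkj => ?_⟩
        by_cases hki : k = i
        · rwa [hki]
        · exact (h1 k (Finset.mem_erase.2 ⟨hkj, hk⟩) hki).trans h2
    calc ∑ j ∈ J, ∑ i ∈ J.erase j, g j i p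
        = ind (AllIn T J p) * ∑ j ∈ J, (c₁ * ∑ i ∈ J.erase j, ind (IsExtreme T (J.erase j) p i) *
            ind (T.wb (p i) < T.wb (p j))
            + c₂ * ∑ i ∈ J.erase j, ind (IsExtreme T (J.erase j) p i)) := by
          simp only [hg, Finset.mul_sum, ← Finset.sum_add_distrib]
          refine Finset.sum_congr rfl fun j _ => Finset.sum_congr rfl fun i _ => ?_
          ring
      _ ≤ ind (AllIn T J p) * ∑ j ∈ J, (c₁ * ind (IsExtreme T J p j) + c₂ * 1) := by
          gcongr with j hj
          · exact h1 j hj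
          · exact sum_isExtreme_le_one _ _ _ _
      _ ≤ ind (AllIn T J p) * (c₁ * 1 + c₂ * J.card) := by
          rw [Finset.sum_add_distrib, ← Finset.mul_sum]
          gcongr
          · exact sum_isExtreme_le_one _ _ _ _
          · simp [mul_comm]
      _ = _ := by ring
  calc lmarginal (fun _ => D) J (fun p => ind (AllIn T J p) *
        ∑ i ∈ J, ∑ j ∈ J.erase i, ind (IsExtreme T J p i) * h (p i) (p j)) x
      ≤ lmarginal (fun _ => D) J (fun p => ∑ j ∈ J, ∑ i ∈ J.erase j, f j i p) x := by
        refine lmarginal_mono (fun p => ?_) x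
        have e : ∑ j ∈ J, ∑ i ∈ J.erase j, f j i p = ind (AllIn T J p) *
            ∑ j ∈ J, ∑ i ∈ J.erase j, ind (IsExtreme T (J.erase j) p i) * h (p i) (p j) := by
          simp only [hf, Finset.mul_sum]
        rw [e]
        refine mul_le_mul' le_rfl ?_
        rw [Finset.sum_comm' (t' := J) (s' := fun j => J.erase j)]
        · gcongr with j hj i hi
          refine ind_mono fun ⟨_, h2⟩ => ⟨hi, fun k hk => h2 k (Finset.mem_erase.1 hk).2⟩
        · intro i j
          simp only [Finset.mem_erase]
          tauto
    _ = ∑ j ∈ J, ∑ i ∈ J.erase j, lmarginal (fun _ => D) J (f j i) x := by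
        rw [lmarginal_finset_sum D J J _
          fun j _ => Finset.measurable_fun_sum _ fun i _ => hfm j i]
        exact Finset.sum_congr rfl fun j _ => lmarginal_finset_sum D J _ _ (fun i _ => hfm j i) x
    _ ≤ ∑ j ∈ J, ∑ i ∈ J.erase j, lmarginal (fun _ => D) J (g j i) x :=
        Finset.sum_le_sum fun j hj => Finset.sum_le_sum fun i hi => hfg j hj i hi
    _ = lmarginal (fun _ => D) J (fun p => ∑ j ∈ J, ∑ i ∈ J.erase j, g j i p) x := by
        rw [lmarginal_finset_sum D J J _
          fun j _ => Finset.measurable_fun_sum _ fun i _ => hgm j i]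
        exact Finset.sum_congr rfl fun j _ =>
          (lmarginal_finset_sum D J _ _ (fun i _ => hgm j i) x).symm
    _ ≤ lmarginal (fun _ => D) J (fun p => (c₁ + c₂ * J.card) * ind (AllIn T J p)) x :=
        lmarginal_mono hup x
    _ = _ := lmarginal_const_mul D J _ _ hAm x

end marginal

end Chord
end

noncomputable section

namespace Chord

/-! ### Independence in the children and one level of the recursion -/

section recursion

variable {ι : Type*} [DecidableEq ι] (D : Measure Point) [SigmaFinite D]

/-- The points in a child triangle are fresh: conditionally on the other ones, they are
independent points of that triangle. -/
lemma lmarginal_child_le {R : Set Point} (ch : Tri → Point → Tri) {T : Tri}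
    (hchm : Measurable (ch T)) (hch : ∀ q ∈ T.interior, ∀ z ∈ (ch T q).interior,
      z ∈ T.interior ∧ T.wb z < T.wb q) (hTR : T.interior ⊆ R)
    (F G : Tri → Finset ι → (ι → Point) → ℝ≥0∞)
    (hF : ∀ S : Finset ι, ∀ {t : (ι → Point) → Tri}, Measurable t → Measurable fun p => F (t p) S p)
    (hG : ∀ S : Finset ι, ∀ {t : (ι → Point) → Tri}, Measurable t → Measurable fun p => G (t p) S p)
    (hFG : ∀ (S : Finset ι) (T' : Tri), T'.interior ⊆ R → ∀ x,
      lmarginal (fun _ => D) S (fun p => ind (AllIn T' S p) * F T' S p) x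
        ≤ lmarginal (fun _ => D) S (fun p => ind (AllIn T' S p) * G T' S p) x)
    (J : Finset ι) {i : ι} (hi : i ∈ J) (x : ι → Point) :
    lmarginal (fun _ => D) J (fun p => ind (AllIn T J p) * (ind (IsExtreme T J p i) *
        F (ch T (p i)) (inside (ch T (p i)) J p) p)) x
      ≤ lmarginal (fun _ => D) J (fun p => ind (AllIn T J p) * (ind (IsExtreme T J p i) *
        G (ch T (p i)) (inside (ch T (p i)) J p) p)) x := by
  have hC : Measurable fun p : ι → Point => ch T (p i) := hchm.comp (measurable_pi_apply i)
  -- For a prescribed set `S` of points in the child, this is the condition on the points outside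
  -- `S`. It involves only coordinates outside `S`, hence is constant when those in `S` are
  -- integrated.
  set E : Finset ι → (ι → Point) → Prop := fun S p =>
    AllIn T (J \ S) p ∧ IsExtreme T (J \ S) p i ∧ ∀ j ∈ J \ S, p j ∉ (ch T (p i)).interior with hE
  have hEm : ∀ S, Measurable fun p => ind (E S p) := by
    intro S
    have hN : MeasurableSet {p : ι → Point | ∀ j ∈ J \ S, p j ∉ (ch T (p i)).interior} := by
      have : {p : ι → Point | ∀ j ∈ J \ S, p j ∉ (ch T (p i)).interior}
          = ⋂ j ∈ J \ S, {p | p j ∈ (ch T (p i)).interior}ᶜ := by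
        ext p; simp
      rw [this]
      exact Finset.measurableSet_biInter _ fun j _ =>
        (Tri.measurableSet_mem_interior hC (measurable_pi_apply j)).compl
    exact measurable_ind (MeasurableSet.inter
      (measurableSet_allIn measurable_const _ fun i => measurable_pi_apply i)
      (MeasurableSet.inter
        (measurableSet_isExtreme measurable_const _ (fun i => measurable_pi_apply i) i) hN))
  have hAm : ∀ S, Measurable fun p : ι → Point => ind (AllIn (ch T (p i)) S p) := fun S =>
    measurable_ind (measurableSet_allIn hC S fun i => measurable_pi_apply i)
  -- Points in the child automatically lie in `T` and are less deep than `p i`, so the points of `S`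
  -- put no further constraint on the choice of `i`: given the others, they are only required to be
  -- in the child.
  have key : ∀ S ⊆ J, ∀ p : ι → Point, (AllIn T J p ∧ IsExtreme T J p i ∧
      inside (ch T (p i)) J p = S) ↔ (E S p ∧ AllIn (ch T (p i)) S p) := by
    intro S hSJ p
    constructor
    · rintro ⟨hA, hX, hS⟩
      have hS' : ∀ j ∈ S, p j ∈ (ch T (p i)).interior := fun j hj => by
        rw [← hS] at hj; exact (mem_inside.1 hj).2
      have hiS : i ∉ S := fun h => lt_irrefl _ (hch _ (hA i hi) _ (hS' i h)).2
      refine ⟨⟨fun j hj => hA j (Finset.mem_sdiff.1 hj).1, ⟨Finset.mem_sdiff.2 ⟨hi, hiS⟩,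
        fun j hj => hX.2 j (Finset.mem_sdiff.1 hj).1⟩, fun j hj hjC => ?_⟩, hS'⟩
      obtain ⟨hj1, hj2⟩ := Finset.mem_sdiff.1 hj
      exact hj2 (hS ▸ mem_inside.2 ⟨hj1, hjC⟩)
    · rintro ⟨⟨hA, hX, hN⟩, hS⟩
      have hin : p i ∈ T.interior := hA i hX.1
      refine ⟨fun j hj => ?_, ⟨hi, fun j hj hji => ?_⟩, ?_⟩
      · by_cases hjS : j ∈ S
        · exact (hch _ hin _ (hS j hjS)).1
        · exact hA j (Finset.mem_sdiff.2 ⟨hj, hjS⟩)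
      · by_cases hjS : j ∈ S
        · exact (hch _ hin _ (hS j hjS)).2
        · exact hX.2 j (Finset.mem_sdiff.2 ⟨hj, hjS⟩) hji
      · ext j
        rw [mem_inside]
        constructor
        · rintro ⟨hj, hjC⟩
          by_contra hjS
          exact hN j (Finset.mem_sdiff.2 ⟨hj, hjS⟩) hjC
        · exact fun hj => ⟨hSJ hj, hS j hj⟩
  have expand : ∀ H : Tri → Finset ι → (ι → Point) → ℝ≥0∞,
      (fun p : ι → Point => ind (AllIn T J p) * (ind (IsExtreme T J p i) *
        H (ch T (p i)) (inside (ch T (p i)) J p) p))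
      = fun p => ∑ S ∈ J.powerset, ind (E S p) *
          (ind (AllIn (ch T (p i)) S p) * H (ch T (p i)) S p) := by
    intro H
    ext p
    rw [eq_sum_inside (ch T (p i)) J p (fun S => H (ch T (p i)) S p), Finset.mul_sum,
      Finset.mul_sum]
    refine Finset.sum_congr rfl fun S hS => ?_
    rw [← mul_assoc (ind (E S p)), ← ind_and (E S p), ← key S (Finset.mem_powerset.1 hS) p,
      ind_and, ind_and]
    ring
  have hm : ∀ H : Tri → Finset ι → (ι → Point) → ℝ≥0∞, (∀ S : Finset ι,
      ∀ {t : (ι → Point) → Tri}, Measurable t → Measurable fun p => H (t p) S p) →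
      ∀ S, Measurable fun p : ι → Point => ind (E S p) *
          (ind (AllIn (ch T (p i)) S p) * H (ch T (p i)) S p) :=
    fun H hH S => (hEm S).mul ((hAm S).mul (hH S hC))
  rw [expand F, expand G, lmarginal_finset_sum D J _ _ (fun S _ => hm F hF S),
    lmarginal_finset_sum D J _ _ (fun S _ => hm G hG S)]
  refine Finset.sum_le_sum fun S hS => ?_
  refine lmarginal_le_of_subset (Finset.mem_powerset.1 hS) (hm F hF S) (hm G hG S) ?_ x
  intro x
  by_cases hiS : i ∈ S
  -- The extreme point is never in its own child.
  · have hz : ∀ p, ¬ E S p := fun p hp => (Finset.mem_sdiff.1 hp.2.1.1).2 hiS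
    simp [ind_of_false (hz _)]
  have hup : ∀ y : S → Point, ∀ j ∉ S, Function.updateFinset x S y j = x j := fun y j hj => by
    simp [Function.updateFinset, hj]
  have hEx : ∀ y : S → Point, E S (Function.updateFinset x S y) ↔ E S x := by
    intro y
    have hJ : ∀ j ∈ J \ S, Function.updateFinset x S y j = x j := fun j hj =>
      hup y j (Finset.mem_sdiff.1 hj).2
    simp only [hE, AllIn, IsExtreme, hup y i hiS]
    refine and_congr (forall₂_congr fun j hj => by rw [hJ j hj])
      (and_congr (and_congr_right fun _ => forall₂_congr fun j hj => by rw [hJ j hj])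
        (forall₂_congr fun j hj => by rw [hJ j hj]))
  -- With `i ∉ S`, the child triangle is fixed during the integration as well, so `hFG` can be used
  -- for that triangle.
  have factor : ∀ H : Tri → Finset ι → (ι → Point) → ℝ≥0∞, (∀ S : Finset ι,
      ∀ {t : (ι → Point) → Tri}, Measurable t → Measurable fun p => H (t p) S p) →
      lmarginal (fun _ => D) S (fun p => ind (E S p) *
        (ind (AllIn (ch T (p i)) S p) * H (ch T (p i)) S p)) x
      = ind (E S x) * lmarginal (fun _ => D) S (fun p =>
        ind (AllIn (ch T (x i)) S p) * H (ch T (x i)) S p) x := by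
    intro H hH
    rw [← lmarginal_const_mul D S (ind (E S x)) (fun p =>
        ind (AllIn (ch T (x i)) S p) * H (ch T (x i)) S p)
      ((measurable_allIn _ S).mul (hH S measurable_const))]
    unfold lmarginal
    refine lintegral_congr fun y => ?_
    simp only [hEx, hup y i hiS]
  rw [factor F hF, factor G hG]
  by_cases hE' : E S x
  · have hin : x i ∈ T.interior := hE'.1 i hE'.2.1.1
    exact mul_le_mul' le_rfl (hFG S _ (fun z hz => hTR (hch _ hin z hz).1) x)
  · simp [ind_of_false hE']

/-- The number of children of `T` at `q` that contain `z`. -/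
def childCount (T : Tri) (q z : Point) : ℝ≥0∞ :=
  ind (z ∈ (T.left q).interior) + ind (z ∈ (T.right q).interior)

lemma measurable_childCount {α : Type*} [MeasurableSpace α] (T : Tri) {q z : α → Point}
    (hq : Measurable q) (hz : Measurable z) : Measurable fun x => childCount T (q x) (z x) :=
  (measurable_ind (Tri.measurableSet_mem_interior
    (Tri.measurable_left measurable_const hq) hz)).add
  (measurable_ind (Tri.measurableSet_mem_interior
    (Tri.measurable_right measurable_const hq) hz))

omit [SigmaFinite D] in
lemma lintegral_childCount_le (T : Tri) (q : Point) :
    ∫⁻ z, ind (z ∈ T.interior) * childCount T q z ∂D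
      ≤ D (T.left q).interior + D (T.right q).interior := by
  have e1 := lintegral_ind D (P := fun z => z ∈ (T.left q).interior)
    (Tri.measurableSet_interior _)
  have e2 := lintegral_ind D (P := fun z => z ∈ (T.right q).interior)
    (Tri.measurableSet_interior _)
  calc ∫⁻ z, ind (z ∈ T.interior) * childCount T q z ∂D
      ≤ ∫⁻ z, (ind (z ∈ (T.left q).interior) + ind (z ∈ (T.right q).interior)) ∂D :=
        lintegral_mono fun z => mul_le_of_le_one_left zero_le (ind_le_one _)
    _ = _ := by
        refine (lintegral_add_left (f := fun z => ind (z ∈ (T.left q).interior))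
          (measurable_ind (Tri.measurableSet_interior _)) _).trans ?_
        rw [e1, e2]
        rfl

lemma card_inside_children {T : Tri} {J : Finset ι} {p : ι → Point} (hp : AllIn T J p) {i : ι}
    (hi : i ∈ J) :
    ((inside (T.left (p i)) J p).card : ℝ≥0∞) + (inside (T.right (p i)) J p).card
      = ∑ j ∈ J.erase i, childCount T (p i) (p j) := by
  rw [card_inside, card_inside, ← Finset.sum_add_distrib, ← Finset.add_sum_erase J _ hi]
  have h1 : p i ∉ (T.left (p i)).interior := fun hz =>
    lt_irrefl _ (Tri.left_interior_subset (hp i hi) hz).2.1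
  have h2 : p i ∉ (T.right (p i)).interior := fun hz =>
    lt_irrefl _ (Tri.right_interior_subset (hp i hi) hz).2.1
  rw [ind_of_false h1, ind_of_false h2, add_zero, zero_add]
  rfl

omit [DecidableEq ι] in
lemma measurable_ind_isExtreme (T : Tri) (J : Finset ι) (i : ι) :
    Measurable fun p : ι → Point => ind (IsExtreme T J p i) :=
  measurable_ind (measurableSet_isExtreme measurable_const _ (fun i => measurable_pi_apply i) i)

omit [SigmaFinite D] in
/-- The sum of a functional over the two children, integrated. -/
lemma lmarginal_children (T : Tri) (J : Finset ι) (H : Tri → Finset ι → (ι → Point) → ℝ≥0∞)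
    (hH : ∀ S : Finset ι, ∀ {t : (ι → Point) → Tri}, Measurable t → Measurable fun p => H (t p) S p)
    (x : ι → Point) :
    lmarginal (fun _ => D) J (fun p => ind (AllIn T J p) * ∑ i ∈ J, ind (IsExtreme T J p i) *
        (H (T.left (p i)) (inside (T.left (p i)) J p) p
          + H (T.right (p i)) (inside (T.right (p i)) J p) p)) x
      = ∑ i ∈ J, lmarginal (fun _ => D) J (fun p => ind (AllIn T J p) *
          (ind (IsExtreme T J p i) * H (T.left (p i)) (inside (T.left (p i)) J p) p)) x
        + ∑ i ∈ J, lmarginal (fun _ => D) J (fun p => ind (AllIn T J p) *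
          (ind (IsExtreme T J p i) * H (T.right (p i)) (inside (T.right (p i)) J p) p)) x := by
  have hlm : ∀ i : ι, Measurable fun p : ι → Point => T.left (p i) := fun i =>
    Tri.measurable_left measurable_const (measurable_pi_apply i)
  have hrm : ∀ i : ι, Measurable fun p : ι → Point => T.right (p i) := fun i =>
    Tri.measurable_right measurable_const (measurable_pi_apply i)
  have hterm : ∀ i : ι, ∀ {t : (ι → Point) → Tri}, Measurable t → Measurable fun p =>
      ind (AllIn T J p) * (ind (IsExtreme T J p i) * H (t p) (inside (t p) J p) p) := by
    intro i t ht
    refine (measurable_allIn T J).mul ((measurable_ind_isExtreme T J i).mul ?_)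
    simp_rw [fun p => eq_sum_inside (t p) J p (fun S => H (t p) S p)]
    exact Finset.measurable_fun_sum _ fun S _ =>
      (measurable_ind (measurableSet_inside_eq ht J S fun i => measurable_pi_apply i)).mul (hH S ht)
  rw [← lmarginal_finset_sum D J J _ (fun i _ => hterm i (hlm i)),
    ← lmarginal_finset_sum D J J _ (fun i _ => hterm i (hrm i))]
  unfold lmarginal
  rw [← lintegral_add_left]
  · refine lintegral_congr fun y => ?_
    simp only [Finset.mul_sum, ← Finset.sum_add_distrib]
    refine Finset.sum_congr rfl fun i _ => ?_
    ring
  · exact (Finset.measurable_fun_sum _ fun i _ => hterm i (hlm i)).comp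
      measurable_updateFinset

/-- The expected number of points in the children, with affine weights. -/
lemma lmarginal_affine_le (T : Tri) {c₁ c₂ : ℝ≥0∞}
    (hc : ∀ q ∈ T.interior,
      D (T.left q).interior + D (T.right q).interior
        ≤ c₁ * D {z | z ∈ T.interior ∧ T.wb q < T.wb z} + c₂ * D T.interior)
    (α β : ℝ≥0∞) (J : Finset ι) (x : ι → Point) :
    lmarginal (fun _ => D) J (fun p => ind (AllIn T J p) * ∑ i ∈ J, ind (IsExtreme T J p i) *
        ((α + β * (inside (T.left (p i)) J p).card)
          + (α + β * (inside (T.right (p i)) J p).card))) x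
      ≤ (2 * α + β * (c₁ + c₂ * J.card)) *
        lmarginal (fun _ => D) J (fun p => ind (AllIn T J p)) x := by
  have hAm := measurable_allIn T J
  have hhm : ∀ i j : ι, Measurable fun p : ι → Point => childCount T (p i) (p j) := fun i j =>
    measurable_childCount T (measurable_pi_apply i) (measurable_pi_apply j)
  have hsm : Measurable (fun p : ι → Point => ind (AllIn T J p) *
      ∑ i ∈ J, ∑ j ∈ J.erase i, ind (IsExtreme T J p i) * childCount T (p i) (p j)) :=
    hAm.mul (Finset.measurable_fun_sum _ fun i _ =>
      Finset.measurable_fun_sum _ fun j _ => (measurable_ind_isExtreme T J i).mul (hhm i j))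
  -- The constant `α` is paid once for each of the two children of the at most one extreme point;
  -- `β` counts the pairs of that point and a point in one of its children.
  have h1 : ∀ p : ι → Point, ind (AllIn T J p) * ∑ i ∈ J, ind (IsExtreme T J p i) *
        ((α + β * (inside (T.left (p i)) J p).card)
          + (α + β * (inside (T.right (p i)) J p).card))
      ≤ 2 * α * ind (AllIn T J p) + β * (ind (AllIn T J p) *
          ∑ i ∈ J, ∑ j ∈ J.erase i, ind (IsExtreme T J p i) * childCount T (p i) (p j)) := by
    intro p
    by_cases hp : AllIn T J p
    swap
    · simp [ind_of_false hp]
    simp only [ind_of_true hp, one_mul, mul_one]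
    calc ∑ i ∈ J, ind (IsExtreme T J p i) *
          ((α + β * (inside (T.left (p i)) J p).card)
            + (α + β * (inside (T.right (p i)) J p).card))
        = ∑ i ∈ J, (2 * α * ind (IsExtreme T J p i)
            + β * ∑ j ∈ J.erase i, ind (IsExtreme T J p i) * childCount T (p i) (p j)) := by
          refine Finset.sum_congr rfl fun i hi => ?_
          rw [← Finset.mul_sum, ← card_inside_children hp hi]
          ring
      _ ≤ _ := by
          rw [Finset.sum_add_distrib, ← Finset.mul_sum, ← Finset.mul_sum]
          exact add_le_add
            (mul_le_of_le_one_right zero_le (sum_isExtreme_le_one _ _ _ _)) le_rfl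
  have h2 : lmarginal (fun _ => D) J (fun p => 2 * α * ind (AllIn T J p) + β * (ind (AllIn T J p) *
        ∑ i ∈ J, ∑ j ∈ J.erase i, ind (IsExtreme T J p i) * childCount T (p i) (p j))) x
      = 2 * α * lmarginal (fun _ => D) J (fun p => ind (AllIn T J p)) x
        + β * lmarginal (fun _ => D) J (fun p => ind (AllIn T J p) *
          ∑ i ∈ J, ∑ j ∈ J.erase i, ind (IsExtreme T J p i) * childCount T (p i) (p j)) x := by
    rw [← lmarginal_const_mul D J _ _ hAm, ← lmarginal_const_mul D J _ _ hsm]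
    unfold lmarginal
    exact lintegral_add_left ((hAm.const_mul _).comp measurable_updateFinset) _
  have h3 := lmarginal_sum_isExtreme_le D T (childCount T)
    (measurable_childCount T measurable_fst measurable_snd) c₁ c₂
    (fun q hq => (lintegral_childCount_le D T q).trans (hc q hq)) J x
  calc _ ≤ _ := lmarginal_mono h1 x
    _ = _ := h2
    _ ≤ _ := add_le_add le_rfl (mul_le_mul' le_rfl h3)
    _ = _ := by ring

/-- One level of the recursion: a bound that is affine in the number of points is passed on. -/
lemma lmarginal_remaining_succ_le {R : Set Point} {c₁ c₂ : ℝ≥0∞}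
    (hc : ∀ T : Tri, T.interior ⊆ R → ∀ q ∈ T.interior,
      D (T.left q).interior + D (T.right q).interior
        ≤ c₁ * D {z | z ∈ T.interior ∧ T.wb q < T.wb z} + c₂ * D T.interior)
    {B m : ℕ} {α β : ℝ≥0∞}
    (ih : ∀ (S : Finset ι) (T : Tri), T.interior ⊆ R → ∀ x,
      lmarginal (fun _ => D) S (fun p => ind (AllIn T S p) * remaining B m T S p) x
        ≤ (α + β * S.card) * lmarginal (fun _ => D) S (fun p => ind (AllIn T S p)) x)
    (J : Finset ι) (hB : B < J.card) (T : Tri) (hTR : T.interior ⊆ R) (x : ι → Point) :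
    lmarginal (fun _ => D) J (fun p => ind (AllIn T J p) * remaining B (m + 1) T J p) x
      ≤ (2 * α + β * (c₁ + c₂ * J.card)) *
        lmarginal (fun _ => D) J (fun p => ind (AllIn T J p)) x := by
  have hF : ∀ S : Finset ι, ∀ {t : (ι → Point) → Tri}, Measurable t →
      Measurable fun p => remaining B m (t p) S p := fun S t ht =>
    measurable_remaining B m ht S fun i => measurable_pi_apply i
  have hG : ∀ S : Finset ι, ∀ {t : (ι → Point) → Tri}, Measurable t →
      Measurable fun p => (fun _ S _ => α + β * S.card : Tri → Finset ι → (ι → Point) → ℝ≥0∞)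
        (t p) S p := fun S t ht => measurable_const
  have hFG : ∀ (S : Finset ι) (T' : Tri), T'.interior ⊆ R → ∀ x,
      lmarginal (fun _ => D) S (fun p => ind (AllIn T' S p) * remaining B m T' S p) x
        ≤ lmarginal (fun _ => D) S (fun p => ind (AllIn T' S p) *
          (fun _ S _ => α + β * S.card : Tri → Finset ι → (ι → Point) → ℝ≥0∞) T' S p) x := by
    intro S T' hT' x
    refine (ih S T' hT' x).trans_eq ?_
    rw [← lmarginal_const_mul D S _ _ (measurable_allIn T' S)]
    simp only [mul_comm]
  refine le_trans ?_ (lmarginal_affine_le D T (hc T hTR) α β J x)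
  have e1 := lmarginal_children D T J (remaining B m) hF x
  have e2 := lmarginal_children D T J (fun _ S _ => α + β * S.card) hG x
  simp only [remaining, if_neg (not_le.2 hB)]
  rw [e1]
  refine le_trans ?_ e2.ge
  refine add_le_add (Finset.sum_le_sum fun i hi => ?_) (Finset.sum_le_sum fun i hi => ?_)
  · exact lmarginal_child_le D (fun T q => T.left q)
      (Tri.measurable_left measurable_const measurable_id)
      (fun q hq z hz => ⟨(Tri.left_interior_subset hq hz).1,
        (Tri.left_interior_subset hq hz).2.1⟩) hTR _ _ hF hG hFG J hi x
  · exact lmarginal_child_le D (fun T q => T.right q)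
      (Tri.measurable_right measurable_const measurable_id)
      (fun q hq z hz => ⟨(Tri.right_interior_subset hq hz).1,
        (Tri.right_interior_subset hq hz).2.1⟩) hTR _ _ hF hG hFG J hi x

end recursion

end Chord
end

noncomputable section

namespace Chord

/-! ### Iterating the affine bounds over the levels -/

section bound

variable {ι : Type*} [DecidableEq ι] (D : Measure Point) [SigmaFinite D]

/-- The density hypothesis in the form in which the recursion uses it. -/
def ChildrenBound (D : Measure Point) (R : Set Point) (c : ℝ) : Prop :=
  ∀ lam : ℝ, 0 < lam → ∀ T : Tri, T.interior ⊆ R → ∀ q ∈ T.interior,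
    D (T.left q).interior + D (T.right q).interior
      ≤ ENNReal.ofReal (c * lam) * D {z | z ∈ T.interior ∧ T.wb q < T.wb z}
        + ENNReal.ofReal (c / lam) * D T.interior

lemma ofReal_affine {a b : ℝ} (ha : 0 ≤ a) (hb : 0 ≤ b) (k : ℕ) :
    ENNReal.ofReal a + ENNReal.ofReal b * k = ENNReal.ofReal (a + b * k) := by
  rw [ENNReal.ofReal_add ha (by positivity), ENNReal.ofReal_mul hb, ENNReal.ofReal_natCast]

variable {D} in
/-- One level, in real numbers. -/
lemma remaining_step {R : Set Point} {c : ℝ} (hc0 : 0 ≤ c) (hc : ChildrenBound D R c) {B m : ℕ}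
    {a b a' b' lam : ℝ} (ha : 0 ≤ a) (hb : 0 ≤ b) (ha' : 0 ≤ a') (hb' : 0 ≤ b') (hlam : 0 < lam)
    (hstep : ∀ k : ℕ, B < k → 2 * a + b * (c * lam + c / lam * k) ≤ a' + b' * k)
    (ih : ∀ (S : Finset ι) (T : Tri), T.interior ⊆ R → ∀ x,
      lmarginal (fun _ => D) S (fun p => ind (AllIn T S p) * remaining B m T S p) x
        ≤ (ENNReal.ofReal a + ENNReal.ofReal b * S.card) *
          lmarginal (fun _ => D) S (fun p => ind (AllIn T S p)) x)
    (J : Finset ι) (T : Tri) (hTR : T.interior ⊆ R) (x : ι → Point) :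
    lmarginal (fun _ => D) J (fun p => ind (AllIn T J p) * remaining B (m + 1) T J p) x
      ≤ (ENNReal.ofReal a' + ENNReal.ofReal b' * J.card) *
          lmarginal (fun _ => D) J (fun p => ind (AllIn T J p)) x := by
  by_cases hB : J.card ≤ B
  · simp [remaining, hB, lmarginal]
  push Not at hB
  refine (lmarginal_remaining_succ_le D (hc lam hlam) ih J hB T hTR x).trans ?_
  refine mul_le_mul' ?_ le_rfl
  have e : (2 : ℝ≥0∞) * ENNReal.ofReal a = ENNReal.ofReal (2 * a) := by
    rw [ENNReal.ofReal_mul (by norm_num)]; norm_num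
  rw [ofReal_affine (by positivity) (by positivity), ofReal_affine (by positivity) (by positivity),
    ← ENNReal.ofReal_mul hb, e, ← ENNReal.ofReal_add (by positivity) (by positivity)]
  exact ENNReal.ofReal_le_ofReal (hstep _ hB)

variable {D} in
/-- Large triangles lose a constant factor of their points at each level. -/
lemma remaining_linear {R : Set Point} {c : ℝ} (hc0 : 0 ≤ c) (hc : ChildrenBound D R c) {B : ℕ}
    (hB : 4 * (2 + c) ^ 4 ≤ B) (m : ℕ) :
    ∀ (S : Finset ι) (T : Tri), T.interior ⊆ R → ∀ x,
      lmarginal (fun _ => D) S (fun p => ind (AllIn T S p) * remaining B m T S p) x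
        ≤ (ENNReal.ofReal 0 + ENNReal.ofReal (((2 + c) ^ m)⁻¹) * S.card) *
          lmarginal (fun _ => D) S (fun p => ind (AllIn T S p)) x := by
  induction m with
  | zero =>
    intro S T _ x
    rw [← lmarginal_const_mul D S _ _ (measurable_allIn T S)]
    simp [remaining, mul_comm]
  | succ m ih =>
    have hA : 0 < 2 + c := by positivity
    -- This `lam` makes `c / lam` at most half of `(2 + c)⁻¹`; the lower bound on `B` makes `c *
    -- lam` at most the other half of `(2 + c)⁻¹ * k` for every `k > B`.
    refine remaining_step hc0 hc (lam := 2 * (2 + c) ^ 2) le_rfl (by positivity) le_rfl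
      (by positivity) (by positivity) (fun k hk => ?_) ih
    have hk' : 4 * (2 + c) ^ 4 ≤ k := hB.trans (by exact_mod_cast hk.le)
    have h1 : c / (2 * (2 + c) ^ 2) ≤ 1 / (2 * (2 + c)) := by
      rw [div_le_div_iff₀ (by positivity) (by positivity)]
      nlinarith
    have h2 : c * (2 * (2 + c) ^ 2) ≤ 1 / (2 * (2 + c)) * k := by
      rw [div_mul_eq_mul_div, one_mul, le_div_iff₀ (by positivity)]
      have : c * (2 * (2 + c) ^ 2) * (2 * (2 + c)) ≤ 4 * (2 + c) ^ 4 := by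
        have : 0 ≤ 8 * (2 + c) ^ 3 := by positivity
        nlinarith
      linarith
    have h3 : c * (2 * (2 + c) ^ 2) + c / (2 * (2 + c) ^ 2) * k ≤ (2 + c)⁻¹ * k := by
      have : c / (2 * (2 + c) ^ 2) * k ≤ 1 / (2 * (2 + c)) * k := by gcongr
      have e : (2 + c)⁻¹ * k = 1 / (2 * (2 + c)) * k + 1 / (2 * (2 + c)) * k := by
        field_simp; ring
      linarith
    calc 2 * 0 + ((2 + c) ^ m)⁻¹ * (c * (2 * (2 + c) ^ 2) + c / (2 * (2 + c) ^ 2) * k)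
        ≤ ((2 + c) ^ m)⁻¹ * ((2 + c)⁻¹ * k) := by
          rw [mul_zero, zero_add]; gcongr
      _ = 0 + ((2 + c) ^ (m + 1))⁻¹ * k := by rw [pow_succ, mul_inv]; ring

variable {D} in
/-- At first the number of points drops to its square root at each level. -/
lemma remaining_sqrt {R : Set Point} {c : ℝ} (hc0 : 0 ≤ c) (hc : ChildrenBound D R c) {B : ℕ}
    (hB : 4 * (2 + c) ^ 4 ≤ B) (L j : ℕ) :
    ∀ (S : Finset ι) (T : Tri), T.interior ⊆ R → ∀ x,
      lmarginal (fun _ => D) S (fun p => ind (AllIn T S p) * remaining B (L + j) T S p) x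
        ≤ (ENNReal.ofReal (2 * (2 + c) ^ j / (2 + c) ^ L)
            + ENNReal.ofReal (2 * (2 + c) ^ j / (2 + c) ^ L / 2 ^ (2 ^ j)) * S.card) *
          lmarginal (fun _ => D) S (fun p => ind (AllIn T S p)) x := by
  have hA : 0 < 2 + c := by positivity
  induction j with
  | zero =>
    intro S T hT x
    refine (remaining_linear hc0 hc hB L S T hT x).trans ?_
    refine mul_le_mul' ?_ le_rfl
    gcongr
    · positivity
    · apply le_of_eq; field_simp; norm_num
  | succ j ih =>
    -- Let `N = 2 ^ (2 ^ j)`. The bound `θ * (1 + k / N)` becomes `θ * (2 + c) + θ * c * k / N ^ 2`,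
    -- which is at most `θ * (2 + c) * (1 + k / N ^ 2)`: the scale of `k` is squared at the cost of
    -- a factor `2 + c`. Seen from the root, the scales run downwards and the levels of geometric
    -- decay come last.
    refine remaining_step hc0 hc (lam := 2 ^ (2 ^ j)) (by positivity) (by positivity)
      (by positivity) (by positivity) (by positivity) (fun k hk => ?_) ih
    have e : (2 : ℝ) ^ (2 ^ (j + 1)) = 2 ^ (2 ^ j) * 2 ^ (2 ^ j) := by
      rw [pow_succ 2 j, mul_two, pow_add]
    rw [e, pow_succ]
    set N : ℝ := 2 ^ (2 ^ j)
    have hN : 0 < N := by positivity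
    set θ := 2 * (2 + c) ^ j / (2 + c) ^ L with hθ
    have hθ0 : 0 ≤ θ := by positivity
    have e2 : 2 * ((2 + c) ^ j * (2 + c)) / (2 + c) ^ L = θ * (2 + c) := by rw [hθ]; ring
    rw [e2]
    have e3 : θ * (2 + c) + θ * (2 + c) / (N * N) * k
        - (2 * θ + θ / N * (c * N + c / N * k)) = 2 * θ * k / (N * N) := by
      field_simp; ring
    have : 0 ≤ 2 * θ * k / (N * N) := by positivity
    linarith

variable {D} in
/-- After `2 L` levels, a bounded number of points is left in large triangles. -/
theorem remaining_le {R : Set Point} {c : ℝ} (hc0 : 0 ≤ c) (hc : ChildrenBound D R c) {B : ℕ}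
    (hB : 4 * (2 + c) ^ 4 ≤ B) (L : ℕ) (S : Finset ι) (hS : S.card ≤ 2 ^ (2 ^ L)) (T : Tri)
    (hT : T.interior ⊆ R) (x : ι → Point) :
    lmarginal (fun _ => D) S (fun p => ind (AllIn T S p) * remaining B (L + L) T S p) x
      ≤ 4 * lmarginal (fun _ => D) S (fun p => ind (AllIn T S p)) x := by
  refine (remaining_sqrt hc0 hc hB L L S T hT x).trans ?_
  refine mul_le_mul' ?_ le_rfl
  have hA : 0 < 2 + c := by positivity
  -- At `j = L` the growth `(2 + c) ^ L` cancels the decay of the last `L` levels exactly.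
  rw [mul_div_assoc, div_self (by positivity), ofReal_affine (by positivity) (by positivity)]
  have : (S.card : ℝ) ≤ 2 ^ (2 ^ L) := by exact_mod_cast hS
  have h2 : (2 : ℝ) * 1 / 2 ^ (2 ^ L) * S.card ≤ 2 := by
    rw [div_mul_eq_mul_div, div_le_iff₀ (by positivity)]; linarith
  calc ENNReal.ofReal (2 * 1 + 2 * 1 / 2 ^ (2 ^ L) * S.card) ≤ ENNReal.ofReal 4 :=
        ENNReal.ofReal_le_ofReal (by linarith)
    _ = 4 := by norm_num

end bound

end Chord
end

noncomputable section

namespace Chord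

/-! ### Covering points by a segment -/

lemma ratioDistTo_le {ε : ℝ} (hε : 0 ≤ ε) {q z : Point} (hq1 : 0 < q.1) (hq2 : 0 < q.2)
    {S : Set Point} (hz : z ∈ S) (h : Covers ε z q) : ratioDistTo q S ≤ ε := by
  have hb : BddBelow (Set.range fun w : S => ratioDist q w) :=
    ⟨0, by rintro _ ⟨w, rfl⟩; exact le_max_right _ _⟩
  refine (ciInf_le hb ⟨z, hz⟩).trans ?_
  refine max_le (max_le ?_ ?_) hε
  · rw [sub_le_iff_le_add, div_le_iff₀ hq1]; linarith [h.1]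
  · rw [sub_le_iff_le_add, div_le_iff₀ hq2]; linarith [h.2]

lemma covers_self {ε : ℝ} (hε : 0 ≤ ε) {q : Point} (hq1 : 0 < q.1) (hq2 : 0 < q.2) :
    Covers ε q q := ⟨by nlinarith, by nlinarith⟩

namespace Tri

/-- The chord of `T` is decreasing. -/
def Decreasing (T : Tri) : Prop := T.1.1 < T.2.1.1 ∧ T.2.1.2 < T.1.2

lemma wb_eq (T : Tri) (z : Point) :
    T.wb z = (T.2.1.1 - T.1.1) * (T.1.2 - z.2) - (T.1.2 - T.2.1.2) * (z.1 - T.1.1) := by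
  simp only [wb, cross, Prod.fst_sub, Prod.snd_sub]; ring

lemma Decreasing.wb_anti {T : Tri} (hT : T.Decreasing) {z w : Point} (h1 : z.1 ≤ w.1)
    (h2 : z.2 ≤ w.2) : T.wb w ≤ T.wb z := by
  obtain ⟨h3, h4⟩ := hT
  rw [wb_eq, wb_eq]
  have := mul_le_mul_of_nonneg_left h2 (sub_pos.2 h3).le
  have := mul_le_mul_of_nonneg_left h1 (sub_pos.2 h4).le
  linarith

/-- If `(1 + ε) • q` is not below the line of the chord, then `q` is covered by the chord point with
the abscissa of `(1 + ε) • q`, or by the right end if that abscissa is past it. -/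
lemma Decreasing.exists_covers {T : Tri} (hT : T.Decreasing) {ε : ℝ} {q : Point}
    (h1 : T.1.1 ≤ (1 + ε) * q.1) (h2 : T.2.1.2 ≤ (1 + ε) * q.2)
    (h : T.wb ((1 + ε) • q) ≤ 0) : ∃ z ∈ segment ℝ T.1 T.2.1, Covers ε z q := by
  obtain ⟨h3, h4⟩ := hT
  by_cases hr : T.2.1.1 ≤ (1 + ε) * q.1
  · exact ⟨T.2.1, right_mem_segment _ _ _, hr, h2⟩
  push Not at hr
  have hpos : 0 < T.2.1.1 - T.1.1 := sub_pos.2 h3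
  set t := ((1 + ε) * q.1 - T.1.1) / (T.2.1.1 - T.1.1) with ht
  have ht0 : 0 ≤ t := div_nonneg (sub_nonneg.2 h1) hpos.le
  have ht1 : t ≤ 1 := by rw [ht, div_le_one hpos]; linarith
  have hte : t * (T.2.1.1 - T.1.1) = (1 + ε) * q.1 - T.1.1 := by rw [ht]; field_simp
  refine ⟨(1 - t) • T.1 + t • T.2.1, ⟨1 - t, t, by linarith, ht0, by ring, rfl⟩, ?_, ?_⟩
  · simp only [Prod.fst_add, Prod.smul_fst, smul_eq_mul]; linarith
  · simp only [Prod.snd_add, Prod.smul_snd, smul_eq_mul]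
    rw [wb_eq] at h
    simp only [Prod.smul_fst, Prod.smul_snd, smul_eq_mul] at h
    rw [← hte] at h
    have : (T.2.1.1 - T.1.1) * ((T.1.2 - (1 + ε) * q.2) - (T.1.2 - T.2.1.2) * t) ≤ 0 := by
      linarith
    have := nonpos_of_mul_nonpos_right this hpos
    linarith

/-- A point that is not covered by the chord lies, even after scaling, below the chord. -/
lemma Decreasing.wb_pos_of_lt {T : Tri} (hT : T.Decreasing) {ε : ℝ} (hε : 0 ≤ ε) {q : Point}
    (hq1 : 0 < q.1) (hq2 : 0 < q.2) (h1 : T.1.1 ≤ q.1) (h2 : T.2.1.2 ≤ q.2)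
    (h : ε < ratioDistTo q (segment ℝ T.1 T.2.1)) : 0 < T.wb ((1 + ε) • q) := by
  by_contra hw
  obtain ⟨z, hz, hc⟩ := hT.exists_covers (ε := ε) (q := q) (by nlinarith) (by nlinarith)
    (not_lt.1 hw)
  exact absurd (ratioDistTo_le hε hq1 hq2 hz hc) (not_le.2 h)

end Tri

/-! ### Triangles of the recursion -/

/-- No two different pairs of points of `A` span parallel lines. -/
def GeneralPosition (A : Set Point) : Prop :=
  ∀ l ∈ A, ∀ r ∈ A, ∀ z ∈ A, ∀ w ∈ A, l ≠ r → z ≠ w → cross (r - l) (w - z) = 0 →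
    (z = l ∧ w = r) ∨ (z = r ∧ w = l)

/-- The invariant of the recursion: the vertices are in the expected position, the left and right
ones are in `A`, and `A` is above the two sides. -/
structure Valid (A : Set Point) (T : Tri) : Prop where
  left_mem : T.1 ∈ A
  right_mem : T.2.1 ∈ A
  decreasing : T.Decreasing
  bottom_le_right : T.2.2.1 ≤ T.2.1.1
  left_le_bottom : T.1.1 ≤ T.2.2.1
  right_le_bottom : T.2.1.2 ≤ T.2.2.2
  bottom_le_left : T.2.2.2 ≤ T.1.2
  area_pos : 0 < T.area
  wr_pos : ∀ z ∈ A, z ≠ T.1 → 0 < T.wr z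
  wl_pos : ∀ z ∈ A, z ≠ T.2.1 → 0 < T.wl z

/-! ### Valid triangles: their children, the points of a solution in them, their area -/

namespace Valid

variable {A : Set Point} {T : Tri}

lemma mem_interior (h : Valid A T) {z : Point} (hz : z ∈ A) (hw : 0 < T.wb z) :
    z ∈ T.interior := by
  refine ⟨h.wl_pos z hz ?_, h.wr_pos z hz ?_, hw⟩
  · rintro rfl; simp at hw
  · rintro rfl; simp at hw

lemma area_mul_fst (T : Tri) (q : Point) : T.area * (q.1 - T.1.1)
    = T.wr q * (T.2.1.1 - T.1.1) + T.wb q * (T.2.2.1 - T.1.1) := by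
  have := congrArg Prod.fst (T.smul_sub_left_bottom q)
  simp only [Prod.fst_sub, Prod.smul_fst, smul_eq_mul] at this
  linarith

lemma area_mul_snd (T : Tri) (q : Point) : T.area * (q.2 - T.1.2)
    = T.wr q * (T.2.1.2 - T.1.2) + T.wb q * (T.2.2.2 - T.1.2) := by
  have := congrArg Prod.snd (T.smul_sub_left_bottom q)
  simp only [Prod.snd_sub, Prod.smul_snd, smul_eq_mul] at this
  linarith

lemma area_mul_fst' (T : Tri) (q : Point) : T.area * (q.1 - T.2.1.1)
    = -(T.wl q * (T.2.1.1 - T.1.1)) + T.wb q * (T.2.2.1 - T.2.1.1) := by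
  have := congrArg Prod.fst (T.smul_sub_right_bottom q)
  simp only [Prod.fst_sub, Prod.smul_fst, smul_eq_mul, Prod.fst_neg] at this
  linarith

lemma area_mul_snd' (T : Tri) (q : Point) : T.area * (q.2 - T.2.1.2)
    = -(T.wl q * (T.2.1.2 - T.1.2)) + T.wb q * (T.2.2.2 - T.2.1.2) := by
  have := congrArg Prod.snd (T.smul_sub_right_bottom q)
  simp only [Prod.snd_sub, Prod.smul_snd, smul_eq_mul, Prod.snd_neg] at this
  linarith

lemma coord_of_mem (h : Valid A T) {q : Point} (hq : q ∈ T.interior) :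
    T.1.1 < q.1 ∧ q.1 < T.2.1.1 ∧ T.2.1.2 < q.2 ∧ q.2 < T.1.2 := by
  obtain ⟨h1, h2⟩ := h.decreasing
  obtain ⟨hl, hr, hb⟩ := hq
  have hT := h.area_pos
  refine ⟨?_, ?_, ?_, ?_⟩
  · refine sub_pos.1 ((pos_iff_pos_of_mul_pos (b := q.1 - T.1.1) ?_).1 hT)
    rw [area_mul_fst]
    have := mul_pos hr (sub_pos.2 h1)
    have := mul_nonneg hb.le (sub_nonneg.2 h.left_le_bottom)
    linarith
  · refine sub_pos.1 ((pos_iff_pos_of_mul_pos (b := T.2.1.1 - q.1) ?_).1 hT)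
    have e := area_mul_fst' T q
    have := mul_pos hl (sub_pos.2 h1)
    have := mul_nonneg hb.le (sub_nonneg.2 h.bottom_le_right)
    linarith
  · refine sub_pos.1 ((pos_iff_pos_of_mul_pos (b := q.2 - T.2.1.2) ?_).1 hT)
    rw [area_mul_snd']
    have := mul_pos hl (sub_pos.2 h2)
    have := mul_nonneg hb.le (sub_nonneg.2 h.right_le_bottom)
    linarith
  · refine sub_pos.1 ((pos_iff_pos_of_mul_pos (b := T.1.2 - q.2) ?_).1 hT)
    have e := area_mul_snd T q
    have := mul_pos hr (sub_pos.2 h2)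
    have := mul_nonneg hb.le (sub_nonneg.2 h.bottom_le_left)
    linarith

variable {q : Point}

/-- The side through the left vertex is inherited up to a positive factor in `wr`; the new side lies
on the parallel through `q`, and strict extremality of `q` puts the rest of `A` above it. -/
lemma left (h : Valid A T) (hqA : q ∈ A) (hq : q ∈ T.interior)
    (hmax : ∀ z ∈ A, z ≠ q → T.wb z < T.wb q) : Valid A (T.left q) := by
  have hT := h.area_pos
  obtain ⟨c1, c2, c3, c4⟩ := h.coord_of_mem hq
  obtain ⟨h1, h2⟩ := h.decreasing
  have hω : 0 < T.wb q / T.area := div_pos hq.2.2 hT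
  have hv : 0 < T.wr q / T.area := div_pos hq.2.1 hT
  have hω1 : T.wb q / T.area ≤ 1 := by
    rw [div_le_one hT, ← T.wl_add_wr_add_wb q]; linarith [hq.1, hq.2.1]
  have e := T.sub_bottom_left hT.ne' q
  have e1 := congrArg Prod.fst e
  have e2 := congrArg Prod.snd e
  simp only [Prod.fst_sub, Prod.snd_sub, Prod.smul_fst, Prod.smul_snd, smul_eq_mul] at e1 e2
  refine ⟨h.left_mem, hqA, ⟨c1, c4⟩, ?_, ?_, ?_, ?_, ?_, ?_, ?_⟩
  · change (T.left q).2.2.1 ≤ q.1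
    have := mul_pos hv (sub_pos.2 h1); linarith
  · change T.1.1 ≤ T.1.1 + T.wb q / T.area * (T.2.2.1 - T.1.1)
    have := mul_nonneg hω.le (sub_nonneg.2 h.left_le_bottom); linarith
  · change q.2 ≤ (T.left q).2.2.2
    have := mul_pos hv (sub_pos.2 h2); linarith
  · change T.1.2 + T.wb q / T.area * (T.2.2.2 - T.1.2) ≤ T.1.2
    have := mul_nonneg hω.le (sub_nonneg.2 h.bottom_le_left); linarith
  · rw [T.area_left]; exact mul_pos hω hq.2.1
  · intro z hz hzl
    rw [T.wr_left]; exact mul_pos hω (h.wr_pos z hz hzl)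
  · intro z hz hzq
    rw [T.wl_left hT.ne']
    exact mul_pos hv (sub_pos.2 (hmax z hz hzq))

lemma right (h : Valid A T) (hqA : q ∈ A) (hq : q ∈ T.interior)
    (hmax : ∀ z ∈ A, z ≠ q → T.wb z < T.wb q) : Valid A (T.right q) := by
  have hT := h.area_pos
  obtain ⟨c1, c2, c3, c4⟩ := h.coord_of_mem hq
  obtain ⟨h1, h2⟩ := h.decreasing
  have hω : 0 < T.wb q / T.area := div_pos hq.2.2 hT
  have hv : 0 < T.wl q / T.area := div_pos hq.1 hT
  have e := T.sub_bottom_right hT.ne' q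
  have e1 := congrArg Prod.fst e
  have e2 := congrArg Prod.snd e
  simp only [Prod.fst_sub, Prod.snd_sub, Prod.smul_fst, Prod.smul_snd, smul_eq_mul] at e1 e2
  refine ⟨hqA, h.right_mem, ⟨c2, c3⟩, ?_, ?_, ?_, ?_, ?_, ?_, ?_⟩
  · change T.2.1.1 + T.wb q / T.area * (T.2.2.1 - T.2.1.1) ≤ T.2.1.1
    have := mul_nonneg hω.le (sub_nonneg.2 h.bottom_le_right); linarith
  · change q.1 ≤ (T.right q).2.2.1
    have := mul_pos hv (sub_pos.2 h1); linarith
  · change T.2.1.2 ≤ T.2.1.2 + T.wb q / T.area * (T.2.2.2 - T.2.1.2)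
    have := mul_nonneg hω.le (sub_nonneg.2 h.right_le_bottom); linarith
  · change (T.right q).2.2.2 ≤ q.2
    have := mul_pos hv (sub_pos.2 h2); linarith
  · rw [T.area_right]; exact mul_pos hω hq.1
  · intro z hz hzq
    rw [T.wr_right hT.ne']
    exact mul_pos hv (sub_pos.2 (hmax z hz hzq))
  · intro z hz hzr
    rw [T.wl_right]; exact mul_pos hω (h.wl_pos z hz hzr)

/-- An `ε`-convex Pareto set has a point below each chord that does not suffice. -/
lemma exists_mem_interior (h : Valid A T) (hpos : ∀ z ∈ A, 0 < z.1 ∧ 0 < z.2) {ε : ℝ}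
    (hε : 0 ≤ ε) (hqA : q ∈ A) (hq : q ∈ T.interior)
    (hqε : ε < ratioDistTo q (segment ℝ T.1 T.2.1)) {S : Set Point}
    (hS : IsConvexPareto ε A S) : ∃ z ∈ S, z ∈ T.interior := by
  by_contra hno
  push Not at hno
  obtain ⟨z, hz, hzc⟩ := hS.2 q hqA
  -- A solution without points inside `T` would lie in this half-plane together with its hull, while
  -- by monotonicity of `wb` a point covering `q` has `wb` at least that of `(1 + ε) • q`, which is
  -- positive.
  have hconv : Convex ℝ {z | T.wb z ≤ 0} := by
    intro u hu v hv s t hs ht hst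
    have e : s • u + t • v = u + t • (v - u) := by
      rw [show s = 1 - t by linarith, sub_smul, one_smul, smul_sub]; abel
    change T.wb (s • u + t • v) ≤ 0
    rw [e, T.wb_line, show 1 - t = s by linarith]
    have := mul_nonpos_of_nonneg_of_nonpos hs hu
    have := mul_nonpos_of_nonneg_of_nonpos ht hv
    linarith
  have hle : T.wb z ≤ 0 := by
    refine convexHull_min (fun w hw => ?_) hconv hz
    by_contra hw'
    exact hno w hw (h.mem_interior (hS.1 hw) (not_le.1 hw'))
  obtain ⟨c1, c2, c3, c4⟩ := h.coord_of_mem hq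
  have h1 := h.decreasing.wb_pos_of_lt hε (hpos q hqA).1 (hpos q hqA).2 c1.le c3.le hqε
  have h2 := h.decreasing.wb_anti (z := z) (w := (1 + ε) • q) hzc.1 hzc.2
  linarith

lemma area_le (h : Valid A T) : T.area ≤ (T.2.1.1 - T.1.1) * (T.1.2 - T.2.1.2) := by
  rw [← T.wb_bottom_vertex, T.wb_eq]
  have h1 := mul_nonneg (sub_pos.2 h.decreasing.2).le (sub_nonneg.2 h.left_le_bottom)
  have h2 := mul_le_mul_of_nonneg_left (sub_le_sub_left h.right_le_bottom T.1.2)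
    (sub_pos.2 h.decreasing.1).le
  linarith

/-- A triangle whose bottom vertex is not covered by its chord is not too small. -/
lemma le_area (h : Valid A T) {ε η : ℝ} (hε : 0 < ε) (hη : 0 < η)
    (hA : ∀ z ∈ A, η ≤ z.1 ∧ η ≤ z.2)
    (hs : ε < ratioDistTo T.2.2 (segment ℝ T.1 T.2.1)) : 4 * ε ^ 2 * η ^ 2 ≤ T.area := by
  have hs1 : η ≤ T.2.2.1 := (hA _ h.left_mem).1.trans h.left_le_bottom
  have hs2 : η ≤ T.2.2.2 := (hA _ h.right_mem).2.trans h.right_le_bottom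
  have h1 := h.decreasing.wb_pos_of_lt hε.le (hη.trans_le hs1) (hη.trans_le hs2)
    h.left_le_bottom h.right_le_bottom hs
  have h2 := h.area_le
  have h0 := h.area_pos
  have h3 := T.wb_bottom_vertex
  rw [T.wb_eq] at h1 h3
  simp only [Prod.smul_fst, Prod.smul_snd, smul_eq_mul] at h1
  obtain ⟨d1, d2⟩ := h.decreasing
  set u := T.2.1.1 - T.1.1
  set v := T.1.2 - T.2.1.2
  have hu : 0 < u := sub_pos.2 d1
  have hv : 0 < v := sub_pos.2 d2
  -- The area is the value of `wb` at the bottom vertex, and `wb` remains positive after scaling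
  -- that vertex by `1 + ε`; the scaling lowers `wb` by `ε * (u * T.2.2.2 + v * T.2.2.1)`.
  have h4 : ε * η * (u + v) ≤ T.area := by
    have a1 : ε * η * u ≤ ε * T.2.2.2 * u := by gcongr
    have a2 : ε * η * v ≤ ε * T.2.2.1 * v := by gcongr
    nlinarith
  have h5 : (ε * η * (u + v)) ^ 2 ≤ T.area ^ 2 := by gcongr
  -- Uses `T.area ≤ u * v ≤ (u + v) ^ 2 / 4`; one factor `T.area` then cancels.
  have h6 : 4 * (ε * η) ^ 2 * T.area ≤ T.area * T.area := by
    have : 4 * (ε * η) ^ 2 * T.area ≤ 4 * (ε * η) ^ 2 * (u * v) := by gcongr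
    have : (ε * η) ^ 2 * (4 * (u * v)) ≤ (ε * η) ^ 2 * (u + v) ^ 2 := by
      gcongr; nlinarith [sq_nonneg (u - v)]
    nlinarith
  have := le_of_mul_le_mul_right h6 h0
  linarith

end Valid

/-! ### One step of the algorithm -/

/-- At the slope of the chord, `wb` is a constant minus a positive multiple of the combined
objective. -/
lemma IsComb.wb_le {A : Set Point} {comb : ℝ≥0∞ → Point} (hc : IsComb A comb) {T : Tri}
    (hT : T.Decreasing) {z : Point} (hz : z ∈ A) :
    T.wb z ≤ T.wb (comb (slope T.1 T.2.1)) := by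
  have h := (hc (slope T.1 T.2.1)).2 z hz
  have h1 : 0 < T.2.1.1 - T.1.1 := sub_pos.2 hT.1
  have h2 : 0 < T.1.2 - T.2.1.2 := sub_pos.2 hT.2
  rw [combObjective, combObjective, if_neg (by simp [slope]), if_neg (by simp [slope])] at h
  generalize comb (slope T.1 T.2.1) = q at *
  rw [slope, ENNReal.toReal_ofReal (div_pos h2 h1).le] at h
  rw [T.wb_eq, T.wb_eq]
  have h3 := mul_le_mul_of_nonneg_left h h1.le
  have e : ∀ w : Point, (T.2.1.1 - T.1.1) * (w.2 + (T.1.2 - T.2.1.2) / (T.2.1.1 - T.1.1) * w.1)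
      = (T.2.1.1 - T.1.1) * w.2 + (T.1.2 - T.2.1.2) * w.1 := fun w => by field_simp
  rw [e, e] at h3
  linarith

/-- The number of calls of the recursive routine on the triangle `T` in `d` levels. -/
def callsIn (comb : ℝ≥0∞ → Point) (ε : ℝ) (d : ℕ) (T : Tri) : ℕ :=
  callsUpTo comb ε d T.1 T.2.1 T.2.2

section step

variable {A : Set Point} {T : Tri} {comb : ℝ≥0∞ → Point} {ε : ℝ}

lemma callsIn_of_bottom_le (h : ratioDistTo T.2.2 (segment ℝ T.1 T.2.1) ≤ ε) (d : ℕ) :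
    callsIn comb ε d T = 0 := by
  cases d <;> simp [callsIn, callsUpTo, h]

lemma callsIn_succ_of_le (h : ¬ ratioDistTo T.2.2 (segment ℝ T.1 T.2.1) ≤ ε)
    (hq : ratioDistTo (comb (slope T.1 T.2.1)) (segment ℝ T.1 T.2.1) ≤ ε) (d : ℕ) :
    callsIn comb ε (d + 1) T = 1 := by
  simp [callsIn, callsUpTo, h, hq]

lemma callsIn_succ (h : ¬ ratioDistTo T.2.2 (segment ℝ T.1 T.2.1) ≤ ε)
    (hq : ¬ ratioDistTo (comb (slope T.1 T.2.1)) (segment ℝ T.1 T.2.1) ≤ ε) (d : ℕ) :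
    callsIn comb ε (d + 1) T = 1 + callsIn comb ε d (T.left (comb (slope T.1 T.2.1)))
      + callsIn comb ε d (T.right (comb (slope T.1 T.2.1))) := by
  simp only [callsIn, callsUpTo, h, hq, if_false]
  rw [T.meet_left, T.meet_right]
  rfl

/-- In general position, a point of `A` that is extreme in the direction of the chord and is not
covered by it is the only extreme one, and is below the chord. -/
lemma Valid.extreme (h : Valid A T) (hgp : GeneralPosition A)
    (hpos : ∀ z ∈ A, 0 < z.1 ∧ 0 < z.2) (hε : 0 ≤ ε) {q : Point} (hqA : q ∈ A)
    (hmax : ∀ z ∈ A, T.wb z ≤ T.wb q) (hq : ¬ ratioDistTo q (segment ℝ T.1 T.2.1) ≤ ε) :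
    q ∈ T.interior ∧ ∀ z ∈ A, z ≠ q → T.wb z < T.wb q := by
  have hlr : T.1 ≠ T.2.1 := fun e => lt_irrefl _ (e ▸ h.decreasing.1)
  have hql : q ≠ T.1 := by
    rintro rfl
    exact hq (ratioDistTo_le hε (hpos _ hqA).1 (hpos _ hqA).2 (left_mem_segment _ _ _)
      (covers_self hε (hpos _ hqA).1 (hpos _ hqA).2))
  have hqr : q ≠ T.2.1 := by
    rintro rfl
    exact hq (ratioDistTo_le hε (hpos _ hqA).1 (hpos _ hqA).2 (right_mem_segment _ _ _)
      (covers_self hε (hpos _ hqA).1 (hpos _ hqA).2))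
  -- A tie spans a line parallel to the chord, so by general position `q` would be an end of the
  -- chord; but the ends are covered.
  have htie : ∀ z ∈ A, z ≠ q → T.wb z < T.wb q := by
    intro z hz hzq
    refine lt_of_le_of_ne (hmax z hz) fun e => ?_
    have hc : cross (T.2.1 - T.1) (q - z) = 0 := by rw [T.cross_chord]; linarith
    rcases hgp _ h.left_mem _ h.right_mem _ hz _ hqA hlr hzq hc with ⟨_, h2⟩ | ⟨_, h2⟩
    · exact hqr h2
    · exact hql h2
  have hl := htie _ h.left_mem hql.symm
  rw [T.wb_left_vertex] at hl
  exact ⟨h.mem_interior hqA hl, htie⟩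

/-- Either the routine stops on `T`, or it recurses on two valid triangles. -/
lemma Valid.step (h : Valid A T) (hgp : GeneralPosition A)
    (hpos : ∀ z ∈ A, 0 < z.1 ∧ 0 < z.2) (hε : 0 ≤ ε) (hc : IsComb A comb) :
    (∀ d, callsIn comb ε d T ≤ 1) ∨
    ∃ q ∈ A, q ∈ T.interior ∧ (∀ z ∈ A, z ≠ q → T.wb z < T.wb q) ∧
      ε < ratioDistTo q (segment ℝ T.1 T.2.1) ∧ Valid A (T.left q) ∧ Valid A (T.right q) ∧
      ∀ d, callsIn comb ε (d + 1) T
        = 1 + callsIn comb ε d (T.left q) + callsIn comb ε d (T.right q) := by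
  by_cases hs : ratioDistTo T.2.2 (segment ℝ T.1 T.2.1) ≤ ε
  · exact Or.inl fun d => by simp [callsIn_of_bottom_le hs d]
  by_cases hq : ratioDistTo (comb (slope T.1 T.2.1)) (segment ℝ T.1 T.2.1) ≤ ε
  · refine Or.inl fun d => ?_
    cases d with
    | zero => simp [callsIn, callsUpTo]
    | succ d => rw [callsIn_succ_of_le hs hq]
  · have hqA := (hc (slope T.1 T.2.1)).1
    obtain ⟨h1, h2⟩ := h.extreme hgp hpos hε hqA (fun z hz => hc.wb_le h.decreasing hz) hq
    exact Or.inr ⟨_, hqA, h1, h2, not_le.1 hq, h.left hqA h1 h2, h.right hqA h1 h2,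
      callsIn_succ hs hq⟩

/-- The number of calls is bounded in terms of the area. -/
lemma Valid.callsIn_mul_le (hgp : GeneralPosition A) (hε : 0 < ε) {η : ℝ} (hη : 0 < η)
    (hA : ∀ z ∈ A, η ≤ z.1 ∧ η ≤ z.2) (hc : IsComb A comb) (d : ℕ) :
    ∀ {T : Tri}, Valid A T →
      (callsIn comb ε d T : ℝ) * (4 * ε ^ 2 * η ^ 2) ≤ 4 / 3 * T.area := by
  have hpos : ∀ z ∈ A, 0 < z.1 ∧ 0 < z.2 := fun z hz =>
    ⟨hη.trans_le (hA z hz).1, hη.trans_le (hA z hz).2⟩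
  induction d with
  | zero => intro T h; simpa [callsIn, callsUpTo] using h.area_pos.le
  | succ d ih =>
    intro T h
    have hT := h.area_pos
    by_cases hs : ratioDistTo T.2.2 (segment ℝ T.1 T.2.1) ≤ ε
    · rw [callsIn_of_bottom_le hs]; simpa using hT.le
    have hκ := h.le_area hε hη hA (not_le.1 hs)
    have hκ0 : 0 < 4 * ε ^ 2 * η ^ 2 := by positivity
    rcases h.step hgp hpos hε.le hc with h1 | ⟨q, _, hq, _, _, hl, hr, hd⟩
    · have : (callsIn comb ε (d + 1) T : ℝ) ≤ 1 := by exact_mod_cast h1 _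
      nlinarith
    · rw [hd d]
      push_cast
      have i1 := ih hl
      have i2 := ih hr
      have e := T.area_left_add_area_right q
      -- This explains the constant `4 / 3`: the call itself is paid by the area of `T`, and the
      -- children by `4 / 3` of a quarter of it.
      have hle : T.wb q / T.area * (T.area - T.wb q) ≤ T.area / 4 := by
        rw [div_mul_eq_mul_div, div_le_iff₀ hT]
        nlinarith [sq_nonneg (T.area - 2 * T.wb q)]
      linarith

end step

end Chord
end

noncomputable section

namespace Chord

/-! ### Counting the calls -/

section counting

variable {ι : Type*} [Fintype ι] {A : Set Point} {T₀ : Tri} {comb : ℝ≥0∞ → Point} {ε : ℝ}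
  {p : ι → Point}

omit [Fintype ι] in
lemma inside_inside {T T' : Tri} (h : T'.interior ⊆ T.interior) (J : Finset ι) (p : ι → Point) :
    inside T' (inside T J p) p = inside T' J p := by
  ext j
  simp only [mem_inside]
  exact ⟨fun ⟨⟨h1, _⟩, h3⟩ => ⟨h1, h3⟩, fun ⟨h1, h3⟩ => ⟨⟨h1, h h3⟩, h3⟩⟩

lemma card_inside_children_lt {T : Tri} {i : ι} (hi : p i ∈ T.interior) :
    (inside (T.left (p i)) Finset.univ p).card + (inside (T.right (p i)) Finset.univ p).card + 1
      ≤ (inside T Finset.univ p).card := by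
  classical
  have hl := Tri.left_interior_subset hi
  have hr := Tri.right_interior_subset hi
  have hd : Disjoint (inside (T.left (p i)) Finset.univ p)
      (inside (T.right (p i)) Finset.univ p) := by
    refine Finset.disjoint_left.2 fun j h1 h2 => ?_
    exact Set.disjoint_left.1 (Tri.disjoint_left_right hi) (mem_inside.1 h1).2 (mem_inside.1 h2).2
  rw [← Finset.card_union_of_disjoint hd]
  refine Finset.card_lt_card ⟨fun j hj => ?_, fun h => ?_⟩
  · rcases Finset.mem_union.1 hj with hj | hj
    · exact mem_inside.2 ⟨Finset.mem_univ _, (hl (mem_inside.1 hj).2).1⟩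
    · exact mem_inside.2 ⟨Finset.mem_univ _, (hr (mem_inside.1 hj).2).1⟩
  · rcases Finset.mem_union.1 (h (mem_inside.2 ⟨Finset.mem_univ i, hi⟩)) with hj | hj
    · exact lt_irrefl _ (hl (mem_inside.1 hj).2).2.1
    · exact lt_irrefl _ (hr (mem_inside.1 hj).2).2.1

/-- Every recursion uses up the point found, which is in neither child; the constant `1` is for a
triangle on which the routine stops after one call. -/
lemma Valid.callsIn_le_card (hgp : GeneralPosition A) (hpos : ∀ z ∈ A, 0 < z.1 ∧ 0 < z.2)
    (hε : 0 ≤ ε) (hc : IsComb A comb) (hin : ∀ z ∈ A, z ∈ T₀.interior → z ∈ Set.range p)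
    (d : ℕ) : ∀ {T : Tri}, Valid A T → T.interior ⊆ T₀.interior →
      callsIn comb ε d T ≤ 1 + 2 * (inside T Finset.univ p).card := by
  induction d with
  | zero => intro T _ _; simp [callsIn, callsUpTo]
  | succ d ih =>
    intro T h hT
    rcases h.step hgp hpos hε hc with h1 | ⟨q, hqA, hq, _, _, hl, hr, hd⟩
    · exact (h1 _).trans (by omega)
    · obtain ⟨i, rfl⟩ := hin q hqA (hT hq)
      have i1 := ih hl fun z hz => hT (Tri.left_interior_subset hq hz).1
      have i2 := ih hr fun z hz => hT (Tri.right_interior_subset hq hz).1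
      have := card_inside_children_lt hq
      rw [hd d]
      omega

lemma encard_children_le {T : Tri} {q : Point} (hq : q ∈ T.interior) (S : Set Point) :
    (S ∩ (T.left q).interior).encard + (S ∩ (T.right q).interior).encard
      ≤ (S ∩ T.interior).encard := by
  rw [← Set.encard_union_eq ((Tri.disjoint_left_right hq).mono Set.inter_subset_right
    Set.inter_subset_right), ← Set.inter_union_distrib_left]
  refine Set.encard_le_encard (Set.inter_subset_inter_right _ (Set.union_subset ?_ ?_))
  · exact fun z hz => (Tri.left_interior_subset hq hz).1
  · exact fun z hz => (Tri.right_interior_subset hq hz).1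

/-- The first `m` levels cost at most the size of a solution each; small triangles cost at most `B`
per point of the solution; the other points are counted by `remaining`. -/
lemma Valid.callsIn_le_remaining (hgp : GeneralPosition A) (hpos : ∀ z ∈ A, 0 < z.1 ∧ 0 < z.2)
    (hε : 0 ≤ ε) (hc : IsComb A comb) (hpA : ∀ i, p i ∈ A) (hinj : Function.Injective p)
    (hin : ∀ z ∈ A, z ∈ T₀.interior → z ∈ Set.range p) {S : Set Point}
    (hS : IsConvexPareto ε A S) (B m : ℕ) :
    ∀ (d : ℕ) {T : Tri}, Valid A T → T.interior ⊆ T₀.interior →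
      (callsIn comb ε d T : ℝ≥0∞) ≤ 1 + 2 * (m + B) * ((S ∩ T.interior).encard : ℝ≥0∞)
        + 2 * remaining B m T (inside T Finset.univ p) p := by
  induction m with
  | zero =>
    intro d T h hT
    have h1 := h.callsIn_le_card hgp hpos hε hc hin d hT
    have h2 : (callsIn comb ε d T : ℝ≥0∞) ≤ 1 + 2 * ((inside T Finset.univ p).card : ℝ≥0∞) := by
      exact_mod_cast h1
    refine h2.trans ?_
    rw [add_right_comm]
    exact le_self_add
  | succ m ih =>
    intro d T h hT
    cases d with
    | zero => simp [callsIn, callsUpTo]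
    | succ d =>
    rcases h.step hgp hpos hε hc with h1 | ⟨q, hqA, hq, hmax, hqε, hl, hr, hd⟩
    · refine le_trans (Nat.cast_le.2 (h1 _)) ?_
      rw [Nat.cast_one, add_assoc]
      exact le_self_add
    obtain ⟨z, hzS, hzT⟩ := h.exists_mem_interior hpos hε hqA hq hqε hS
    -- This is where the optimum enters: the point of the solution in `T` pays for the present
    -- level.
    have hN : (1 : ℝ≥0∞) ≤ ((S ∩ T.interior).encard : ℝ≥0∞) := by
      have : (1 : ℕ∞) ≤ (S ∩ T.interior).encard :=
        Set.one_le_encard_iff_nonempty.2 ⟨z, hzS, hzT⟩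
      exact_mod_cast this
    set N := ((S ∩ T.interior).encard : ℝ≥0∞) with hNdef
    obtain ⟨i, rfl⟩ := hin q hqA (hT hq)
    have hlT : (T.left (p i)).interior ⊆ T.interior := fun z hz =>
      (Tri.left_interior_subset hq hz).1
    have hrT : (T.right (p i)).interior ⊆ T.interior := fun z hz =>
      (Tri.right_interior_subset hq hz).1
    by_cases hB : (inside T Finset.univ p).card ≤ B
    · have h1 := h.callsIn_le_card hgp hpos hε hc hin (d + 1) hT
      -- For a small triangle, where `remaining` contributes nothing, the whole subtree is charged
      -- to that point.
      have h2 : (callsIn comb ε (d + 1) T : ℝ≥0∞) ≤ 1 + 2 * (B : ℝ≥0∞) := by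
        exact_mod_cast h1.trans (by omega)
      calc (callsIn comb ε (d + 1) T : ℝ≥0∞) ≤ 1 + 2 * (B : ℝ≥0∞) := h2
        _ ≤ 1 + 2 * (((m + 1 : ℕ) : ℝ≥0∞) + B) * N := by
            refine add_le_add le_rfl ?_
            calc (2 : ℝ≥0∞) * B = 2 * B * 1 := by ring
              _ ≤ 2 * (((m + 1 : ℕ) : ℝ≥0∞) + B) * N := by
                gcongr
                exact le_add_self
        _ ≤ _ := le_self_add
    push Not at hB
    have hX : IsExtreme T (inside T Finset.univ p) p i := by
      refine ⟨mem_inside.2 ⟨Finset.mem_univ _, hq⟩, fun j _ hji => hmax _ (hpA j) fun e => hji ?_⟩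
      exact hinj e
    have hrem : remaining B m (T.left (p i)) (inside (T.left (p i)) Finset.univ p) p
        + remaining B m (T.right (p i)) (inside (T.right (p i)) Finset.univ p) p
        ≤ remaining B (m + 1) T (inside T Finset.univ p) p := by
      rw [remaining, if_neg (not_le.2 hB)]
      refine le_trans ?_ (Finset.single_le_sum (fun _ _ => zero_le) hX.1)
      rw [ind_of_true hX, one_mul, inside_inside hlT, inside_inside hrT]
    have hsplit : ((S ∩ (T.left (p i)).interior).encard : ℝ≥0∞)
        + ((S ∩ (T.right (p i)).interior).encard : ℝ≥0∞) ≤ N := by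
      rw [hNdef]
      exact_mod_cast encard_children_le hq S
    have i1 := ih d hl (hlT.trans hT)
    have i2 := ih d hr (hrT.trans hT)
    rw [hd d]
    push_cast
    calc (1 : ℝ≥0∞) + callsIn comb ε d (T.left (p i)) + callsIn comb ε d (T.right (p i))
        ≤ 1 + (1 + 2 * (m + B) * ((S ∩ (T.left (p i)).interior).encard : ℝ≥0∞)
            + 2 * remaining B m (T.left (p i)) (inside (T.left (p i)) Finset.univ p) p)
          + (1 + 2 * (m + B) * ((S ∩ (T.right (p i)).interior).encard : ℝ≥0∞)
            + 2 * remaining B m (T.right (p i)) (inside (T.right (p i)) Finset.univ p) p) := by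
          gcongr
      -- Of the three units, one from this call and one from each child, one is kept as the additive
      -- constant and two are paid by `N`.
      _ = 1 + 2 * 1 + 2 * (m + B) * (((S ∩ (T.left (p i)).interior).encard : ℝ≥0∞)
            + ((S ∩ (T.right (p i)).interior).encard : ℝ≥0∞))
          + 2 * (remaining B m (T.left (p i)) (inside (T.left (p i)) Finset.univ p) p
            + remaining B m (T.right (p i)) (inside (T.right (p i)) Finset.univ p) p) := by ring
      _ ≤ 1 + 2 * N + 2 * (m + B) * N
          + 2 * remaining B (m + 1) T (inside T Finset.univ p) p := by gcongr
      _ = _ := by ring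

end counting

end Chord
end

noncomputable section

namespace Chord

/-! ### The root triangle -/

/-- The root triangle, as a triangle of the recursion. -/
def root (a b : Point) : Tri := (a, b, (a.1, b.2))

section root

variable {a b : Point}

lemma root_area (a b : Point) : (root a b).area = (b.1 - a.1) * (a.2 - b.2) := by
  simp only [root, Tri.area, cross, Prod.fst_sub, Prod.snd_sub]; ring

lemma root_wl (a b z : Point) : (root a b).wl z = (b.1 - a.1) * (z.2 - b.2) := by
  simp only [root, Tri.wl, cross, Prod.fst_sub, Prod.snd_sub]; ring

lemma root_wr (a b z : Point) : (root a b).wr z = (z.1 - a.1) * (a.2 - b.2) := by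
  simp only [root, Tri.wr, cross, Prod.fst_sub, Prod.snd_sub]; ring

lemma root_area_pos (h1 : a.1 < b.1) (h2 : b.2 < a.2) : 0 < (root a b).area := by
  rw [root_area]; exact mul_pos (sub_pos.2 h1) (sub_pos.2 h2)

lemma root_interior_subset (h1 : a.1 < b.1) (h2 : b.2 < a.2) :
    (root a b).interior ⊆ rootTriangle a b := by
  rintro z ⟨hl, hr, hb⟩
  have hA := root_area_pos h1 h2
  have hsum := (root a b).wl_add_wr_add_wb z
  have e : z = ((root a b).wl z / (root a b).area) • a + ((root a b).wr z / (root a b).area) • b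
      + ((root a b).wb z / (root a b).area) • ((a.1, b.2) : Point) := by
    have e1 : (root a b).wb z = (root a b).area - (root a b).wl z - (root a b).wr z := by linarith
    rw [e1]
    have h3 : b.1 - a.1 ≠ 0 := (sub_pos.2 h1).ne'
    have h4 : a.2 - b.2 ≠ 0 := (sub_pos.2 h2).ne'
    rw [root_wl, root_wr, root_area]
    ext
    · simp only [Prod.fst_add, Prod.smul_fst, smul_eq_mul]; field_simp; ring
    · simp only [Prod.snd_add, Prod.smul_snd, smul_eq_mul]; field_simp; ring
  have hconv : Convex ℝ (rootTriangle a b) := convex_convexHull ℝ _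
  rw [e]
  have hsum3 := hconv.sum_mem (t := Finset.univ)
    (w := ![(root a b).wl z / (root a b).area, (root a b).wr z / (root a b).area,
      (root a b).wb z / (root a b).area]) (z := ![a, b, (a.1, b.2)]) ?_ ?_ ?_
  · simpa [Fin.sum_univ_three] using hsum3
  · intro i _
    fin_cases i
    · exact (div_pos hl hA).le
    · exact (div_pos hr hA).le
    · exact (div_pos hb hA).le
  · simp only [Fin.sum_univ_three, Matrix.cons_val_zero, Matrix.cons_val_one, Matrix.cons_val]
    rw [← add_div, ← add_div, hsum, div_self hA.ne']
  · intro i _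
    fin_cases i <;> exact subset_convexHull ℝ _ (by simp)

lemma convex_nonneg_of_line {f : Point → ℝ}
    (hf : ∀ u v t, f (u + t • (v - u)) = (1 - t) * f u + t * f v) : Convex ℝ {z | 0 ≤ f z} := by
  intro u hu v hv s t hs ht hst
  have e : s • u + t • v = u + t • (v - u) := by
    rw [show s = 1 - t by linarith, sub_smul, one_smul, smul_sub]; abel
  change 0 ≤ f (s • u + t • v)
  rw [e, hf, show 1 - t = s by linarith]
  exact add_nonneg (mul_nonneg hs hu) (mul_nonneg ht hv)

lemma rootTriangle_subset (h1 : a.1 < b.1) (h2 : b.2 < a.2) :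
    rootTriangle a b
      ⊆ {z | 0 ≤ (root a b).wl z} ∩ ({z | 0 ≤ (root a b).wr z} ∩ {z | 0 ≤ (root a b).wb z}) := by
  have hA := (root_area_pos h1 h2).le
  have e1 : (root a b).wl a = (root a b).area := by rw [root_wl, root_area]
  have e2 : (root a b).wr b = (root a b).area := by rw [root_wr, root_area]
  refine convexHull_min ?_ ((convex_nonneg_of_line (Tri.wl_line _)).inter
    ((convex_nonneg_of_line (Tri.wr_line _)).inter (convex_nonneg_of_line (Tri.wb_line _))))
  rintro z (rfl | rfl | rfl)
  · exact ⟨hA.trans e1.ge, (Tri.wr_left_vertex (root z b)).ge, (Tri.wb_left_vertex (root z b)).ge⟩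
  · exact ⟨(Tri.wl_right_vertex (root a z)).ge, hA.trans e2.ge, (Tri.wb_right_vertex (root a z)).ge⟩
  · refine ⟨?_, ?_, ?_⟩
    · simp [root_wl]
    · simp [root_wr]
    · exact hA

end root

lemma volume_line {v : Point} (hv : v ≠ 0) (c : Point) :
    volume {z : Point | cross v (z - c) = 0} = 0 := by
  let f : Point →ₗ[ℝ] ℝ := v.1 • LinearMap.snd ℝ ℝ ℝ - v.2 • LinearMap.fst ℝ ℝ ℝ
  have hf : ∀ z, f z = cross v z := fun z => by simp [f, cross]
  have hker : LinearMap.ker f ≠ ⊤ := by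
    intro h
    refine hv ?_
    have h1 : f (0, 1) = 0 := LinearMap.mem_ker.1 (h ▸ Submodule.mem_top)
    have h2 : f (1, 0) = 0 := LinearMap.mem_ker.1 (h ▸ Submodule.mem_top)
    ext
    · simpa [f] using h1
    · simpa [f] using h2
  have e : {z : Point | cross v (z - c) = 0}
      = (fun z => z + -c) ⁻¹' (LinearMap.ker f : Set Point) := by
    ext z; simp [hf, sub_eq_add_neg]
  rw [e, measure_preimage_add_right]
  exact Measure.addHaar_submodule _ _ hker


lemma volume_rootTriangle_sdiff {a b : Point} (h1 : a.1 < b.1) (h2 : b.2 < a.2) :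
    volume (rootTriangle a b \ (root a b).interior) = 0 := by
  set T := root a b with hT
  have hab : b - a ≠ 0 := fun h => (sub_pos.2 h1).ne' (congrArg Prod.fst h)
  have ha : T.2.2 - T.1 ≠ 0 := fun h => by
    have := congrArg Prod.snd h
    simp only [hT, root, Prod.snd_sub, Prod.snd_zero] at this; linarith
  have hb : T.2.1 - T.2.2 ≠ 0 := fun h => by
    have := congrArg Prod.fst h
    simp only [hT, root, Prod.fst_sub, Prod.fst_zero] at this; linarith
  refine measure_mono_null (t := {z | cross (T.2.1 - T.2.2) (z - T.2.2) = 0}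
    ∪ ({z | cross (T.2.2 - T.1) (z - T.1) = 0} ∪ {z | cross (b - a) (z - a) = 0})) ?_
    (measure_union_null (volume_line hb _) (measure_union_null (volume_line ha _)
      (volume_line hab _)))
  rintro z ⟨hz, hzi⟩
  obtain ⟨hl, hr, hw⟩ := rootTriangle_subset h1 h2 hz
  by_contra hno
  simp only [Set.mem_union, Set.mem_ofPred_eq, not_or] at hno
  refine hzi ⟨lt_of_le_of_ne hl (Ne.symm hno.1), lt_of_le_of_ne hr (Ne.symm hno.2.1),
    lt_of_le_of_ne hw fun h => hno.2.2 ?_⟩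
  have := T.cross_chord z a
  have e : T.wb a = 0 := T.wb_left_vertex
  rw [e, ← h, sub_zero] at this
  exact this

lemma measurableSet_rootTriangle (a b : Point) : MeasurableSet (rootTriangle a b) :=
  ((Set.toFinite _).isCompact_convexHull (𝕜 := ℝ)).measurableSet

lemma volume_rootTriangle_ne_top (a b : Point) : volume (rootTriangle a b) ≠ ⊤ :=
  ((Set.toFinite _).isCompact_convexHull (𝕜 := ℝ)).measure_ne_top

/-! ### Null sets of a balanced distribution -/

namespace IsBalanced

variable {γ : ℝ} {a b : Point} {D : Measure Point}

lemma absolutelyContinuous {R : Set Point} (h : IsBalanced γ R D) (hR : MeasurableSet R)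
    {N : Set Point} (hNm : MeasurableSet N) (hN : volume N = 0) : D N = 0 := by
  have h1 : D (N ∩ R) = 0 := by
    refine le_antisymm ((h.upper _ Set.inter_subset_right (hNm.inter hR)).trans ?_) zero_le
    have : ProbabilityTheory.cond volume R (N ∩ R) = 0 := by
      rw [ProbabilityTheory.cond_apply hR,
        measure_mono_null (Set.inter_subset_right.trans Set.inter_subset_left) hN, mul_zero]
    rw [this, ENNReal.zero_div]
  refine measure_mono_null (t := N ∩ R ∪ Rᶜ) (fun z hz => ?_) (measure_union_null h1 h.supported)
  by_cases hzR : z ∈ R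
  · exact Or.inl ⟨hz, hzR⟩
  · exact Or.inr hzR

lemma ae_mem_interior (h1 : a.1 < b.1) (h2 : b.2 < a.2) (h : IsBalanced γ (rootTriangle a b) D) :
    ∀ᵐ z ∂D, z ∈ (root a b).interior := by
  have hm := measurableSet_rootTriangle a b
  have h0 := h.absolutelyContinuous hm (hm.diff (root a b).measurableSet_interior)
    (volume_rootTriangle_sdiff h1 h2)
  refine measure_mono_null (t := rootTriangle a b \ (root a b).interior ∪ (rootTriangle a b)ᶜ)
    (fun z hz => ?_) (measure_union_null h0 h.supported)
  by_cases hzR : z ∈ rootTriangle a b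
  · exact Or.inl ⟨hzR, hz⟩
  · exact Or.inr hzR

lemma line_null {R : Set Point} (h : IsBalanced γ R D) (hR : MeasurableSet R) {v : Point}
    (hv : v ≠ 0) (c : Point) : D {z | cross v (z - c) = 0} = 0 :=
  h.absolutelyContinuous hR
    (measurable_cross measurable_const (by fun_prop) (measurableSet_singleton 0)) (volume_line hv c)

end IsBalanced

/-! ### Almost surely, an instance is in general position -/

section generalPosition

variable {n : ℕ} {γ : ℝ} {a b : Point} {D : Measure Point}

/-- Once the other points are fixed, `c p` and `v p` determine a line that does not depend on the
`t`-th point, and lines are null sets. -/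
lemma ae_cross_ne_zero {R : Set Point} (h : IsBalanced γ R D) (hR : MeasurableSet R) (t : Fin n)
    {v c : (Fin n → Point) → Point} (hvm : Measurable v) (hcm : Measurable c)
    (hv : ∀ p z, v (Function.update p t z) = v p) (hc : ∀ p z, c (Function.update p t z) = c p) :
    ∀ᵐ p ∂(Measure.pi fun _ : Fin n => D), v p ≠ 0 → cross (v p) (p t - c p) ≠ 0 := by
  have := h.prob
  have hm : MeasurableSet {p : Fin n → Point | v p ≠ 0 ∧ cross (v p) (p t - c p) = 0} :=
    (hvm (measurableSet_singleton 0)).compl.inter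
      (measurable_cross hvm ((measurable_pi_apply t).sub hcm) (measurableSet_singleton 0))
  have h0 : (Measure.pi fun _ : Fin n => D)
      {p | v p ≠ 0 ∧ cross (v p) (p t - c p) = 0} = 0 := by
    rw [← lintegral_ind _ hm, lintegral_eq_lmarginal_univ (0 : Fin n → Point)]
    refine le_antisymm ?_ zero_le
    refine (lmarginal_le_of_subset (μ := fun _ : Fin n => D) (s := {t}) (g := fun _ => 0)
      (Finset.subset_univ _) (measurable_ind hm) measurable_const (fun x => ?_) _).trans_eq
      (by simp [lmarginal])
    rw [lmarginal_singleton, lmarginal_singleton]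
    simp only [hv, hc, Function.update_self, lintegral_zero]
    by_cases hx : v x = 0
    · simp [hx, ind]
    · refine le_trans (lintegral_mono fun z => ind_mono (Q := cross (v x) (z - c x) = 0)
        fun hz => hz.2) ?_
      rw [lintegral_ind D (P := fun z => cross (v x) (z - c x) = 0)
        (measurable_cross measurable_const (by fun_prop) (measurableSet_singleton 0)),
        h.line_null hR hx]
  refine measure_mono_null (fun p hp => ?_) h0
  simpa using hp

/-- The points of an instance, as an indexed family. -/
def vertex (a b : Point) (p : Fin n → Point) : Bool ⊕ Fin n → Point :=
  Sum.elim (fun c => cond c a b) p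

lemma inst_eq_range (a b : Point) (p : Fin n → Point) :
    inst a b p = Set.range (vertex a b p) := by
  rw [vertex, Set.Sum.elim_range, inst]
  congr 1
  ext z
  simp [eq_comm, or_comm]

lemma measurable_vertex (a b : Point) (k : Bool ⊕ Fin n) :
    Measurable fun p => vertex a b p k := by
  cases k with
  | inl c => exact measurable_const
  | inr t => exact measurable_pi_apply t

lemma vertex_update (p : Fin n → Point) {t : Fin n} {k : Bool ⊕ Fin n} (hk : k ≠ Sum.inr t)
    (z : Point) : vertex a b (Function.update p t z) k = vertex a b p k := by
  cases k with
  | inl c => rfl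
  | inr s => exact Function.update_of_ne (fun h => hk (congrArg _ h)) _ _

lemma cross_sub (u v w z : Point) : cross (u - v) (w - z)
    = (u.1 - v.1) * (w.2 - z.2) - (u.2 - v.2) * (w.1 - z.1) := rfl

/-- An instance to which the analysis of the algorithm applies. -/
structure Good (a b : Point) (p : Fin n → Point) : Prop where
  mem : ∀ i, p i ∈ (root a b).interior
  inj : Function.Injective p
  gp : GeneralPosition (inst a b p)

lemma ae_vertex_ne (h1 : a.1 < b.1) (h : IsBalanced γ (rootTriangle a b) D)
    (k l : Bool ⊕ Fin n) (hkl : k ≠ l) :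
    ∀ᵐ p ∂(Measure.pi fun _ : Fin n => D), vertex a b p k ≠ vertex a b p l := by
  have hab : a ≠ b := fun e => h1.ne (congrArg Prod.fst e)
  have main : ∀ (t : Fin n) (l : Bool ⊕ Fin n), l ≠ Sum.inr t →
      ∀ᵐ p ∂(Measure.pi fun _ : Fin n => D), p t ≠ vertex a b p l := by
    intro t l hl
    filter_upwards [ae_cross_ne_zero h (measurableSet_rootTriangle a b) t
      -- With this direction, the second coordinates already differ almost surely.
      (v := fun _ => ((1, 0) : Point)) (c := fun p => vertex a b p l) measurable_const
      (measurable_vertex a b l) (fun _ _ => rfl) (fun p z => vertex_update p hl z)] with p hp e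
    exact hp (by simp) (by rw [e]; simp [cross])
  rcases k with c | t
  · rcases l with d | t
    · refine Filter.Eventually.of_forall fun p => ?_
      rcases c <;> rcases d <;> simp [vertex] at * <;> tauto
    · filter_upwards [main t (Sum.inl c) hkl] with p hp using fun e => hp e.symm
  · exact main t l hkl.symm

lemma ae_good (h1 : a.1 < b.1) (h2 : b.2 < a.2) (h : IsBalanced γ (rootTriangle a b) D) :
    ∀ᵐ p ∂(Measure.pi fun _ : Fin n => D), Good a b p := by
  have := h.prob
  have hR := measurableSet_rootTriangle a b
  have hne : ∀ᵐ p ∂(Measure.pi fun _ : Fin n => D), ∀ k l, k ≠ l →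
      vertex a b p k ≠ vertex a b p l := by
    simp only [ae_all_iff]
    exact fun k l => fun hkl => ae_vertex_ne h1 h k l hkl
  have hcr : ∀ᵐ p ∂(Measure.pi fun _ : Fin n => D), ∀ (t : Fin n) (i k l : Bool ⊕ Fin n),
      i ≠ Sum.inr t → k ≠ Sum.inr t → l ≠ Sum.inr t →
      vertex a b p l - vertex a b p k ≠ 0 →
      cross (vertex a b p l - vertex a b p k) (p t - vertex a b p i) ≠ 0 := by
    simp only [ae_all_iff]
    intro t i k l hi hk hl
    exact ae_cross_ne_zero h hR t ((measurable_vertex a b l).sub (measurable_vertex a b k))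
      (measurable_vertex a b i)
      (fun p z => by rw [vertex_update p hl, vertex_update p hk]) (fun p z => vertex_update p hi z)
  have hmem : ∀ᵐ p ∂(Measure.pi fun _ : Fin n => D), ∀ i, p i ∈ (root a b).interior := by
    rw [ae_all_iff]
    intro i
    exact (Measure.quasiMeasurePreserving_eval (fun _ : Fin n => D) i).ae
      (h.ae_mem_interior h1 h2)
  filter_upwards [hne, hcr, hmem] with p hne hcr hmem
  refine ⟨hmem, fun i j hij => ?_, ?_⟩
  · by_contra hne'
    exact hne (Sum.inr i) (Sum.inr j) (fun e => hne' (Sum.inr_injective e)) hij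
  rw [inst_eq_range]
  rintro _ ⟨i, rfl⟩ _ ⟨j, rfl⟩ _ ⟨k, rfl⟩ _ ⟨l, rfl⟩ hij hkl hc
  have hij' : i ≠ j := fun e => hij (e ▸ rfl)
  have hkl' : k ≠ l := fun e => hkl (e ▸ rfl)
  suffices (k = i ∧ l = j) ∨ (k = j ∧ l = i) by
    rcases this with ⟨rfl, rfl⟩ | ⟨rfl, rfl⟩
    · exact Or.inl ⟨rfl, rfl⟩
    · exact Or.inr ⟨rfl, rfl⟩
  have hne0 : ∀ k l, k ≠ l → vertex a b p l - vertex a b p k ≠ 0 := fun k l hkl =>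
    sub_ne_zero.2 (hne k l hkl).symm
  have swap : ∀ u v w z : Point, cross (u - v) (w - z) = cross (z - w) (u - v) := by
    intro u v w z; simp only [cross, Prod.fst_sub, Prod.snd_sub]; ring
  have swap' : ∀ u v w z : Point, cross (u - v) (w - z) = -cross (u - v) (z - w) := by
    intro u v w z; simp only [cross, Prod.fst_sub, Prod.snd_sub]; ring
  -- A random endpoint of one of two parallel chords must also be an endpoint of the other;
  -- otherwise it would lie on a line determined by the remaining three endpoints. The same holds
  -- for each of the four endpoints.
  have fj : ∀ t, j = Sum.inr t → j = k ∨ j = l := by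
    rintro t rfl
    by_contra! hcon
    rw [swap] at hc
    exact hcr t i l k hij' hcon.2.symm hcon.1.symm (hne0 _ _ hkl'.symm) hc
  have fi : ∀ t, i = Sum.inr t → i = k ∨ i = l := by
    rintro t rfl
    by_contra! hcon
    rw [swap, swap', neg_eq_zero] at hc
    exact hcr t j l k hij'.symm hcon.2.symm hcon.1.symm (hne0 _ _ hkl'.symm) hc
  have fl : ∀ t, l = Sum.inr t → l = i ∨ l = j := by
    rintro t rfl
    by_contra! hcon
    exact hcr t k i j hkl' hcon.1.symm hcon.2.symm (hne0 _ _ hij') hc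
  have fk : ∀ t, k = Sum.inr t → k = i ∨ k = j := by
    rintro t rfl
    by_contra! hcon
    rw [swap', neg_eq_zero] at hc
    exact hcr t l i j hkl'.symm hcon.1.symm hcon.2.symm (hne0 _ _ hij') hc
  -- The configuration not excluded so far consists of two chords that join one random point to `a`
  -- and to `b`; it is excluded because the point is strictly below the line `ab`.
  have hcol : ∀ t : Fin n, cross (p t - a) (p t - b) ≠ 0 := by
    intro t e
    have := (hmem t).2.2
    rw [(root a b).wb_eq] at this
    simp only [root, cross, Prod.fst_sub, Prod.snd_sub] at this e
    linarith
  clear hcr hmem hne0 hne hij hkl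
  rcases i with ci | ti <;> rcases j with cj | tj <;> rcases k with ck | tk <;>
    rcases l with cl | tl <;> simp only [Sum.inr.injEq, Sum.inl.injEq, reduceCtorEq, ne_eq, forall_eq', false_or, or_false, imp_false,
      and_false, false_and] at hc hij' hkl' fi fj fk fl ⊢
  · clear hc fi fj fk fl
    revert ci cj ck cl
    decide
  · obtain rfl := fj
    cases ci <;> cases ck <;> simp only [vertex, Sum.elim_inl, Sum.elim_inr, cond] at hc <;>
      first | exact ⟨rfl, rfl⟩ | exact absurd (by rw [cross_sub] at hc ⊢; linarith) (hcol tj)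
  · obtain rfl := fj
    cases ci <;> cases cl <;> simp only [vertex, Sum.elim_inl, Sum.elim_inr, cond] at hc <;>
      first | exact ⟨rfl, rfl⟩ | exact absurd (by rw [cross_sub] at hc ⊢; linarith) (hcol tj)
  · exact hkl' (fk.trans fl.symm)
  · obtain rfl := fi
    cases cj <;> cases ck <;> simp only [vertex, Sum.elim_inl, Sum.elim_inr, cond] at hc <;>
      first | exact ⟨rfl, rfl⟩ | exact absurd (by rw [cross_sub] at hc ⊢; linarith) (hcol ti)
  · obtain rfl := fi
    cases cj <;> cases cl <;> simp only [vertex, Sum.elim_inl, Sum.elim_inr, cond] at hc <;>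
      first | exact ⟨rfl, rfl⟩ | exact absurd (by rw [cross_sub] at hc ⊢; linarith) (hcol ti)
  · exact hkl' (fk.trans fl.symm)
  · exact hij' (fi.trans fj.symm)
  · exact hij' (fi.trans fj.symm)
  · rcases fk with rfl | rfl
    · exact Or.inl ⟨rfl, fl.resolve_left (Ne.symm hkl')⟩
    · exact Or.inr ⟨rfl, fl.resolve_right (Ne.symm hkl')⟩

end generalPosition

end Chord
end

noncomputable section

namespace Chord

/-! ### Measurability -/

/-- A continuous function is below `c` somewhere on the segment exactly if it is so at a point of a
dense sequence; this turns the infimum into a countable one. -/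
lemma ratioDistTo_segment_lt_iff (q l r : Point) (c : ℝ) :
    ratioDistTo q (segment ℝ l r) < c ↔ ∃ k : ℕ, ratioDist q
      (l + (TopologicalSpace.denseSeq unitInterval k : ℝ) • (r - l)) < c := by
  have hb : BddBelow (Set.range fun w : segment ℝ l r => ratioDist q w) :=
    ⟨0, by rintro _ ⟨w, rfl⟩; exact le_max_right _ _⟩
  have hcont : Continuous fun t : unitInterval => ratioDist q (l + (t : ℝ) • (r - l)) := by
    unfold ratioDist
    simp only [Prod.fst_add, Prod.snd_add, Prod.smul_fst, Prod.smul_snd]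
    fun_prop
  have : Nonempty (segment ℝ l r) := ⟨⟨l, left_mem_segment _ _ _⟩⟩
  constructor
  · intro h
    obtain ⟨⟨w, hw⟩, hlt⟩ := exists_lt_of_ciInf_lt h
    rw [segment_eq_image'] at hw
    obtain ⟨t, ht, rfl⟩ := hw
    have hopen : IsOpen {t : unitInterval | ratioDist q (l + (t : ℝ) • (r - l)) < c} :=
      isOpen_lt hcont continuous_const
    obtain ⟨k, hk⟩ := (TopologicalSpace.denseRange_denseSeq unitInterval).exists_mem_open hopen
      ⟨⟨t, ht⟩, hlt⟩
    exact ⟨k, hk⟩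
  · rintro ⟨k, hk⟩
    refine lt_of_le_of_lt (ciInf_le hb ⟨_, ?_⟩) hk
    rw [segment_eq_image']
    exact ⟨_, (TopologicalSpace.denseSeq unitInterval k).2, rfl⟩

lemma measurable_ratioDistTo_segment {α : Type*} [MeasurableSpace α] {q l r : α → Point}
    (hq : Measurable q) (hl : Measurable l) (hr : Measurable r) :
    Measurable fun x => ratioDistTo (q x) (segment ℝ (l x) (r x)) := by
  refine measurable_of_Iio fun c => ?_
  have e : (fun x => ratioDistTo (q x) (segment ℝ (l x) (r x))) ⁻¹' Set.Iio c
      = ⋃ k : ℕ, {x | ratioDist (q x)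
        (l x + (TopologicalSpace.denseSeq unitInterval k : ℝ) • (r x - l x)) < c} := by
    ext x
    simp only [Set.mem_preimage, Set.mem_Iio, Set.mem_iUnion, Set.mem_ofPred_eq,
      ratioDistTo_segment_lt_iff]
  rw [e]
  refine MeasurableSet.iUnion fun k => measurableSet_lt ?_ measurable_const
  unfold ratioDist
  simp only [Prod.fst_add, Prod.snd_add, Prod.smul_fst, Prod.smul_snd, Prod.fst_sub, Prod.snd_sub,
    smul_eq_mul]
  fun_prop

open Classical in
/-- The number of calls, as a function of the points of the instance only. -/
def callsOf {κ : Type*} (P : κ → Point) (ε : ℝ) : ℕ → Tri → ℝ≥0∞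
  | 0, _ => 0
  | d + 1, T =>
    if ratioDistTo T.2.2 (segment ℝ T.1 T.2.1) ≤ ε then 0
    -- A countable infimum over all maximizers replaces the choice of the oracle, which need not be
    -- measurable; the value `⊤` removes the other indices.
    else ⨅ k, if ∀ j, T.wb (P j) ≤ T.wb (P k) then
        if ratioDistTo (P k) (segment ℝ T.1 T.2.1) ≤ ε then 1
        else 1 + callsOf P ε d (T.left (P k)) + callsOf P ε d (T.right (P k))
      else ⊤

lemma measurable_callsOf {α κ : Type*} [MeasurableSpace α] [Countable κ] {P : α → κ → Point}
    (hP : ∀ k, Measurable fun x => P x k) (ε : ℝ) (d : ℕ) :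
    ∀ {T : α → Tri}, Measurable T → Measurable fun x => callsOf (P x) ε d (T x) := by
  induction d with
  | zero => intro T _; exact measurable_const
  | succ d ih =>
    intro T hT
    simp only [callsOf]
    refine Measurable.ite (measurableSet_le (measurable_ratioDistTo_segment (by fun_prop)
      (by fun_prop) (by fun_prop)) measurable_const) measurable_const ?_
    refine Measurable.iInf fun k => Measurable.ite ?_ (Measurable.ite ?_ measurable_const ?_)
      measurable_const
    · simp only [Set.ofPred_forall]
      exact MeasurableSet.iInter fun j =>
        measurableSet_le (Tri.measurable_wb hT (hP j)) (Tri.measurable_wb hT (hP k))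
    · exact measurableSet_le (measurable_ratioDistTo_segment (hP k) (by fun_prop)
        (by fun_prop)) measurable_const
    · exact (measurable_const.add (ih (Tri.measurable_left hT (hP k)))).add
        (ih (Tri.measurable_right hT (hP k)))

/-- In general position, ties do not influence the number of calls. -/
lemma Valid.callsIn_eq {κ : Type*} {P : κ → Point} {A : Set Point} (hA : A = Set.range P)
    (hgp : GeneralPosition A) (hpos : ∀ z ∈ A, 0 < z.1 ∧ 0 < z.2) {ε : ℝ} (hε : 0 ≤ ε)
    {comb : ℝ≥0∞ → Point} (hc : IsComb A comb) (d : ℕ) :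
    ∀ {T : Tri}, Valid A T → (callsIn comb ε d T : ℝ≥0∞) = callsOf P ε d T := by
  induction d with
  | zero => intro T _; simp [callsIn, callsUpTo, callsOf]
  | succ d ih =>
    intro T h
    by_cases hs : ratioDistTo T.2.2 (segment ℝ T.1 T.2.1) ≤ ε
    · simp [callsIn_of_bottom_le hs, callsOf, hs]
    have hqA := (hc (slope T.1 T.2.1)).1
    have hmax : ∀ z ∈ A, T.wb z ≤ T.wb (comb (slope T.1 T.2.1)) := fun z hz =>
      hc.wb_le h.decreasing hz
    have hval : (callsIn comb ε (d + 1) T : ℝ≥0∞)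
        = if ratioDistTo (comb (slope T.1 T.2.1)) (segment ℝ T.1 T.2.1) ≤ ε then 1
          else 1 + callsOf P ε d (T.left (comb (slope T.1 T.2.1)))
            + callsOf P ε d (T.right (comb (slope T.1 T.2.1))) := by
      split_ifs with hq
      · rw [callsIn_succ_of_le hs hq]; simp
      · obtain ⟨h1, h2⟩ := h.extreme hgp hpos hε hqA hmax hq
        rw [callsIn_succ hs hq]
        push_cast
        rw [ih (h.left hqA h1 h2), ih (h.right hqA h1 h2)]
    rw [hval, callsOf, if_neg hs]
    generalize comb (slope T.1 T.2.1) = q at *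
    refine le_antisymm (le_iInf fun k => ?_) ?_
    · split_ifs with h1 h2 h3 h4 h5
      · exact le_rfl
      -- A maximizer that is not covered by the chord is the only one. So either all maximizers are
      -- covered, or the oracle and the infimum see the same point.
      · have hk : ∀ z ∈ A, T.wb z ≤ T.wb (P k) := by
          rw [hA]; rintro _ ⟨j, rfl⟩; exact h2 j
        have hkA : P k ∈ A := hA ▸ ⟨k, rfl⟩
        obtain ⟨_, h5⟩ := h.extreme hgp hpos hε hkA hk h3
        by_cases e : q = P k
        · exact absurd (e ▸ h1) h3
        · exact absurd (hmax _ hkA) (not_le.2 (h5 q hqA e))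
      · exact le_top
      · have hkA : P k ∈ A := hA ▸ ⟨k, rfl⟩
        obtain ⟨_, h6⟩ := h.extreme hgp hpos hε hqA hmax h1
        by_cases e : P k = q
        · exact absurd (e ▸ h5) h1
        · have hqk : T.wb q ≤ T.wb (P k) := by
            rw [hA] at hqA
            obtain ⟨j, rfl⟩ := hqA
            exact h4 j
          exact absurd (h6 _ hkA e) (not_lt.2 hqk)
      · have hkA : P k ∈ A := hA ▸ ⟨k, rfl⟩
        obtain ⟨_, h6⟩ := h.extreme hgp hpos hε hqA hmax h1
        by_cases e : P k = q
        · rw [e]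
        · have hqk : T.wb q ≤ T.wb (P k) := by
            rw [hA] at hqA
            obtain ⟨j, rfl⟩ := hqA
            exact h4 j
          exact absurd (h6 _ hkA e) (not_lt.2 hqk)
      · exact le_top
    · have hq' := hqA
      rw [hA] at hq'
      obtain ⟨k, rfl⟩ := hq'
      refine (iInf_le _ k).trans_eq ?_
      rw [if_pos fun j => hmax _ (hA ▸ ⟨j, rfl⟩)]

/-! Measurability of the optimum. -/

lemma convexHull_image_finset {κ : Type*} (P : κ → Point) (K : Finset κ) :
    convexHull ℝ (P '' K)
      = (fun w : K → ℝ => ∑ k, w k • P k) '' stdSimplex ℝ K := by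
  classical
  refine Set.Subset.antisymm (convexHull_min ?_ ?_) ?_
  · rintro _ ⟨k, hk, rfl⟩
    refine ⟨Pi.single ⟨k, hk⟩ 1, single_mem_stdSimplex ℝ _, ?_⟩
    simp [Pi.single_apply]
  · refine (convex_stdSimplex ℝ K).is_linear_image ⟨fun u v => ?_, fun c u => ?_⟩
    · simp [add_smul, Finset.sum_add_distrib]
    · simp [Finset.smul_sum, mul_smul]
  · rintro _ ⟨w, hw, rfl⟩
    exact (convex_convexHull ℝ _).sum_mem (fun k _ => hw.1 k) hw.2
      fun k _ => subset_convexHull ℝ _ ⟨k, k.2, rfl⟩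

/-- The set is the projection along the compact simplex of weights of a closed condition on weights
and points. -/
lemma isClosed_exists_covers {X κ : Type*} [TopologicalSpace X] {P : X → κ → Point}
    (hP : ∀ k, Continuous fun x => P x k) (ε : ℝ) (K : Finset κ) (j : κ) :
    IsClosed {x | ∃ z ∈ convexHull ℝ (P x '' K), Covers ε z (P x j)} := by
  have : CompactSpace (stdSimplex ℝ K) := isCompact_iff_compactSpace.1 (isCompact_stdSimplex ℝ K)
  have hcl : IsClosed {y : stdSimplex ℝ K × X |
      Covers ε (∑ k, (y.1 : K → ℝ) k • P y.2 k) (P y.2 j)} := by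
    have h1 : Continuous fun y : stdSimplex ℝ K × X => ∑ k, (y.1 : K → ℝ) k • P y.2 k := by
      refine continuous_finsetSum _ fun k _ => ?_
      have h2 : Continuous fun y : stdSimplex ℝ K × X => P y.2 k := (hP k).comp continuous_snd
      have h3 : Continuous fun y : stdSimplex ℝ K × X => (y.1 : K → ℝ) k :=
        (continuous_apply k).comp (continuous_subtype_val.comp continuous_fst)
      exact h3.smul h2
    have h2 : Continuous fun y : stdSimplex ℝ K × X => P y.2 j := (hP j).comp continuous_snd
    exact (isClosed_le (continuous_fst.comp h1)
      (continuous_const.mul (continuous_fst.comp h2))).inter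
      (isClosed_le (continuous_snd.comp h1) (continuous_const.mul (continuous_snd.comp h2)))
  have e : {x | ∃ z ∈ convexHull ℝ (P x '' K), Covers ε z (P x j)}
      = Prod.snd '' {y : stdSimplex ℝ K × X |
        Covers ε (∑ k, (y.1 : K → ℝ) k • P y.2 k) (P y.2 j)} := by
    ext x
    simp only [convexHull_image_finset, Set.mem_ofPred_eq, Set.mem_image]
    constructor
    · rintro ⟨_, ⟨w, hw, rfl⟩, h⟩
      exact ⟨(⟨w, hw⟩, x), h, rfl⟩
    · rintro ⟨⟨⟨w, hw⟩, x⟩, h, rfl⟩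
      exact ⟨_, ⟨w, hw, rfl⟩, h⟩
  rw [e]
  exact isClosedMap_snd_of_compactSpace _ hcl

-- The minimum over subsets becomes one over the fixed finite family of index sets, so that only the
-- covering condition depends on the points. Repeated points do no harm: an image has at most as
-- many points as its index set.
open Classical in
lemma opt_range {κ : Type*} [Finite κ] (ε : ℝ) (P : κ → Point) :
    opt ε (Set.range P) = ⨅ K : Finset κ,
      if ∀ j, ∃ z ∈ convexHull ℝ (P '' K), Covers ε z (P j) then (K.card : ℕ∞) else ⊤ := by
  refine le_antisymm (le_iInf fun K => ?_) (le_iInf₂ fun S hS => ?_)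
  · split_ifs with h
    · have hPK : IsConvexPareto ε (Set.range P) (P '' K) :=
        ⟨Set.image_subset_range _ _, by rintro _ ⟨j, rfl⟩; exact h j⟩
      refine (iInf₂_le (P '' K) hPK).trans ?_
      exact (Set.encard_image_le _ _).trans_eq (Set.encard_coe_eq_coe_finsetCard K)
    · exact le_top
  -- One index is chosen for each point of `S`, so that no cardinality is lost.
  · obtain ⟨K', hK', hinj⟩ := Set.SurjOn.exists_bijOn_subset
      (f := P) (s := Set.univ) (t := S) (fun z hz => by simpa using hS.1 hz)
    set K := (Set.toFinite K').toFinset with hK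
    have hKK : (K : Set κ) = K' := by simp [hK]
    refine (iInf_le _ K).trans ?_
    have himg : P '' K = S := by rw [hKK]; exact hinj.image_eq
    rw [if_pos fun j => himg ▸ hS.2 _ ⟨j, rfl⟩, ← himg, ← Set.encard_coe_eq_coe_finsetCard, hKK,
      hinj.injOn.encard_image]

lemma measurable_opt {X κ : Type*} [TopologicalSpace X] [MeasurableSpace X] [BorelSpace X]
    [Finite κ] {P : X → κ → Point} (hP : ∀ k, Continuous fun x => P x k) (ε : ℝ) :
    Measurable fun x => (opt ε (Set.range (P x)) : ℝ≥0∞) := by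
  classical
  simp_rw [opt_range, ENat.toENNReal_iInf]
  refine Measurable.iInf fun K => ?_
  have e : ∀ x, ((if ∀ j, ∃ z ∈ convexHull ℝ (P x '' K), Covers ε z (P x j) then (K.card : ℕ∞)
      else ⊤ : ℕ∞) : ℝ≥0∞) = if ∀ j, ∃ z ∈ convexHull ℝ (P x '' K), Covers ε z (P x j)
      then (K.card : ℝ≥0∞) else ⊤ := by
    intro x; split_ifs <;> simp
  simp_rw [e]
  refine Measurable.ite ?_ measurable_const measurable_const
  simp only [Set.ofPred_forall]
  exact MeasurableSet.iInter fun j => (isClosed_exists_covers hP ε K j).measurableSet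

end Chord
end

noncomputable section

namespace Chord

/-! ### The performance ratio on good instances -/

section instances

variable {n : ℕ} {a b : Point} {p : Fin n → Point}

lemma Good.valid_root (h1 : a.1 < b.1) (h2 : b.2 < a.2) (h : Good a b p) :
    Valid (inst a b p) (root a b) := by
  have hA := root_area_pos h1 h2
  refine ⟨Or.inl (Or.inl rfl), Or.inl (Or.inr rfl), ⟨h1, h2⟩, h1.le, le_rfl, le_rfl, h2.le, hA,
    ?_, ?_⟩
  · rintro z ((rfl | rfl) | ⟨i, rfl⟩) hz
    · exact absurd rfl hz
    · exact hA
    · exact (h.mem i).2.1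
  · rintro z ((rfl | rfl) | ⟨i, rfl⟩) hz
    · rw [root_wl]; exact mul_pos (sub_pos.2 h1) (sub_pos.2 h2)
    · exact absurd rfl hz
    · exact (h.mem i).1

lemma inst_inter_root (a b : Point) (p : Fin n → Point) :
    ∀ z ∈ inst a b p, z ∈ (root a b).interior → z ∈ Set.range p := by
  rintro z ((rfl | rfl) | hz) hi
  · exact absurd hi.2.2 ((root z b).wb_left_vertex.le.not_gt)
  · exact absurd hi.2.2 ((root a z).wb_right_vertex.le.not_gt)
  · exact hz

/-- Strictness makes `a` and `b` the unique minimizers of the two objectives, so the two initial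
oracle calls are forced. -/
lemma Good.coord (h1 : a.1 < b.1) (h2 : b.2 < a.2) (h : Good a b p) :
    ∀ z ∈ inst a b p, (a.1 ≤ z.1 ∧ (z ≠ a → a.1 < z.1)) ∧ b.2 ≤ z.2 ∧ (z ≠ b → b.2 < z.2) := by
  rintro z ((rfl | rfl) | ⟨i, rfl⟩)
  · exact ⟨⟨le_rfl, fun h => absurd rfl h⟩, h2.le, fun _ => h2⟩
  · exact ⟨⟨h1.le, fun _ => h1⟩, le_rfl, fun h => absurd rfl h⟩
  · obtain ⟨c1, _, c3, _⟩ := (h.valid_root h1 h2).coord_of_mem (h.mem i)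
    exact ⟨⟨c1.le, fun _ => c1⟩, c3.le, fun _ => c3⟩

variable {comb : ℝ≥0∞ → Point} {ε : ℝ}

lemma Good.calls_eq (h1 : a.1 < b.1) (h2 : b.2 < a.2) (h : Good a b p)
    (hc : IsComb (inst a b p) comb) :
    (calls comb ε : ℝ≥0∞) = 2 + ⨆ d : ℕ, (callsIn comb ε d (root a b) : ℝ≥0∞) := by
  have ha : comb ⊤ = a := by
    by_contra hne
    obtain ⟨hm, hmin⟩ := hc ⊤
    have h3 := hmin a (Or.inl (Or.inl rfl))
    simp only [combObjective, if_true] at h3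
    exact absurd ((h.coord h1 h2 _ hm).1.2 hne) (not_lt.2 h3)
  have hb : comb 0 = b := by
    by_contra hne
    obtain ⟨hm, hmin⟩ := hc 0
    have h3 := hmin b (Or.inl (Or.inr rfl))
    simp only [combObjective, ENNReal.zero_ne_top, if_false, ENNReal.toReal_zero, zero_mul,
      add_zero] at h3
    exact absurd ((h.coord h1 h2 _ hm).2.2 hne) (not_lt.2 h3)
  simp only [calls, ha, hb, ENat.toENNReal_add, ENat.toENNReal_iSup, ENat.toENNReal_coe,
    ENat.toENNReal_ofNat]
  rfl

lemma exists_encard_eq_opt {A : Set Point} (hε : 0 ≤ ε) (hpos : ∀ z ∈ A, 0 < z.1 ∧ 0 < z.2) :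
    ∃ S, IsConvexPareto ε A S ∧ S.encard = opt ε A := by
  have hA : IsConvexPareto ε A A := ⟨subset_rfl, fun q hq =>
    ⟨q, subset_convexHull ℝ _ hq, covers_self hε (hpos q hq).1 (hpos q hq).2⟩⟩
  have : Nonempty {S // IsConvexPareto ε A S} := ⟨⟨A, hA⟩⟩
  obtain ⟨⟨S, hS⟩, h⟩ := ciInf_mem fun S : {S // IsConvexPareto ε A S} => (S : Set Point).encard
  refine ⟨S, hS, ?_⟩
  rw [opt, iInf_subtype']
  exact h

lemma one_le_encard_of_isConvexPareto {A S : Set Point} (hA : A.Nonempty)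
    (hS : IsConvexPareto ε A S) : 1 ≤ S.encard := by
  obtain ⟨q, hq⟩ := hA
  obtain ⟨z, hz, _⟩ := hS.2 q hq
  exact Set.one_le_encard_iff_nonempty.2 (convexHull_nonempty_iff.1 ⟨z, hz⟩)

lemma inst_nonempty (a b : Point) (p : Fin n → Point) : (inst a b p).Nonempty :=
  ⟨a, Or.inl (Or.inl rfl)⟩

/-- The ratio is bounded by the number of levels and the points that are left after them. -/
lemma Good.perfRatio_le_remaining (h1 : a.1 < b.1) (h2 : b.2 < a.2) (ha : 0 < a.1) (hb : 0 < b.2)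
    (h : Good a b p) (hc : IsComb (inst a b p) comb) (hε : 0 ≤ ε) (B m : ℕ) :
    perfRatio ε (inst a b p) comb
      ≤ 3 + 2 * (m + B) + 2 * remaining B m (root a b) Finset.univ p := by
  have hpos : ∀ z ∈ inst a b p, 0 < z.1 ∧ 0 < z.2 := fun z hz =>
    ⟨ha.trans_le (h.coord h1 h2 z hz).1.1, hb.trans_le (h.coord h1 h2 z hz).2.1⟩
  obtain ⟨S, hS, hSo⟩ := exists_encard_eq_opt hε hpos
  have hone := one_le_encard_of_isConvexPareto (inst_nonempty a b p) hS
  have hone' : (1 : ℝ≥0∞) ≤ (opt ε (inst a b p) : ℝ≥0∞) := by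
    rw [← hSo]; exact_mod_cast hone
  have huniv : inside (root a b) Finset.univ p = Finset.univ := by
    ext j; simp [mem_inside, h.mem j]
  refine ENNReal.div_le_of_le_mul ?_
  rw [h.calls_eq h1 h2 hc]
  set O := (opt ε (inst a b p) : ℝ≥0∞) with hO
  set rem := remaining B m (root a b) Finset.univ p with hrem
  have hd : ∀ d, (callsIn comb ε d (root a b) : ℝ≥0∞) ≤ 1 + 2 * (m + B) * O + 2 * rem := by
    intro d
    have := (h.valid_root h1 h2).callsIn_le_remaining h.gp hpos hε hc
      (fun i => Or.inr ⟨i, rfl⟩) h.inj (inst_inter_root a b p) hS B m d subset_rfl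
    rw [huniv] at this
    refine this.trans ?_
    gcongr
    rw [hO, ← hSo]
    exact_mod_cast Set.encard_le_encard Set.inter_subset_left
  calc (2 : ℝ≥0∞) + ⨆ d : ℕ, (callsIn comb ε d (root a b) : ℝ≥0∞)
      ≤ 2 + (1 + 2 * (m + B) * O + 2 * rem) := by gcongr; exact iSup_le hd
    _ = 3 * 1 + 2 * (m + B) * O + 2 * rem * 1 := by ring
    _ ≤ 3 * O + 2 * (m + B) * O + 2 * rem * O := by gcongr
    _ = _ := by ring

/-- The ratio is bounded in terms of the areas of the two triangles on the second level. -/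
lemma Good.perfRatio_le_depthRatio (h1 : a.1 < b.1) (h2 : b.2 < a.2)
    (h : Good a b p) (hc : IsComb (inst a b p) comb) (hε : 0 < ε) {η : ℝ} (hη : 0 < η)
    (hA : ∀ z ∈ inst a b p, η ≤ z.1 ∧ η ≤ z.2) :
    perfRatio ε (inst a b p) comb
      ≤ 3 + ENNReal.ofReal (4 / 3 * (root a b).area / (4 * ε ^ 2 * η ^ 2)) *
        ∑ i, ind (IsExtreme (root a b) Finset.univ p i) *
          ENNReal.ofReal ((root a b).depthRatio (p i)) := by
  have hpos : ∀ z ∈ inst a b p, 0 < z.1 ∧ 0 < z.2 := fun z hz =>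
    ⟨hη.trans_le (hA z hz).1, hη.trans_le (hA z hz).2⟩
  obtain ⟨S, hS, hSo⟩ := exists_encard_eq_opt hε.le hpos
  have hone := one_le_encard_of_isConvexPareto (inst_nonempty a b p) hS
  have hone' : (1 : ℝ≥0∞) ≤ (opt ε (inst a b p) : ℝ≥0∞) := by
    rw [← hSo]; exact_mod_cast hone
  have hv := h.valid_root h1 h2
  have hT := hv.area_pos
  have hκ : 0 < 4 * ε ^ 2 * η ^ 2 := by positivity
  set X := ENNReal.ofReal (4 / 3 * (root a b).area / (4 * ε ^ 2 * η ^ 2)) *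
        ∑ i, ind (IsExtreme (root a b) Finset.univ p i) *
          ENNReal.ofReal ((root a b).depthRatio (p i)) with hX
  have hd : ∀ d, (callsIn comb ε d (root a b) : ℝ≥0∞) ≤ 1 + X := by
    rcases hv.step h.gp hpos hε.le hc with h3 | ⟨q, hqA, hq, hmax, _, hl, hr, hstep⟩
    · intro d
      refine le_trans ?_ le_self_add
      exact_mod_cast h3 d
    · obtain ⟨i, rfl⟩ := inst_inter_root a b p q hqA hq
      have hXi : ENNReal.ofReal (4 / 3 * (root a b).area / (4 * ε ^ 2 * η ^ 2) *
          (root a b).depthRatio (p i)) ≤ X := by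
        rw [hX, ENNReal.ofReal_mul (by positivity)]
        refine mul_le_mul' le_rfl ?_
        have hE : IsExtreme (root a b) Finset.univ p i := ⟨Finset.mem_univ _, fun j _ hji =>
          hmax _ (Or.inr ⟨j, rfl⟩) fun e => hji (h.inj e)⟩
        refine le_trans ?_ (Finset.single_le_sum (f := fun i =>
          ind (IsExtreme (root a b) Finset.univ p i) *
          ENNReal.ofReal ((root a b).depthRatio (p i))) (fun _ _ => zero_le) (Finset.mem_univ i))
        rw [ind_of_true hE, one_mul]
      intro d
      cases d with
      | zero => simp [callsIn, callsUpTo]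
      | succ d =>
        have e := (root a b).area_left_add_area_right (p i)
        have i1 := Valid.callsIn_mul_le h.gp hε hη hA hc d hl
        have i2 := Valid.callsIn_mul_le h.gp hε hη hA hc d hr
        -- The factor `ω` is dropped from `ω * (1 - ω)`: what matters is that `1 - ω` is small.
        have hle : (root a b).wb (p i) / (root a b).area * ((root a b).area - (root a b).wb (p i))
            ≤ (root a b).area * (root a b).depthRatio (p i) := by
          have hsum := (root a b).wl_add_wr_add_wb (p i)
          obtain ⟨x1, x2, x3⟩ := hq
          have h5 : (root a b).area * (root a b).depthRatio (p i)
              = (root a b).area - (root a b).wb (p i) := by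
            rw [Tri.depthRatio]; field_simp
          rw [h5]
          refine mul_le_of_le_one_left (by linarith) ?_
          rw [div_le_one hT]; linarith
        have hreal : (callsIn comb ε d ((root a b).left (p i)) : ℝ)
            + callsIn comb ε d ((root a b).right (p i))
            ≤ 4 / 3 * (root a b).area / (4 * ε ^ 2 * η ^ 2) * (root a b).depthRatio (p i) := by
          rw [div_mul_eq_mul_div, le_div_iff₀ hκ, add_mul]
          linarith
        rw [hstep d]
        push_cast
        rw [add_assoc]
        refine add_le_add le_rfl (le_trans ?_ hXi)
        have := ENNReal.ofReal_le_ofReal hreal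
        rwa [ENNReal.ofReal_add (by positivity) (by positivity), ENNReal.ofReal_natCast,
          ENNReal.ofReal_natCast] at this
  refine ENNReal.div_le_of_le_mul ?_
  rw [h.calls_eq h1 h2 hc]
  calc (2 : ℝ≥0∞) + ⨆ d : ℕ, (callsIn comb ε d (root a b) : ℝ≥0∞)
      ≤ 2 + (1 + X) := by gcongr; exact iSup_le hd
    _ = (3 + X) * 1 := by ring
    _ ≤ _ := by gcongr

end instances

/-! ### Expectations -/

section expectation

variable {γ : ℝ} {a b : Point} {D : Measure Point}

lemma aemeasurable_perfRatio (h1 : a.1 < b.1) (h2 : b.2 < a.2) (ha : 0 < a.1) (hb : 0 < b.2)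
    (h : IsBalanced γ (rootTriangle a b) D) {ε : ℝ} (hε : 0 ≤ ε) {n : ℕ}
    {comb : (Fin n → Point) → ℝ≥0∞ → Point} (hc : ∀ p, IsComb (inst a b p) (comb p)) :
    AEMeasurable (fun p => perfRatio ε (inst a b p) (comb p)) (Measure.pi fun _ : Fin n => D) := by
  refine ⟨fun p => (2 + ⨆ d : ℕ, callsOf (vertex a b p) ε d (root a b))
    / (opt ε (Set.range (vertex a b p)) : ℝ≥0∞), ?_, ?_⟩
  · refine Measurable.div (measurable_const.add (Measurable.iSup fun d =>
      measurable_callsOf (measurable_vertex a b) ε d measurable_const)) (measurable_opt ?_ ε)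
    rintro (c | t)
    · exact continuous_const
    · exact continuous_apply t
  · filter_upwards [ae_good h1 h2 h] with p hp
    have hpos : ∀ z ∈ inst a b p, 0 < z.1 ∧ 0 < z.2 := fun z hz =>
      ⟨ha.trans_le (hp.coord h1 h2 z hz).1.1, hb.trans_le (hp.coord h1 h2 z hz).2.1⟩
    rw [perfRatio, hp.calls_eq h1 h2 (hc p), ← inst_eq_range]
    simp_rw [fun d => Valid.callsIn_eq (inst_eq_range a b p) hp.gp hpos hε (hc p) d
      (hp.valid_root h1 h2)]

lemma childrenBound (hγ1 : γ < 1)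
    (h : IsBalanced γ (rootTriangle a b) D) :
    ChildrenBound D (rootTriangle a b) ((1 - γ) ^ 2)⁻¹ := by
  intro lam hlam T hT q hq
  exact (h.volumeComparable (measurableSet_rootTriangle a b)).children_le hγ1 hT
    (ne_top_of_le_ne_top (volume_rootTriangle_ne_top a b) (measure_mono hT)) hq hlam

/-- The inserted indicator is almost surely `1`; it brings integrals into the form in which the
conditional bounds were proved. -/
lemma lintegral_allIn_mul (h1 : a.1 < b.1) (h2 : b.2 < a.2)
    (h : IsBalanced γ (rootTriangle a b) D) {n : ℕ} (f : (Fin n → Point) → ℝ≥0∞) :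
    ∫⁻ p, f p ∂(Measure.pi fun _ : Fin n => D)
      = lmarginal (fun _ => D) Finset.univ
        (fun p => ind (AllIn (root a b) Finset.univ p) * f p) 0 := by
  have := h.prob
  rw [← lintegral_eq_lmarginal_univ (μ := fun _ : Fin n => D)]
  refine lintegral_congr_ae ?_
  filter_upwards [ae_good h1 h2 h] with p hp
  rw [ind_of_true (P := AllIn (root a b) Finset.univ p) fun j _ => hp.mem j, one_mul]

lemma lmarginal_allIn_le_one [IsProbabilityMeasure D] {n : ℕ} (T : Tri) :
    lmarginal (fun _ => D) (Finset.univ : Finset (Fin n))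
      (fun p => ind (AllIn T Finset.univ p)) 0 ≤ 1 := by
  rw [← lintegral_eq_lmarginal_univ (μ := fun _ : Fin n => D)]
  refine (lintegral_mono fun p => ind_le_one _).trans_eq ?_
  simp

/-- The expected ratio is at most linear in the iterated logarithm of the number of points. -/
lemma lintegral_perfRatio_le (h1 : a.1 < b.1) (h2 : b.2 < a.2) (ha : 0 < a.1) (hb : 0 < b.2)
    (hγ1 : γ < 1) (h : IsBalanced γ (rootTriangle a b) D) {B : ℕ}
    (hB : 4 * (2 + ((1 - γ) ^ 2)⁻¹) ^ 4 ≤ (B : ℝ)) {ε : ℝ} (hε : 0 ≤ ε) {n L : ℕ}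
    (hn : n ≤ 2 ^ (2 ^ L)) {comb : (Fin n → Point) → ℝ≥0∞ → Point}
    (hc : ∀ p, IsComb (inst a b p) (comb p)) :
    ∫⁻ p, perfRatio ε (inst a b p) (comb p) ∂(Measure.pi fun _ : Fin n => D)
      ≤ ENNReal.ofReal (11 + 4 * L + 2 * B) := by
  have := h.prob
  have hrm : Measurable fun p : Fin n → Point =>
      remaining B (L + L) (root a b) Finset.univ p :=
    measurable_remaining B (L + L) measurable_const Finset.univ fun i => measurable_pi_apply i
  have hrem : ∫⁻ p, remaining B (L + L) (root a b) Finset.univ p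
      ∂(Measure.pi fun _ : Fin n => D) ≤ 4 := by
    rw [lintegral_allIn_mul h1 h2 h]
    refine (remaining_le (by positivity) (childrenBound hγ1 h) hB L Finset.univ
      (by simpa using hn) (root a b) (root_interior_subset h1 h2) 0).trans ?_
    exact mul_le_of_le_one_right zero_le (lmarginal_allIn_le_one _)
  calc ∫⁻ p, perfRatio ε (inst a b p) (comb p) ∂(Measure.pi fun _ : Fin n => D)
      ≤ ∫⁻ p, (3 + 2 * ((L + L : ℕ) + B) + 2 * remaining B (L + L) (root a b) Finset.univ p)
          ∂(Measure.pi fun _ : Fin n => D) := by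
        refine lintegral_mono_ae ?_
        filter_upwards [ae_good h1 h2 h] with p hp
        exact hp.perfRatio_le_remaining h1 h2 ha hb (hc p) hε B (L + L)
    _ = 3 + 2 * ((L + L : ℕ) + B) + 2 * ∫⁻ p, remaining B (L + L) (root a b) Finset.univ p
          ∂(Measure.pi fun _ : Fin n => D) := by
        rw [lintegral_add_left measurable_const, lintegral_const_mul _ hrm]
        simp
    _ ≤ 3 + 2 * ((L + L : ℕ) + B) + 2 * 4 := by gcongr
    _ = ((11 + 4 * L + 2 * B : ℕ) : ℝ≥0∞) := by push_cast; ring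
    _ = ENNReal.ofReal (11 + 4 * L + 2 * B) := by
        rw [← ENNReal.ofReal_natCast]; push_cast; rfl

/-- The first point found is, in expectation, close to the bottom vertex. -/
lemma lintegral_depthRatio_le (h1 : a.1 < b.1) (h2 : b.2 < a.2)
    (hγ1 : γ < 1) (h : IsBalanced γ (rootTriangle a b) D) {n : ℕ} (hn : 2 ≤ n) {N : ℝ} (hN : 0 < N)
    (hnN : N ^ 2 ≤ n) :
    ∫⁻ p, ∑ i, ind (IsExtreme (root a b) Finset.univ p i) *
        ENNReal.ofReal ((root a b).depthRatio (p i)) ∂(Measure.pi fun _ : Fin n => D)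
      ≤ ENNReal.ofReal (4 * ((1 - γ) ^ 2)⁻¹ / N) := by
  have := h.prob
  set c := ((1 - γ) ^ 2)⁻¹ with hcdef
  have hc0 : 0 ≤ c := by positivity
  set T := root a b with hT
  set g : (Fin n → Point) → ℝ≥0∞ := fun p => ∑ i, ind (IsExtreme T Finset.univ p i) *
        ENNReal.ofReal (T.depthRatio (p i)) with hg
  have hgm : Measurable g := Finset.measurable_fun_sum _ fun i _ =>
    (measurable_ind_isExtreme T _ i).mul (ENNReal.measurable_ofReal.comp
      (Tri.measurable_depthRatio measurable_const (measurable_pi_apply i)))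
  -- The redrawing bound with a weight that ignores the second point; the sum over `j` then merely
  -- multiplies by `n - 1`.
  have hmain := lmarginal_sum_isExtreme_le D T
    (fun q _ => ENNReal.ofReal (T.depthRatio q))
    (ENNReal.measurable_ofReal.comp (Tri.measurable_depthRatio measurable_const measurable_fst))
    (ENNReal.ofReal (c * N)) (ENNReal.ofReal (c / N)) (fun q hq => by
      have hin : Measurable fun z : Point => ind (z ∈ T.interior) :=
        measurable_ind T.measurableSet_interior
      rw [lintegral_mul_const _ hin,
        lintegral_ind D (P := fun z => z ∈ T.interior) T.measurableSet_interior, mul_comm]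
      exact (h.volumeComparable (measurableSet_rootTriangle a b)).depthRatio_mul_le hγ1
        (root_interior_subset h1 h2) hq hN) (Finset.univ : Finset (Fin n)) 0
  have hsum : ∀ p : Fin n → Point, ∑ i : Fin n, ∑ j ∈ Finset.univ.erase i,
      ind (IsExtreme T Finset.univ p i) * ENNReal.ofReal (T.depthRatio (p i))
      = ((n - 1 : ℕ) : ℝ≥0∞) * g p := by
    intro p
    rw [hg, Finset.mul_sum]
    refine Finset.sum_congr rfl fun i _ => ?_
    rw [Finset.sum_const, Finset.card_erase_of_mem (Finset.mem_univ i), Finset.card_univ,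
      Fintype.card_fin, nsmul_eq_mul]
  simp only [hsum] at hmain
  rw [← lintegral_allIn_mul h1 h2 h, lintegral_const_mul _ hgm] at hmain
  have hn1 : ((n - 1 : ℕ) : ℝ≥0∞) ≠ 0 := by
    rw [Nat.cast_ne_zero]; omega
  refine (ENNReal.mul_le_mul_iff_right hn1 (ENNReal.natCast_ne_top _)).1 (hmain.trans ?_)
  refine (mul_le_of_le_one_right zero_le (lmarginal_allIn_le_one _)).trans ?_
  rw [Finset.card_univ, Fintype.card_fin, ofReal_affine (by positivity) (by positivity),
    ← ENNReal.ofReal_natCast, ← ENNReal.ofReal_mul (by positivity)]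
  refine ENNReal.ofReal_le_ofReal ?_
  rw [Nat.cast_sub (by omega), Nat.cast_one]
  have hn2 : (2 : ℝ) ≤ n := by exact_mod_cast hn
  -- It remains to use `N ^ 2 + n ≤ 2 * n ≤ 4 * (n - 1)`, which needs `2 ≤ n`.
  have e : c * N + c / N * n = c / N * (N ^ 2 + n) := by field_simp
  have e2 : ((n : ℝ) - 1) * (4 * c / N) = c / N * (4 * (n - 1)) := by ring
  rw [e, e2]
  have : 0 ≤ c / N := by positivity
  gcongr
  linarith

/-- With very many points the expected ratio is bounded. -/
lemma lintegral_perfRatio_le_const (h1 : a.1 < b.1) (h2 : b.2 < a.2)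
    (hγ1 : γ < 1) (h : IsBalanced γ (rootTriangle a b) D) {ε : ℝ} (hε : 0 < ε) {η : ℝ}
    (hη : 0 < η) (hA : ∀ z ∈ rootTriangle a b, η ≤ z.1 ∧ η ≤ z.2) {n : ℕ} (hn : 2 ≤ n) {N : ℝ}
    (hN : 0 < N) (hnN : N ^ 2 ≤ n) (hNA : (root a b).area / (4 * ε ^ 2 * η ^ 2) ≤ N)
    {comb : (Fin n → Point) → ℝ≥0∞ → Point} (hc : ∀ p, IsComb (inst a b p) (comb p)) :
    ∫⁻ p, perfRatio ε (inst a b p) (comb p) ∂(Measure.pi fun _ : Fin n => D)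
      ≤ ENNReal.ofReal (3 + 6 * ((1 - γ) ^ 2)⁻¹) := by
  have := h.prob
  have hT := root_area_pos h1 h2
  have hgm : Measurable fun p : Fin n → Point => ∑ i, ind (IsExtreme (root a b) Finset.univ p i) *
        ENNReal.ofReal ((root a b).depthRatio (p i)) := Finset.measurable_fun_sum _ fun i _ =>
    (measurable_ind_isExtreme _ _ i).mul (ENNReal.measurable_ofReal.comp
      (Tri.measurable_depthRatio measurable_const (measurable_pi_apply i)))
  set c := ((1 - γ) ^ 2)⁻¹ with hcdef
  have hc0 : 0 ≤ c := by positivity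
  calc ∫⁻ p, perfRatio ε (inst a b p) (comb p) ∂(Measure.pi fun _ : Fin n => D)
      ≤ ∫⁻ p, (3 + ENNReal.ofReal (4 / 3 * (root a b).area / (4 * ε ^ 2 * η ^ 2)) *
        ∑ i, ind (IsExtreme (root a b) Finset.univ p i) *
          ENNReal.ofReal ((root a b).depthRatio (p i))) ∂(Measure.pi fun _ : Fin n => D) := by
        refine lintegral_mono_ae ?_
        filter_upwards [ae_good h1 h2 h] with p hp
        refine hp.perfRatio_le_depthRatio h1 h2 (hc p) hε hη ?_
        rintro z ((rfl | rfl) | ⟨i, rfl⟩)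
        · exact hA _ (subset_convexHull ℝ _ (by simp))
        · exact hA _ (subset_convexHull ℝ _ (by simp))
        · exact hA _ (root_interior_subset h1 h2 (hp.mem i))
    _ = 3 + ENNReal.ofReal (4 / 3 * (root a b).area / (4 * ε ^ 2 * η ^ 2)) *
        ∫⁻ p, ∑ i, ind (IsExtreme (root a b) Finset.univ p i) *
          ENNReal.ofReal ((root a b).depthRatio (p i)) ∂(Measure.pi fun _ : Fin n => D) := by
        rw [lintegral_add_left measurable_const, lintegral_const_mul _ hgm]
        simp
    _ ≤ 3 + ENNReal.ofReal (4 / 3 * (root a b).area / (4 * ε ^ 2 * η ^ 2)) *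
        ENNReal.ofReal (4 * c / N) := by
        gcongr
        exact lintegral_depthRatio_le h1 h2 hγ1 h hn hN hnN
    _ = ENNReal.ofReal (3 + 4 / 3 * (root a b).area / (4 * ε ^ 2 * η ^ 2) * (4 * c / N)) := by
        rw [ENNReal.ofReal_add (by norm_num) (by positivity), ENNReal.ofReal_mul (by positivity)]
        norm_num
    _ ≤ _ := by
        refine ENNReal.ofReal_le_ofReal ?_
        have e : 4 / 3 * (root a b).area / (4 * ε ^ 2 * η ^ 2) * (4 * c / N)
            = 16 / 3 * c * ((root a b).area / (4 * ε ^ 2 * η ^ 2) / N) := by ring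
        rw [e]
        have : (root a b).area / (4 * ε ^ 2 * η ^ 2) / N ≤ 1 := (div_le_one hN).2 hNA
        have : 16 / 3 * c * ((root a b).area / (4 * ε ^ 2 * η ^ 2) / N) ≤ 16 / 3 * c * 1 := by
          gcongr
        linarith

end expectation

/-- A number of levels that is logarithmic in `Y` and reaches `exp Y`. -/
lemma exists_levels {Y : ℝ} (hY : 1 ≤ Y) :
    ∃ L : ℕ, Real.exp Y ≤ 2 ^ (2 ^ L) ∧ (L : ℝ) ≤ 2 + 2 * Real.log Y := by
  have hlog : 0 ≤ Real.log Y := Real.log_nonneg hY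
  have h2 : 1 / 2 < Real.log 2 := by linarith [Real.log_two_gt_d9]
  -- As `Real.log 2 > 1 / 2`, the ceiling alone gives `Y ≤ 2 ^ k`; the extra level compensates for
  -- the base `2` in place of `e`.
  refine ⟨⌈2 * Real.log Y⌉₊ + 1, ?_, ?_⟩
  · set k := ⌈2 * Real.log Y⌉₊
    have hk : 2 * Real.log Y ≤ k := Nat.le_ceil _
    have h3 : Y ≤ 2 ^ k := by
      calc Y = Real.exp (Real.log Y) := (Real.exp_log (by linarith)).symm
        _ ≤ Real.exp (Real.log 2 * k) := by
            refine Real.exp_le_exp.2 ?_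
            have := mul_le_mul_of_nonneg_left hk (by linarith : 0 ≤ Real.log 2)
            nlinarith
        _ = 2 ^ k := by
            rw [mul_comm, Real.exp_nat_mul, Real.exp_log (by norm_num)]
    have h4 : Y ≤ Real.log 2 * ((2 ^ (k + 1) : ℕ) : ℝ) := by
      push_cast
      rw [pow_succ]
      have : (0 : ℝ) < 2 ^ k := by positivity
      nlinarith
    calc Real.exp Y ≤ Real.exp (Real.log 2 * ((2 ^ (k + 1) : ℕ) : ℝ)) := Real.exp_le_exp.2 h4
      _ = 2 ^ (2 ^ (k + 1)) := by
          rw [mul_comm, Real.exp_nat_mul, Real.exp_log (by norm_num)]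
  · push_cast
    have := Nat.ceil_lt_add_one (by positivity : 0 ≤ 2 * Real.log Y)
    linarith

end Chord
end

noncomputable section

namespace Chord

lemma log_log_three_pos : 0 < Real.log (Real.log 3) := by
  refine Real.log_pos ?_
  rw [Real.lt_log_iff_exp_lt (by norm_num)]
  exact Real.exp_one_lt_three

/-! ### Few points against many points, and the constants -/

section final

variable {γ : ℝ} {a b : Point} {D : Measure Point}

/-- If there are at most `exp Y` points, the expected ratio is logarithmic in `Y`. -/
lemma lintegral_perfRatio_le_log (h1 : a.1 < b.1) (h2 : b.2 < a.2) (ha : 0 < a.1) (hb : 0 < b.2)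
    (hγ1 : γ < 1) (h : IsBalanced γ (rootTriangle a b) D) {B : ℕ}
    (hB : 4 * (2 + ((1 - γ) ^ 2)⁻¹) ^ 4 ≤ (B : ℝ)) {ε : ℝ} (hε : 0 ≤ ε) {n : ℕ} {Y : ℝ}
    (hY : 1 ≤ Y) (hn : n ≤ Real.exp Y) {comb : (Fin n → Point) → ℝ≥0∞ → Point}
    (hc : ∀ p, IsComb (inst a b p) (comb p)) :
    ∫⁻ p, perfRatio ε (inst a b p) (comb p) ∂(Measure.pi fun _ : Fin n => D)
      ≤ ENNReal.ofReal (19 + 2 * B + 8 * Real.log Y) := by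
  obtain ⟨L, hL, hLY⟩ := exists_levels hY
  refine (lintegral_perfRatio_le h1 h2 ha hb hγ1 h hB hε (L := L) ?_ hc).trans
    (ENNReal.ofReal_le_ofReal (by linarith))
  exact_mod_cast hn.trans hL

/-- For objectives in `[2⁻ᵐ, 2ᵐ]`, the expected ratio is bounded as soon as the number of points
is large in terms of `m` and `1 / ε`. -/
lemma lintegral_perfRatio_le_const_of_subset (h1 : a.1 < b.1) (h2 : b.2 < a.2)
    (hγ1 : γ < 1) (h : IsBalanced γ (rootTriangle a b) D) {ε : ℝ} (hε : 0 < ε) {m : ℕ}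
    (hsub : rootTriangle a b ⊆
      Set.Icc ((2 : ℝ) ^ m)⁻¹ ((2 : ℝ) ^ m) ×ˢ Set.Icc ((2 : ℝ) ^ m)⁻¹ ((2 : ℝ) ^ m))
    {n : ℕ} (hn : 2 ≤ n) (hnN : ((16 : ℝ) ^ m / ε ^ 2) ^ 2 ≤ n)
    {comb : (Fin n → Point) → ℝ≥0∞ → Point} (hc : ∀ p, IsComb (inst a b p) (comb p)) :
    ∫⁻ p, perfRatio ε (inst a b p) (comb p) ∂(Measure.pi fun _ : Fin n => D)
      ≤ ENNReal.ofReal (3 + 6 * ((1 - γ) ^ 2)⁻¹) := by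
  have hm : (0 : ℝ) < 2 ^ m := by positivity
  have hm' : (0 : ℝ) < (2 ^ m)⁻¹ := inv_pos.2 hm
  refine lintegral_perfRatio_le_const h1 h2 hγ1 h hε hm'
    (fun z hz => ⟨(hsub hz).1.1, (hsub hz).2.1⟩) hn (by positivity) hnN ?_ hc
  have hA := hsub (subset_convexHull ℝ _ (by simp) : a ∈ rootTriangle a b)
  have hB := hsub (subset_convexHull ℝ _ (by simp) : b ∈ rootTriangle a b)
  have harea : (root a b).area ≤ 2 ^ m * 2 ^ m := by
    rw [root_area]
    refine mul_le_mul ?_ ?_ (sub_pos.2 h2).le hm.le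
    · linarith [hB.1.2, hA.1.1]
    · linarith [hA.2.2, hB.2.1]
  have e16 : (16 : ℝ) ^ m = 2 ^ m * 2 ^ m * (2 ^ m * 2 ^ m) := by
    rw [← mul_pow, ← mul_pow]; norm_num
  calc (root a b).area / (4 * ε ^ 2 * ((2 ^ m)⁻¹) ^ 2)
      ≤ 2 ^ m * 2 ^ m / (1 * ε ^ 2 * ((2 ^ m)⁻¹) ^ 2) := by gcongr; norm_num
    _ = 16 ^ m / ε ^ 2 := by rw [e16]; field_simp

/-- The bound on the expected ratio that does not depend on the number of points. -/
lemma lintegral_perfRatio_le_of_subset (h1 : a.1 < b.1) (h2 : b.2 < a.2) (ha : 0 < a.1)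
    (hb : 0 < b.2) (hγ1 : γ < 1) (h : IsBalanced γ (rootTriangle a b) D) {B : ℕ}
    (hB : 4 * (2 + ((1 - γ) ^ 2)⁻¹) ^ 4 ≤ (B : ℝ)) {ε : ℝ} (hε : 0 < ε) (hε3 : ε ≤ 1 / 3)
    {m : ℕ} (hm : 1 ≤ m)
    (hsub : rootTriangle a b ⊆
      Set.Icc ((2 : ℝ) ^ m)⁻¹ ((2 : ℝ) ^ m) ×ˢ Set.Icc ((2 : ℝ) ^ m)⁻¹ ((2 : ℝ) ^ m))
    {n : ℕ} {comb : (Fin n → Point) → ℝ≥0∞ → Point} (hc : ∀ p, IsComb (inst a b p) (comb p)) :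
    ∫⁻ p, perfRatio ε (inst a b p) (comb p) ∂(Measure.pi fun _ : Fin n => D)
      ≤ ENNReal.ofReal (19 + 2 * B + 8 * Real.log 10 + (3 + 6 * ((1 - γ) ^ 2)⁻¹)
        + 8 * (Real.log m + Real.log (Real.log (1 / ε)))) := by
  have hm1 : (1 : ℝ) ≤ m := by exact_mod_cast hm
  have hl3 : 1 < Real.log 3 := by
    rw [Real.lt_log_iff_exp_lt (by norm_num)]; exact Real.exp_one_lt_three
  have hε3' : 3 ≤ 1 / ε := by rw [le_div_iff₀ hε]; linarith
  set ℓ := Real.log (1 / ε) with hℓ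
  have hℓ1 : 1 < ℓ := hl3.trans_le (Real.log_le_log (by norm_num) hε3')
  have hlm := Real.log_nonneg hm1
  have hlℓ := Real.log_pos hℓ1
  have hl10 := Real.log_nonneg (by norm_num : (1 : ℝ) ≤ 10)
  have hc0 : 0 ≤ ((1 - γ) ^ 2)⁻¹ := by positivity
  have hB0 : (0 : ℝ) ≤ B := B.cast_nonneg
  -- An upper bound for the ratio of the area of the root triangle, at most `4 ^ m`, to the least
  -- area `4 * ε ^ 2 * (2 ^ m)⁻¹ ^ 2` of a triangle that needs a call.
  set N : ℝ := 16 ^ m / ε ^ 2 with hN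
  have hNpos : 0 < N := by positivity
  have hNexp : N ^ 2 = Real.exp (8 * m * Real.log 2 + 4 * ℓ) := by
    have e1 : 8 * m * Real.log 2 + 4 * ℓ = ((8 * m : ℕ) : ℝ) * Real.log 2 + ((4 : ℕ) : ℝ) * ℓ := by
      push_cast; ring
    rw [e1, Real.exp_add, Real.exp_nat_mul, Real.exp_nat_mul, hℓ, Real.exp_log (by norm_num),
      Real.exp_log (by positivity), hN, div_pow, ← pow_mul, ← pow_mul, pow_mul 2 8 m, one_div,
      inv_pow, ← div_eq_mul_inv, mul_comm m 2, pow_mul 16 2 m]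
    norm_num
  have hl2 := Real.log_two_gt_d9
  have hl2' := Real.log_two_lt_d9
  have hY1 : 1 ≤ 8 * m * Real.log 2 + 4 * ℓ := by nlinarith
  -- With `n ≥ N ^ 2` points the ratio is bounded in expectation. With fewer, `n` is below `exp Y`
  -- for `Y = 8 * m * log 2 + 4 * log (1 / ε)`, and the bound logarithmic in `Y` applies.
  rcases le_or_gt (N ^ 2) n with hn | hn
  · have hn2 : 2 ≤ n := by
      have : Real.exp 1 ≤ n := (Real.exp_le_exp.2 hY1).trans (hNexp ▸ hn)
      have h4 : (1 : ℝ) < n := (Real.one_lt_exp_iff.2 one_pos).trans_le this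
      exact_mod_cast h4
    refine (lintegral_perfRatio_le_const_of_subset h1 h2 hγ1 h hε hsub hn2 hn hc).trans
      (ENNReal.ofReal_le_ofReal (by linarith))
  · refine (lintegral_perfRatio_le_log h1 h2 ha hb hγ1 h hB hε.le hY1 (hNexp ▸ hn.le) hc).trans
      (ENNReal.ofReal_le_ofReal ?_)
    -- As `m` and `ℓ` are at least `1`, the sum is bounded by a product, whose logarithm splits.
    have hle : 8 * m * Real.log 2 + 4 * ℓ ≤ 10 * (m * ℓ) := by nlinarith
    have := Real.log_le_log (by linarith) hle
    rw [Real.log_mul (by norm_num) (by positivity), Real.log_mul (by positivity) (by positivity)]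
      at this
    linarith

end final

end Chord
end

theorem mainTheorem9 (γ : ℝ) (hγ0 : 0 ≤ γ) (hγ1 : γ < 1) :
    ∃ C : ℝ, 0 < C ∧
      ∀ (a b : Chord.Point), 0 < a.1 → a.1 < b.1 → 0 < b.2 → b.2 < a.2 →
      ∀ (D : MeasureTheory.Measure Chord.Point),
        Chord.IsBalanced γ (Chord.rootTriangle a b) D →
      ∀ (ε : ℝ), 0 < ε →
      ∀ (n : ℕ) (comb : (Fin n → Chord.Point) → ℝ≥0∞ → Chord.Point),
        (∀ p, Chord.IsComb (Chord.inst a b p) (comb p)) →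
        -- the performance ratio is a random variable
        AEMeasurable (fun p => Chord.perfRatio ε (Chord.inst a b p) (comb p))
          (MeasureTheory.Measure.pi fun _ : Fin n => D) ∧
        -- its expectation is `O_γ(log log n)`
        (3 ≤ n →
          ∫⁻ p, Chord.perfRatio ε (Chord.inst a b p) (comb p)
              ∂(MeasureTheory.Measure.pi fun _ : Fin n => D)
            ≤ ENNReal.ofReal (C * Real.log (Real.log n))) ∧
        -- and `O_γ(log m + log log (1/ε))`, whatever `n` is, for objectives in `[2^(-m), 2^m]`
        (∀ m : ℕ, 1 ≤ m → ε ≤ 1 / 3 →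
          Chord.rootTriangle a b ⊆
            Set.Icc ((2 : ℝ) ^ m)⁻¹ ((2 : ℝ) ^ m) ×ˢ Set.Icc ((2 : ℝ) ^ m)⁻¹ ((2 : ℝ) ^ m) →
          ∫⁻ p, Chord.perfRatio ε (Chord.inst a b p) (comb p)
              ∂(MeasureTheory.Measure.pi fun _ : Fin n => D)
            ≤ ENNReal.ofReal (C * (Real.log m + Real.log (Real.log (1 / ε))))) := by
  obtain ⟨B, hB⟩ := exists_nat_ge (4 * (2 + ((1 - γ) ^ 2)⁻¹) ^ 4)
  set M : ℝ := 19 + 2 * B + 8 * Real.log 10 + (3 + 6 * ((1 - γ) ^ 2)⁻¹) with hM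
  have hl0 := Chord.log_log_three_pos
  have hl10 := Real.log_nonneg (by norm_num : (1 : ℝ) ≤ 10)
  have hc0 : 0 ≤ ((1 - γ) ^ 2)⁻¹ := by positivity
  have hM0 : 0 ≤ M := by positivity
  -- Both target quantities are at least `log (log 3) > 0`, because `3 ≤ n` and `ε ≤ 1 / 3`; hence
  -- additive constants can be absorbed into the factor.
  have hfin : ∀ Z, Real.log (Real.log 3) ≤ Z →
      M + 8 * Z ≤ (M / Real.log (Real.log 3) + 8) * Z := by
    intro Z hZ
    have : M ≤ M / Real.log (Real.log 3) * Z := by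
      rw [div_mul_eq_mul_div, le_div_iff₀ hl0]
      gcongr
    linarith
  have hl3 : 1 < Real.log 3 := by
    rw [Real.lt_log_iff_exp_lt (by norm_num)]; exact Real.exp_one_lt_three
  refine ⟨M / Real.log (Real.log 3) + 8, by positivity, ?_⟩
  intro a b ha h1 hb h2 D hD ε hε n comb hc
  refine ⟨Chord.aemeasurable_perfRatio h1 h2 ha hb hD hε.le hc, fun hn => ?_,
    fun m hm hε3 hsub => ?_⟩
  · have hn3 : (3 : ℝ) ≤ n := by exact_mod_cast hn
    have hlog := Real.log_le_log (by norm_num) hn3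
    refine (Chord.lintegral_perfRatio_le_log h1 h2 ha hb hγ1 hD hB hε.le (hl3.le.trans hlog)
      (Real.exp_log (by linarith)).ge hc).trans (ENNReal.ofReal_le_ofReal ?_)
    refine le_trans ?_ (hfin _ (Real.log_le_log (by linarith) hlog))
    rw [hM]
    linarith
  · refine (Chord.lintegral_perfRatio_le_of_subset h1 h2 ha hb hγ1 hD hB hε hε3 hm hsub hc).trans
      (ENNReal.ofReal_le_ofReal (hfin _ ?_))
    have hε3' : 3 ≤ 1 / ε := by rw [le_div_iff₀ hε]; linarith
    have := Real.log_le_log (by linarith) (Real.log_le_log (by norm_num) hε3')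
    have := Real.log_nonneg (by exact_mod_cast hm : (1 : ℝ) ≤ m)
    linarith
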